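/- **Setting.** Let $X\subset\mathbb R^d$ be a set of $n$ points such that any two distinct points of $X$ have distance at least $1$ and at most $\Delta$. Let $k\ge 1$ and $z\ge 0$ be integers with $k+z<n$, and let $\varepsilon\in(0,1]$. For a finite set $C\subset\mathbb R^d$ and $\Theta\in(0,\infty]$ put $\phi(x,C)=\min_{c\in C}\|x-c\|^2$ (with $\phi(x,\emptyset)=\infty$), $\tau_\Theta(x,C)=\min(\Theta,\phi(x,C))$, $\phi(Y,C)=\sum_{x\in Y}\phi(x,C)$, $\tau_\Theta(Y,C)=\sum_{x\in Y}\tau_\Theta(x,C)$, and $\mathrm{out}_\Theta(X,C)=\{x\in X:\tau_\Theta(x,C)=\Theta\}$. Let $$\mathrm{OPT}=\min\{\phi(X\setminus O,C') : C'\subset\mathbb R^d,\ |C'|=k,\ O\subseteq X,\ |O|=z\}.$$ **Algorithm (Local-search++ with outliers, with constant $A>0$).** Let $$N=\Big\lceil A\Big(k\,\max\{1,\log\log k\}+\tfrac{k}{\varepsilon}\max\{1,\log(1/\varepsilon)\}\Big)\Big\rceil$$ (the first maximum is $1$ if $k=1$). Start with $C=\emptyset$, $X_{out}=\emptyset$.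 For $i=0,1,\dots,\lceil\log_2(n\Delta^2)\rceil$ do the following, with $\Theta=\frac{300}{\varepsilon}\cdot\frac{2^i}{z}$ ($\Theta=\infty$ if $z=0$). 1. *Seeding:* choose $k$ centers by $k$-means++ with penalty $\Theta$: the first center is uniform in $X$, and each of the following $k-1$ centers is a point $x\in X$ drawn with probability $\tau_\Theta(x,C')/\tau_\Theta(X,C')$, where $C'$ is the set of centers chosen so far. This gives $C_{i,0}$. 2. For $j=1,\dots,N$: draw $c\in X$ with probability $\tau_\Theta(c,C_{i,j-1})/\tau_\Theta(X,C_{i,j-1})$, and let $C_{i,j}$ be $C_{i,j-1}\cup\{c\}$ without the element whose deletion from this set gives the smallest cost $\tau_\Theta(X,\cdot)$. Put $X_{out}^{i,j}=\mathrm{out}_{10\Theta}(X,C_{i,j})$. If $|X_{out}^{i,j}|\le(1+\varepsilon)z$ and $\phi(X\setminus X_{out}^{i,j},C_{i,j})<\phi(X\setminus X_{out},C)$, replace $(C,X_{out})$ by $(C_{i,j},X_{out}^{i,j})$. Return $(C,X_{out})$. **Theorem.** (a) There are absolute constants $A_0,c,p>0$ such that for every $A\ge A_0$, all $d,k,z,\varepsilon,\Delta,X$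 as above and every deterministic rule for choosing a minimizer in case of ties (as a function of the set and of the cost function to be minimized over it), with probability at least $p$ the algorithm returns a set $C$ of exactly $k$ centers and a set $X_{out}\subseteq X$ with $|X_{out}|\le(1+\varepsilon)z$ and $$\phi(X\setminus X_{out},C)\le\frac{c}{\varepsilon}\,\mathrm{OPT}.$$ (b) The algorithm can be implemented in time $\tilde O(nk/\varepsilon)$. Precisely: there are one program $P$ for a randomized real RAM and an integer $q\ge0$ such that for every $A>0$ there is $K>0$ such that, for every input as above (given as an enumeration $x_0,\dots,x_{n-1}$ of $X$ without repetitions), $P$ halts in every run after at most $$K\cdot\frac{nk}{\varepsilon}\cdot\Big(\log\frac{n\Delta}{\varepsilon}\Big)^q$$ steps, and its output has exactly the distribution of the output of the algorithm with constant $A$, for some rule of the above kind for breaking ties. The machine has finitely many two-dimensional arrays of natural numbers and of reals, initially zero except for the inputs $n,k,z,N$ and $\varepsilon,\Delta$; in one step it makes an assignment, a coin flip with a computed real bias, or a test (a comparison) for a branching or a loop. Its expressions are built from constants (natural, respectively rational), memory cells, $+$, truncated $-$ and $\lfloor\cdot/2\rfloor$ on natural numbers, $+,-,\cdot,/$ on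 reals, natural numbers read as reals, and squared distances of two input points, each obtained from an oracle at unit cost. The output $(C,X_{out})$ is stored by flags for the indices of the points. -/

import Mathlib

open scoped ENNReal
open scoped Classical

/-! ### Costs -/

/-- The Euclidean space `ℝ^d`. -/
abbrev Pt (d : ℕ) : Type := EuclideanSpace ℝ (Fin d)

/-- `φ(x, C) = min_{c ∈ C} ‖x - c‖²`; it is `∞` for `C = ∅`. -/
noncomputable def phiPt {d : ℕ} (x : Pt d) (C : Finset (Pt d)) : ℝ≥0∞ :=
  ⨅ c ∈ C, edist x c ^ 2

/-- `φ(X, C) = ∑_{x ∈ X} φ(x, C)`. -/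
noncomputable def phi {d : ℕ} (X C : Finset (Pt d)) : ℝ≥0∞ :=
  ∑ x ∈ X, phiPt x C

/-- `τ_Θ(x, C) = min(Θ, φ(x, C))`. -/
noncomputable def tauPt {d : ℕ} (Θ : ℝ≥0∞) (x : Pt d) (C : Finset (Pt d)) : ℝ≥0∞ :=
  min Θ (phiPt x C)

/-- `τ_Θ(X, C) = ∑_{x ∈ X} τ_Θ(x, C)`. -/
noncomputable def tau {d : ℕ} (Θ : ℝ≥0∞) (X C : Finset (Pt d)) : ℝ≥0∞ :=
  ∑ x ∈ X, tauPt Θ x C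

/-- `out_Θ(X, C)`: the points `x ∈ X` with `τ_Θ(x, C) = Θ`. -/
noncomputable def outPts {d : ℕ} (Θ : ℝ≥0∞) (X C : Finset (Pt d)) : Finset (Pt d) :=
  X.filter fun x => tauPt Θ x C = Θ

/-- The optimal cost of `k`-means with `z` outliers. -/
noncomputable def optCost {d : ℕ} (X : Finset (Pt d)) (k z : ℕ) : ℝ≥0∞ :=
  ⨅ (C : Finset (Pt d)) (_ : C.card = k) (O : Finset (Pt d)) (_ : O ⊆ X ∧ O.card = z),
    phi (X \ O) C

/-- Distinct points of `X` have distance at least `1` and at most `Δ`. -/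
def SpreadBetween {d : ℕ} (X : Finset (Pt d)) (Δ : ℝ) : Prop :=
  ∀ x ∈ X, ∀ y ∈ X, x ≠ y → 1 ≤ dist x y ∧ dist x y ≤ Δ

/-! ### The algorithm -/

/-- The point `y ∈ X` is drawn with probability `w y / ∑_{x ∈ X} w x`. (Only used where the total
weight is positive and finite; otherwise the value is an arbitrary point mass.) -/
noncomputable def sampleBy {d : ℕ} (X : Finset (Pt d)) (w : Pt d → ℝ≥0∞) : PMF (Pt d) :=
  if h : (∑' y, if y ∈ X then w y else 0) ≠ 0 ∧ (∑' y, if y ∈ X then w y else 0) ≠ ∞ then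
    PMF.normalize (fun y => if y ∈ X then w y else 0) h.1 h.2
  else PMF.pure 0

/-- `k`-means++ seeding with penalty `Θ` and `ℓ` centers: the first center is uniform in `X`, each
further one is drawn proportionally to `τ_Θ(·, C)`. -/
noncomputable def kmeansPP {d : ℕ} (X : Finset (Pt d)) (Θ : ℝ≥0∞) : ℕ → PMF (Finset (Pt d))
  | 0 => PMF.pure ∅
  | 1 => (sampleBy X fun _ => 1).map fun c => {c}
  | ℓ + 2 => (kmeansPP X Θ (ℓ + 1)).bind fun C =>
      (sampleBy X fun y => tauPt Θ y C).map fun c => insert c C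

/-- A rule that picks a minimizer of `g` over `S`, that is, a way of breaking the ties. -/
structure ArgminRule (α : Type) where
  pick : Finset α → (α → ℝ≥0∞) → α
  pick_mem : ∀ (S : Finset α) (g : α → ℝ≥0∞), S.Nonempty → pick S g ∈ S
  pick_le : ∀ (S : Finset α) (g : α → ℝ≥0∞), ∀ y ∈ S, g (pick S g) ≤ g y

/-- One local search step: draw `c` proportionally to `τ_Θ(·, C)`, then delete from `C ∪ {c}` the
center whose deletion leaves the smallest cost. -/
noncomputable def localSearchStep {d : ℕ} (am : ArgminRule (Pt d)) (X : Finset (Pt d)) (Θ : ℝ≥0∞)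
    (C : Finset (Pt d)) : PMF (Finset (Pt d)) :=
  (sampleBy X fun y => tauPt Θ y C).map fun c =>
    (insert c C).erase (am.pick (insert c C) fun e => tau Θ X ((insert c C).erase e))

/-- The update of the best solution `best = (C_best, X_out)` found so far by the current centers
`C`, with outliers `out_{10Θ}(X, C)`. -/
noncomputable def keepBest {d : ℕ} (X : Finset (Pt d)) (z : ℕ) (ε : ℝ) (Θ : ℝ≥0∞)
    (C : Finset (Pt d)) (best : Finset (Pt d) × Finset (Pt d)) :
    Finset (Pt d) × Finset (Pt d) :=
  if ((outPts (10 * Θ) X C).card : ℝ) ≤ (1 + ε) * z ∧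
      phi (X \ outPts (10 * Θ) X C) C < phi (X \ best.2) best.1 then
    (C, outPts (10 * Θ) X C)
  else best

/-- `N` local search steps with penalty `Θ`, each followed by the update of the best solution. The
state consists of the current centers and the best solution. -/
noncomputable def innerLoop {d : ℕ} (am : ArgminRule (Pt d)) (X : Finset (Pt d)) (z : ℕ) (ε : ℝ)
    (Θ : ℝ≥0∞) : ℕ → Finset (Pt d) × (Finset (Pt d) × Finset (Pt d)) →
      PMF (Finset (Pt d) × (Finset (Pt d) × Finset (Pt d)))
  | 0, s => PMF.pure s
  | N + 1, s => (innerLoop am X z ε Θ N s).bind fun s' =>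
      (localSearchStep am X Θ s'.1).map fun C => (C, keepBest X z ε Θ C s'.2)

/-- The penalty `Θ = β · 2^i / z`, `β = 300 / ε`, of round `i`; it is `∞` for `z = 0`. -/
noncomputable def penalty (z : ℕ) (ε : ℝ) (i : ℕ) : ℝ≥0∞ :=
  ENNReal.ofReal (300 / ε * 2 ^ i) / z

/-- The round with the guess `2^i` of the optimum. -/
noncomputable def guessRound {d : ℕ} (am : ArgminRule (Pt d)) (X : Finset (Pt d)) (k z : ℕ) (ε : ℝ)
    (N i : ℕ) (best : Finset (Pt d) × Finset (Pt d)) : PMF (Finset (Pt d) × Finset (Pt d)) :=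
  (kmeansPP X (penalty z ε i) k).bind fun C =>
    (innerLoop am X z ε (penalty z ε i) N (C, best)).map fun s => s.2

/-- The first `r` rounds (those with the guesses `2^0, …, 2^(r-1)`), started from the empty
solution, whose cost is `∞`. -/
noncomputable def guessRounds {d : ℕ} (am : ArgminRule (Pt d)) (X : Finset (Pt d)) (k z : ℕ) (ε : ℝ)
    (N : ℕ) : ℕ → PMF (Finset (Pt d) × Finset (Pt d))
  | 0 => PMF.pure (∅, ∅)
  | r + 1 => (guessRounds am X k z ε N r).bind fun best => guessRound am X k z ε N r best

/-- The law of the output `(C, X_out)` of Local-search++ with outliers, with `N` local search steps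
for each of the guesses `2^i`, `0 ≤ i ≤ ⌈log₂(n Δ²)⌉`. -/
noncomputable def localSearchOutliers {d : ℕ} (am : ArgminRule (Pt d)) (X : Finset (Pt d))
    (k z : ℕ) (ε Δ : ℝ) (N : ℕ) : PMF (Finset (Pt d) × Finset (Pt d)) :=
  guessRounds am X k z ε N (⌈Real.logb 2 (X.card * Δ ^ 2)⌉₊ + 1)

/-- The number `O(k log log k + k log(1/ε)/ε)` of local search steps, with the hidden constant `A`.
As usual in this notation, logarithmic factors smaller than `1` are read as `1`. -/
noncomputable def numSteps (A : ℝ) (k : ℕ) (ε : ℝ) : ℕ :=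
  ⌈A * (k * max 1 (Real.log (Real.log k)) + k * max 1 (Real.log (1 / ε)) / ε)⌉₊

/-- `k` centers and at most `(1+ε)z` outliers among `X`, of cost at most `(c/ε)·OPT`. -/
def GoodOutput {d : ℕ} (X : Finset (Pt d)) (k z : ℕ) (ε c : ℝ)
    (o : Finset (Pt d) × Finset (Pt d)) : Prop :=
  o.1.card = k ∧ o.2 ⊆ X ∧ (o.2.card : ℝ) ≤ (1 + ε) * z ∧
    phi (X \ o.2) o.1 ≤ ENNReal.ofReal (c / ε) * optCost X k z

/-! ### A randomized real RAM with a distance oracle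

The memory has an integer part (natural numbers) and a real part. Each part consists of numbered
two-dimensional arrays: the array is named by a literal of the program, the two indices are
computed. Integers can be added, subtracted (truncated) and halved; reals can be added, subtracted,
multiplied and divided, and there is no rounding of reals to integers. The input points are only
accessible through their pairwise squared distances. A coin with a given real bias can be flipped.
Programs are finite, so that an expression in a given program has bounded size; executing an
assignment, a coin flip or the test of a branching or of a loop is one step. -/

/-- Integer expressions. -/
inductive NExpr : Type
  | lit (a : ℕ)
  | load (array : ℕ) (i j : NExpr)
  | add (a b : NExpr)
  | sub (a b : NExpr)
  | half (a : NExpr)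

/-- Real expressions; `sqDist i j` is the squared distance of the `i`-th and `j`-th input points. -/
inductive RExpr : Type
  | lit (q : ℚ)
  | load (array : ℕ) (i j : NExpr)
  | ofNat (a : NExpr)
  | sqDist (i j : NExpr)
  | add (a b : RExpr)
  | sub (a b : RExpr)
  | mul (a b : RExpr)
  | div (a b : RExpr)

/-- Tests. -/
inductive BExpr : Type
  | natLT (a b : NExpr)
  | realLT (a b : RExpr)
  | not (a : BExpr)
  | and (a b : BExpr)

/-- Programs; `flip array i j p` stores `1` with probability `p` (clipped to `[0,1]`) and else `0`
in an integer cell. -/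
inductive Prog : Type
  | skip
  | setNat (array : ℕ) (i j : NExpr) (a : NExpr)
  | setReal (array : ℕ) (i j : NExpr) (a : RExpr)
  | flip (array : ℕ) (i j : NExpr) (p : RExpr)
  | seq (P Q : Prog)
  | ite (b : BExpr) (P Q : Prog)
  | while (b : BExpr) (P : Prog)

/-- The contents of the memory. -/
structure Mem where
  nat : ℕ → ℕ → ℕ → ℕ
  real : ℕ → ℕ → ℕ → ℝ

/-- Writing an integer cell. -/
noncomputable def Mem.setNat (m : Mem) (a i j v : ℕ) : Mem :=
  { m with nat := fun a' i' j' => if a' = a ∧ i' = i ∧ j' = j then v else m.nat a' i' j' }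

/-- Writing a real cell. -/
noncomputable def Mem.setReal (m : Mem) (a i j : ℕ) (v : ℝ) : Mem :=
  { m with real := fun a' i' j' => if a' = a ∧ i' = i ∧ j' = j then v else m.real a' i' j' }

/-- The value of an integer expression. -/
def NExpr.eval (m : Mem) : NExpr → ℕ
  | .lit a => a
  | .load array i j => m.nat array (i.eval m) (j.eval m)
  | .add a b => a.eval m + b.eval m
  | .sub a b => a.eval m - b.eval m
  | .half a => a.eval m / 2

/-- The value of a real expression, where `D` is the oracle for squared distances. -/
noncomputable def RExpr.eval (D : ℕ → ℕ → ℝ) (m : Mem) : RExpr → ℝ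
  | .lit q => q
  | .load array i j => m.real array (i.eval m) (j.eval m)
  | .ofNat a => (a.eval m : ℝ)
  | .sqDist i j => D (i.eval m) (j.eval m)
  | .add a b => a.eval D m + b.eval D m
  | .sub a b => a.eval D m - b.eval D m
  | .mul a b => a.eval D m * b.eval D m
  | .div a b => a.eval D m / b.eval D m

/-- The truth value of a test. -/
def BExpr.holds (D : ℕ → ℕ → ℝ) (m : Mem) : BExpr → Prop
  | .natLT a b => a.eval m < b.eval m
  | .realLT a b => a.eval D m < b.eval D m
  | .not a => ¬ a.holds D m
  | .and a b => a.holds D m ∧ b.holds D m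

/-- A coin that shows `true` with probability `p`, clipped to `[0,1]`. -/
noncomputable def coin (p : ℝ) : PMF Bool :=
  PMF.ofFintype (fun b => cond b (min 1 (ENNReal.ofReal p)) (1 - min 1 (ENNReal.ofReal p)))
    (by simp)

/-- A configuration: the stack of the programs that remain to be executed, and the memory. The
machine has halted when the stack is empty. -/
abbrev Config : Type := List Prog × Mem

/-- One step of the machine. -/
noncomputable def machineStep (D : ℕ → ℕ → ℝ) : Config → PMF Config
  | ([], m) => PMF.pure ([], m)
  | (.skip :: K, m) => PMF.pure (K, m)
  | (.setNat array i j a :: K, m) =>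
      PMF.pure (K, m.setNat array (i.eval m) (j.eval m) (a.eval m))
  | (.setReal array i j a :: K, m) =>
      PMF.pure (K, m.setReal array (i.eval m) (j.eval m) (a.eval D m))
  | (.flip array i j p :: K, m) =>
      (coin (p.eval D m)).map fun b =>
        (K, m.setNat array (i.eval m) (j.eval m) (if b then 1 else 0))
  | (.seq P Q :: K, m) => PMF.pure (P :: Q :: K, m)
  | (.ite b P Q :: K, m) => PMF.pure (if b.holds D m then P :: K else Q :: K, m)
  | (.while b P :: K, m) =>
      PMF.pure (if b.holds D m then P :: .while b P :: K else K, m)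

/-- The law of the configuration after `T` steps. -/
noncomputable def runFor (D : ℕ → ℕ → ℝ) : ℕ → Config → PMF Config
  | 0, s => PMF.pure s
  | T + 1, s => (runFor D T s).bind (machineStep D)

/-- The oracle for the squared distances of the points `x_0, …, x_{n-1}`. -/
noncomputable def sqDistOracle {d n : ℕ} (x : Fin n → Pt d) (i j : ℕ) : ℝ :=
  if h : i < n ∧ j < n then dist (x ⟨i, h.1⟩) (x ⟨j, h.2⟩) ^ 2 else 0

/-- The memory at the start: the integers `n, k, z, N` and the reals `ε, Δ` in the first cells of
the arrays with number `0`, and zeros elsewhere. -/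
noncomputable def inputMem (n k z N : ℕ) (ε Δ : ℝ) : Mem where
  nat a i j :=
    if a = 0 ∧ i = 0 then
      if j = 0 then n else if j = 1 then k else if j = 2 then z else if j = 3 then N else 0
    else 0
  real a i j :=
    if a = 0 ∧ i = 0 then if j = 0 then ε else if j = 1 then Δ else 0 else 0

/-- The output `(C, X_out)` that is stored in the memory, by flags: `x_i` belongs to `C` if the
integer cell `(0, i)` of array `1` contains `1`, and to `X_out` if the cell `(1, i)` of it does. -/
noncomputable def outputOf {d n : ℕ} (x : Fin n → Pt d) (m : Mem) :
    Finset (Pt d) × Finset (Pt d) :=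
  ((Finset.univ.filter fun i : Fin n => m.nat 1 0 i = 1).image x,
    (Finset.univ.filter fun i : Fin n => m.nat 1 1 i = 1).image x)

/-- Started on the input points `x_0, …, x_{n-1}` and the parameters `k, z, ε, Δ, N`, the program
`P` has halted after at most `T` steps in every run, and its output has the law `μ`. -/
def Implements {d n : ℕ} (P : Prog) (x : Fin n → Pt d) (k z N : ℕ) (ε Δ : ℝ) (T : ℕ)
    (μ : PMF (Finset (Pt d) × Finset (Pt d))) : Prop :=
  (∀ s ∈ (runFor (sqDistOracle x) T ([P], inputMem n k z N ε Δ)).support, s.1 = []) ∧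
    (runFor (sqDistOracle x) T ([P], inputMem n k z N ε Δ)).map (fun s => outputOf x s.2) = μ

/-! Guarantee. The penalty turns the outlier constraint into a cost: every point pays at most Θ, so
the z outliers of a solution cost at most B = zΘ. Fix a reference solution of cost P with OPT ≤ P ≤
2·OPT (`exists_nearly_optimal`) and a guess with OPT ≤ 2^i ≤ 2·OPT (`exists_guess`), so that B =
300·2^i/ε if z > 0. If the truncated cost T of the current centers is small in the sense of
`NearOptimal`, then at most z + 65P/Θ ≤ (1+ε)z points have squared distance at least 10Θ, and the
other points cost O(B+P) = O(OPT/ε) (`goodCenters_of_nearOptimal`). The stored solution never gets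
worse, so it suffices that this single round meets such centers with probability 1/2.

Seeding. With penalties, `k`-means++ still has expected cost at most (B+16P)(1+H_k)
(`kmeansPP_expect_le`). The proof follows a potential that counts the covered cost, 16 times the
reference cost of the uncovered clusters, and the average uncovered cost once for each step that
covered no new cluster (`sum_truncSq_mul_seedPotential_le`).

Local search. Every reference center is assigned a current center that can be given up for it
(`exists_charging`). Giving up a center is cheap: an outlier never pays more than Θ, a point whose
reference center is far from all current centers already pays almost Θ or has a large reference
cost, and any other point can move to the current center nearest to its reference center. Sampling
hits a good replacement with probability proportional to the excess cost of a cluster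
(`exists_good_centers`). By Cauchy-Schwarz, while the centers are not near-optimal, a step lowers
the excess E = T − B by at least E²/(256kT) in expectation, with the gain capped at E
(`sq_le_sum_truncSq_mul_min`). As T = E + B, integrating dE/(E²/(kT)) down to the scale m = 64P
suggests about k·(log(E/m) + B/m) steps. This is `hittingPotential`; it is concave, so it drops by 1
per step in expectation (`localSearchStep_expect_add_one_le`). After seeding, E/m is of order (log
k)/ε and B/m of order 1/ε, so the expected potential is at most (N−1)/2, and the failure probability
is at most 1/2 (`innerLoop_expect_le`, `guessRound_expect_le`).

Running time. For every point a tournament tree over all points holds the current centers, keyed by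
closeness. One insertion or deletion of a center costs O(log n) per point. The costs of all k
possible deletions are found together in O(n log n) steps, because deleting a center matters only to
the points it serves (`det_delCostStep`). With O(log) rounds of k + N such steps this gives three
logarithms. The exact output law is tracked by `Wp`, a weakest-precondition judgement in
continuation-passing style that couples an abstract random result with a relation on memories; ties
are broken by the smallest index. -/

/-! ### Expectations over a `PMF` -/

/-- The expectation of a nonnegative function. -/
noncomputable def PMF.expect {α : Type*} (p : PMF α) (f : α → ℝ≥0∞) : ℝ≥0∞ := ∑' a, p a * f a

theorem PMF.expect_pure {α : Type*} (a : α) (f : α → ℝ≥0∞) : (PMF.pure a).expect f = f a := by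
  unfold PMF.expect
  rw [tsum_eq_single a]
  · simp
  · intro b hb
    simp [PMF.pure_apply, hb]

theorem PMF.expect_bind {α β : Type*} (p : PMF α) (q : α → PMF β) (f : β → ℝ≥0∞) :
    (p.bind q).expect f = p.expect fun a => (q a).expect f := by
  unfold PMF.expect
  simp only [PMF.bind_apply, ← ENNReal.tsum_mul_right, ← ENNReal.tsum_mul_left]
  rw [ENNReal.tsum_comm]
  simp only [mul_assoc]

theorem PMF.expect_map {α β : Type*} (p : PMF α) (g : α → β) (f : β → ℝ≥0∞) :
    (p.map g).expect f = p.expect fun a => f (g a) := by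
  have h : p.map g = p.bind fun a => PMF.pure (g a) := rfl
  rw [h, PMF.expect_bind]
  simp only [PMF.expect_pure]

theorem PMF.expect_mono {α : Type*} (p : PMF α) {f g : α → ℝ≥0∞}
    (h : ∀ a ∈ p.support, f a ≤ g a) : p.expect f ≤ p.expect g := by
  refine ENNReal.tsum_le_tsum fun a => ?_
  by_cases ha : a ∈ p.support
  · exact mul_le_mul_right (h a ha) _
  · rw [PMF.mem_support_iff, not_not] at ha
    simp [ha]

theorem PMF.expect_add {α : Type*} (p : PMF α) (f g : α → ℝ≥0∞) :
    p.expect (fun a => f a + g a) = p.expect f + p.expect g := by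
  simp only [PMF.expect, mul_add, ENNReal.tsum_add]

theorem PMF.expect_const_mul {α : Type*} (p : PMF α) (c : ℝ≥0∞) (f : α → ℝ≥0∞) :
    p.expect (fun a => c * f a) = c * p.expect f := by
  simp only [PMF.expect, ← ENNReal.tsum_mul_left]
  exact tsum_congr fun a => by ring

theorem PMF.expect_const {α : Type*} (p : PMF α) (c : ℝ≥0∞) : p.expect (fun _ => c) = c := by
  simp [PMF.expect, ENNReal.tsum_mul_right, p.tsum_coe]

theorem PMF.toOuterMeasure_eq_expect {α : Type*} (p : PMF α) (s : Set α) :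
    p.toOuterMeasure s = p.expect (s.indicator 1) := by
  rw [PMF.toOuterMeasure_apply, PMF.expect]
  refine tsum_congr fun a => ?_
  by_cases ha : a ∈ s <;> simp [ha]

theorem PMF.bind_congr_support {α β : Type*} (p : PMF α) {f g : α → PMF β}
    (h : ∀ a ∈ p.support, f a = g a) : p.bind f = p.bind g := by
  ext b
  simp only [PMF.bind_apply]
  refine tsum_congr fun a => ?_
  by_cases ha : a ∈ p.support
  · rw [h a ha]
  · rw [PMF.mem_support_iff, not_not] at ha
    simp [ha]

/-! ### Weighted sampling -/

section Sampling
variable {d : ℕ}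

theorem tsum_ite_mem_eq_sum (X : Finset (Pt d)) (w : Pt d → ℝ≥0∞) :
    (∑' y, if y ∈ X then w y else 0) = ∑ y ∈ X, w y := by
  rw [tsum_eq_sum (s := X)]
  · exact Finset.sum_congr rfl fun y hy => by simp [hy]
  · intro y hy
    simp [hy]

theorem sampleBy_apply {X : Finset (Pt d)} {w : Pt d → ℝ≥0∞} (h0 : ∑ x ∈ X, w x ≠ 0)
    (h1 : ∑ x ∈ X, w x ≠ ∞) (y : Pt d) :
    sampleBy X w y = (if y ∈ X then w y else 0) * (∑ x ∈ X, w x)⁻¹ := by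
  rw [sampleBy, dif_pos (by rw [tsum_ite_mem_eq_sum]; exact ⟨h0, h1⟩), PMF.normalize_apply,
    tsum_ite_mem_eq_sum]

theorem mem_of_mem_support_sampleBy {X : Finset (Pt d)} {w : Pt d → ℝ≥0∞} (h0 : ∑ x ∈ X, w x ≠ 0)
    (h1 : ∑ x ∈ X, w x ≠ ∞) {y : Pt d} (hy : y ∈ (sampleBy X w).support) : y ∈ X ∧ w y ≠ 0 := by
  rw [PMF.mem_support_iff, sampleBy_apply h0 h1] at hy
  by_cases h : y ∈ X
  · refine ⟨h, fun h2 => hy ?_⟩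
    simp [h, h2]
  · simp [h] at hy

theorem sampleBy_expect {X : Finset (Pt d)} {w : Pt d → ℝ≥0∞} (h0 : ∑ x ∈ X, w x ≠ 0)
    (h1 : ∑ x ∈ X, w x ≠ ∞) (f : Pt d → ℝ≥0∞) :
    (sampleBy X w).expect f = (∑ x ∈ X, w x * f x) * (∑ x ∈ X, w x)⁻¹ := by
  unfold PMF.expect
  simp only [sampleBy_apply h0 h1]
  rw [tsum_eq_sum (s := X)]
  · rw [Finset.sum_mul]
    exact Finset.sum_congr rfl fun y hy => by simp only [hy, if_true]; ring
  · intro y hy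
    simp [hy]

theorem sampleBy_congr {X : Finset (Pt d)} {w w' : Pt d → ℝ≥0∞} (h : ∀ x ∈ X, w x = w' x) :
    sampleBy X w = sampleBy X w' := by
  have : (fun y => if y ∈ X then w y else 0) = fun y => if y ∈ X then w' y else 0 := by
    funext y
    by_cases hy : y ∈ X
    · simp [hy, h y hy]
    · simp [hy]
  unfold sampleBy
  simp only [this]

/-- Used to see the uniform first center as a draw proportional to the cost for the empty set of
centers, where all costs agree. -/
theorem sampleBy_const {X : Finset (Pt d)} (hX : X.Nonempty) {c : ℝ≥0∞} (h0 : c ≠ 0)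
    (h1 : c ≠ ∞) : sampleBy X (fun _ => c) = sampleBy X (fun _ => 1) := by
  have hn : (X.card : ℝ≥0∞) ≠ 0 := by simpa using hX.ne_empty
  ext y
  rw [sampleBy_apply (by simpa using ⟨hX.ne_empty, h0⟩)
    (by simpa using ENNReal.mul_ne_top (by simp) h1),
    sampleBy_apply (by simpa using hX.ne_empty) (by simp)]
  by_cases hy : y ∈ X
  · simp only [hy, if_true, Finset.sum_const, nsmul_eq_mul, mul_one, one_mul]
    rw [ENNReal.mul_inv (Or.inl hn) (Or.inl (by simp)), mul_comm, mul_assoc,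
      ENNReal.inv_mul_cancel h0 h1, mul_one]
  · simp [hy]

/-- A real inequality for a weighted sum gives one for the expectation of a sample. -/
theorem sampleBy_expect_le {X : Finset (Pt d)} {w f : Pt d → ℝ} {b : ℝ} (hw : ∀ x ∈ X, 0 ≤ w x)
    (hpos : 0 < ∑ x ∈ X, w x) (hf : ∀ x ∈ X, 0 ≤ f x)
    (h : ∑ x ∈ X, w x * f x ≤ (∑ x ∈ X, w x) * b) :
    (sampleBy X fun x => ENNReal.ofReal (w x)).expect (fun x => ENNReal.ofReal (f x)) ≤
      ENNReal.ofReal b := by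
  have hs : ∑ x ∈ X, ENNReal.ofReal (w x) = ENNReal.ofReal (∑ x ∈ X, w x) :=
    (ENNReal.ofReal_sum_of_nonneg hw).symm
  have h0 : ∑ x ∈ X, ENNReal.ofReal (w x) ≠ 0 := by
    rw [hs]; simpa using hpos
  have h1 : ∑ x ∈ X, ENNReal.ofReal (w x) ≠ ∞ := by rw [hs]; simp
  rw [sampleBy_expect h0 h1, hs]
  have h2 : ∑ x ∈ X, ENNReal.ofReal (w x) * ENNReal.ofReal (f x) =
      ENNReal.ofReal (∑ x ∈ X, w x * f x) := by
    rw [ENNReal.ofReal_sum_of_nonneg fun x hx => mul_nonneg (hw x hx) (hf x hx)]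
    exact Finset.sum_congr rfl fun x hx => (ENNReal.ofReal_mul (hw x hx)).symm
  rw [h2, ← ENNReal.ofReal_inv_of_pos hpos, ← ENNReal.ofReal_mul' (inv_nonneg.2 hpos.le)]
  refine ENNReal.ofReal_le_ofReal ?_
  rw [← div_eq_mul_inv, div_le_iff₀ hpos]
  linarith

end Sampling

/-! ### Truncated costs as real numbers -/

section Trunc
variable {d : ℕ}

/-- The truncated squared distance to `C`; it is `Θ` for `C = ∅`. -/
noncomputable def truncSq (Θ : ℝ) (x : Pt d) (C : Finset (Pt d)) : ℝ :=
  C.fold min Θ fun c => dist x c ^ 2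

/-- The sum of the truncated squared distances. -/
noncomputable def truncSum (Θ : ℝ) (X C : Finset (Pt d)) : ℝ :=
  ∑ x ∈ X, truncSq Θ x C

theorem truncSq_le {Θ : ℝ} {x : Pt d} {C : Finset (Pt d)} : truncSq Θ x C ≤ Θ :=
  (Finset.fold_min_le _).2 (Or.inl le_rfl)

theorem truncSq_le_dist {Θ : ℝ} {x c : Pt d} {C : Finset (Pt d)} (hc : c ∈ C) :
    truncSq Θ x C ≤ dist x c ^ 2 :=
  (Finset.fold_min_le _).2 (Or.inr ⟨c, hc, le_rfl⟩)

theorem le_truncSq {Θ b : ℝ} {x : Pt d} {C : Finset (Pt d)} :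
    b ≤ truncSq Θ x C ↔ b ≤ Θ ∧ ∀ c ∈ C, b ≤ dist x c ^ 2 :=
  Finset.le_fold_min _

theorem truncSq_nonneg {Θ : ℝ} (hΘ : 0 ≤ Θ) {x : Pt d} {C : Finset (Pt d)} :
    0 ≤ truncSq Θ x C :=
  le_truncSq.2 ⟨hΘ, fun _ _ => sq_nonneg _⟩

theorem truncSq_anti {Θ : ℝ} {x : Pt d} {C C' : Finset (Pt d)} (h : C ⊆ C') :
    truncSq Θ x C' ≤ truncSq Θ x C :=
  le_truncSq.2 ⟨truncSq_le, fun _ hc => truncSq_le_dist (h hc)⟩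

theorem truncSq_empty {Θ : ℝ} {x : Pt d} : truncSq Θ x ∅ = Θ := rfl

theorem truncSq_eq_or (Θ : ℝ) (x : Pt d) (C : Finset (Pt d)) :
    truncSq Θ x C = Θ ∨ ∃ c ∈ C, truncSq Θ x C = dist x c ^ 2 := by
  rcases (Finset.fold_min_le (truncSq Θ x C) (b := Θ) (f := fun c => dist x c ^ 2)
    (s := C)).1 le_rfl with h | ⟨c, hc, h⟩
  · exact Or.inl (le_antisymm truncSq_le h)
  · exact Or.inr ⟨c, hc, le_antisymm (truncSq_le_dist hc) h⟩

theorem truncSq_pos {Θ : ℝ} (hΘ : 0 < Θ) {x : Pt d} {C : Finset (Pt d)} (hx : x ∉ C) :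
    0 < truncSq Θ x C := by
  rcases truncSq_eq_or Θ x C with h | ⟨c, hc, h⟩
  · rwa [h]
  · rw [h]
    have : x ≠ c := fun h => hx (h ▸ hc)
    have := dist_pos.2 this
    positivity

theorem truncSq_eq_zero {Θ : ℝ} (hΘ : 0 ≤ Θ) {x : Pt d} {C : Finset (Pt d)} (hx : x ∈ C) :
    truncSq Θ x C = 0 :=
  le_antisymm ((truncSq_le_dist hx).trans (by simp)) (truncSq_nonneg hΘ)

/-- The relaxed triangle inequality survives truncation: if `x` pays Θ, so at most does `y`;
otherwise compare with the center that serves `x`. -/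
theorem truncSq_le_two_mul {Θ : ℝ} (hΘ : 0 ≤ Θ) (x y : Pt d) (C : Finset (Pt d)) :
    truncSq Θ y C ≤ 2 * truncSq Θ x C + 2 * dist x y ^ 2 := by
  rcases truncSq_eq_or Θ x C with h | ⟨c, hc, h⟩
  · have h1 : truncSq Θ y C ≤ Θ := truncSq_le
    rw [h]
    nlinarith [sq_nonneg (dist x y)]
  · have h1 : truncSq Θ y C ≤ dist y c ^ 2 := truncSq_le_dist hc
    have h2 : dist y c ≤ dist x y + dist x c := dist_triangle_left y c x
    have h3 : dist y c ^ 2 ≤ (dist x y + dist x c) ^ 2 := by gcongr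
    rw [h]
    nlinarith [sq_nonneg (dist x y - dist x c)]

theorem truncSum_nonneg {Θ : ℝ} (hΘ : 0 ≤ Θ) {X C : Finset (Pt d)} : 0 ≤ truncSum Θ X C :=
  Finset.sum_nonneg fun _ _ => truncSq_nonneg hΘ

theorem truncSum_anti {Θ : ℝ} {X C C' : Finset (Pt d)} (h : C ⊆ C') :
    truncSum Θ X C' ≤ truncSum Θ X C :=
  Finset.sum_le_sum fun _ _ => truncSq_anti h

theorem truncSum_pos {Θ : ℝ} (hΘ : 0 < Θ) {X C : Finset (Pt d)} (h : C.card < X.card) :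
    0 < truncSum Θ X C := by
  obtain ⟨x, hx, hxC⟩ := Finset.exists_mem_notMem_of_card_lt_card h
  exact Finset.sum_pos' (fun _ _ => truncSq_nonneg hΘ.le) ⟨x, hx, truncSq_pos hΘ hxC⟩

theorem edist_sq_eq_ofReal (x c : Pt d) : edist x c ^ 2 = ENNReal.ofReal (dist x c ^ 2) := by
  rw [edist_dist, ENNReal.ofReal_pow dist_nonneg]

theorem tauPt_ofReal (Θ : ℝ) (x : Pt d) (C : Finset (Pt d)) :
    tauPt (ENNReal.ofReal Θ) x C = ENNReal.ofReal (truncSq Θ x C) := by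
  refine le_antisymm ?_ ?_
  · rcases truncSq_eq_or Θ x C with h | ⟨c, hc, h⟩
    · rw [h]; exact min_le_left _ _
    · rw [h, ← edist_sq_eq_ofReal]
      exact (min_le_right _ _).trans (iInf₂_le c hc)
  · refine le_min (ENNReal.ofReal_le_ofReal truncSq_le) (le_iInf₂ fun c hc => ?_)
    rw [edist_sq_eq_ofReal]
    exact ENNReal.ofReal_le_ofReal (truncSq_le_dist hc)

theorem phiPt_eq_truncSq {b : ℝ} {x : Pt d} {C : Finset (Pt d)} (hC : C.Nonempty)
    (hb : ∀ c ∈ C, dist x c ^ 2 ≤ b) : phiPt x C = ENNReal.ofReal (truncSq b x C) := by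
  obtain ⟨c₀, hc₀⟩ := hC
  rw [← tauPt_ofReal, tauPt, min_eq_right]
  refine (iInf₂_le c₀ hc₀).trans ?_
  rw [edist_sq_eq_ofReal]
  exact ENNReal.ofReal_le_ofReal (hb c₀ hc₀)

theorem truncSq_eq_min {Θ b : ℝ} {x : Pt d} {C : Finset (Pt d)} (hC : C.Nonempty)
    (hb : ∀ c ∈ C, dist x c ^ 2 ≤ b) : truncSq Θ x C = min Θ (truncSq b x C) := by
  obtain ⟨c₀, hc₀⟩ := hC
  refine le_antisymm (le_min truncSq_le (le_truncSq.2 ⟨?_, fun c hc => truncSq_le_dist hc⟩))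
    (le_truncSq.2 ⟨min_le_left _ _, fun c hc => (min_le_right _ _).trans (truncSq_le_dist hc)⟩)
  exact (truncSq_le_dist hc₀).trans (hb c₀ hc₀)

/-- The real number `Θ'` yields the same truncated costs as the penalty `Θ`, for the sets of centers
that the algorithm meets. -/
def PenaltyEquiv (X : Finset (Pt d)) (Θ : ℝ≥0∞) (Θ' : ℝ) : Prop :=
  0 < Θ' ∧ ∀ C ⊆ X, C.Nonempty → ∀ x ∈ X, tauPt Θ x C = ENNReal.ofReal (truncSq Θ' x C)

theorem PenaltyEquiv.tau_eq {X : Finset (Pt d)} {Θ : ℝ≥0∞} {Θ' : ℝ} (h : PenaltyEquiv X Θ Θ')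
    {C : Finset (Pt d)} (hC : C ⊆ X) (hne : C.Nonempty) :
    tau Θ X C = ENNReal.ofReal (truncSum Θ' X C) := by
  rw [tau, truncSum, ENNReal.ofReal_sum_of_nonneg fun x _ => truncSq_nonneg h.1.le]
  exact Finset.sum_congr rfl fun x hx => h.2 C hC hne x hx

/-- The penalty as a real number. -/
noncomputable def realPenalty (z : ℕ) (ε Δ : ℝ) (i : ℕ) : ℝ :=
  if z = 0 then Δ ^ 2 + 1 else 300 / ε * 2 ^ i / z

theorem penalty_eq_ofReal {z : ℕ} (hz : z ≠ 0) (ε : ℝ) (i : ℕ) :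
    penalty z ε i = ENNReal.ofReal (300 / ε * 2 ^ i / z) := by
  have hz' : (0 : ℝ) < z := by exact_mod_cast Nat.pos_of_ne_zero hz
  rw [penalty, ENNReal.ofReal_div_of_pos hz', ENNReal.ofReal_natCast]

theorem penalty_zero {ε : ℝ} (hε : 0 < ε) (i : ℕ) : penalty 0 ε i = ∞ := by
  rw [penalty, Nat.cast_zero, ENNReal.div_zero]
  have : 0 < 300 / ε * 2 ^ i := by positivity
  simpa using this

theorem SpreadBetween.sq_le {X : Finset (Pt d)} {Δ : ℝ} (h : SpreadBetween X Δ) {x y : Pt d}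
    (hx : x ∈ X) (hy : y ∈ X) : dist x y ^ 2 ≤ Δ ^ 2 := by
  by_cases hxy : x = y
  · simpa [hxy] using sq_nonneg Δ
  · have := (h x hx y hy hxy).2
    gcongr

/-- For z = 0 the penalty is infinite. Truncating at Δ² + 1 then has no effect as long as there is a
center and all centers lie in `X`, so both cases can be treated with a finite real penalty. -/
theorem penaltyEquiv_penalty {X : Finset (Pt d)} {z : ℕ} {ε Δ : ℝ} (hε : 0 < ε)
    (h : SpreadBetween X Δ) (i : ℕ) :
    PenaltyEquiv X (penalty z ε i) (realPenalty z ε Δ i) := by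
  unfold realPenalty
  split_ifs with hz
  · subst hz
    refine ⟨by positivity, fun C hC hne x hx => ?_⟩
    rw [penalty_zero hε, tauPt, top_inf_eq]
    exact phiPt_eq_truncSq hne fun c hc => (h.sq_le hx (hC hc)).trans (by linarith)
  · have hz' : (0 : ℝ) < z := by exact_mod_cast Nat.pos_of_ne_zero hz
    refine ⟨by positivity, fun C _ _ x _ => ?_⟩
    rw [penalty_eq_ofReal hz, tauPt_ofReal]

end Trunc

/-! ### The steps of the algorithm in terms of real weights -/

section Steps
variable {d : ℕ}

/-- A sample with probability proportional to the truncated cost. -/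
noncomputable def sampleTrunc (X : Finset (Pt d)) (Θ : ℝ) (C : Finset (Pt d)) : PMF (Pt d) :=
  sampleBy X fun y => ENNReal.ofReal (truncSq Θ y C)

theorem sum_ofReal_truncSq {X : Finset (Pt d)} {Θ : ℝ} (hΘ : 0 ≤ Θ) (C : Finset (Pt d)) :
    ∑ y ∈ X, ENNReal.ofReal (truncSq Θ y C) = ENNReal.ofReal (truncSum Θ X C) :=
  (ENNReal.ofReal_sum_of_nonneg fun _ _ => truncSq_nonneg hΘ).symm

theorem mem_support_sampleTrunc {X C : Finset (Pt d)} {Θ : ℝ} (hΘ : 0 < Θ)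
    (hC : C.card < X.card) {y : Pt d} (hy : y ∈ (sampleTrunc X Θ C).support) :
    y ∈ X ∧ y ∉ C := by
  have hp := truncSum_pos hΘ hC
  obtain ⟨h1, h2⟩ := mem_of_mem_support_sampleBy (by rw [sum_ofReal_truncSq hΘ.le]; simpa using hp)
    (by rw [sum_ofReal_truncSq hΘ.le]; simp) hy
  refine ⟨h1, fun h => h2 ?_⟩
  simp [truncSq_eq_zero hΘ.le h]

theorem sampleTrunc_expect_le {X C : Finset (Pt d)} {Θ : ℝ} (hΘ : 0 < Θ)
    (hC : C.card < X.card) {f : Pt d → ℝ} {b : ℝ} (hf : ∀ x ∈ X, 0 ≤ f x)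
    (h : ∑ x ∈ X, truncSq Θ x C * f x ≤ truncSum Θ X C * b) :
    (sampleTrunc X Θ C).expect (fun x => ENNReal.ofReal (f x)) ≤ ENNReal.ofReal b :=
  sampleBy_expect_le (fun _ _ => truncSq_nonneg hΘ.le) (truncSum_pos hΘ hC) hf h

theorem kmeansPP_support {X : Finset (Pt d)} {Θ : ℝ≥0∞} {Θ' : ℝ} (h : PenaltyEquiv X Θ Θ')
    {ℓ : ℕ} (hℓ : ℓ ≤ X.card) {C : Finset (Pt d)} (hC : C ∈ (kmeansPP X Θ ℓ).support) :
    C ⊆ X ∧ C.card = ℓ := by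
  induction ℓ using Nat.strong_induction_on generalizing C with
  | _ ℓ ih =>
    match ℓ, ih, hℓ, hC with
    | 0, _, _, hC =>
      have : C = ∅ := by simpa [kmeansPP] using hC
      simp [this]
    | 1, _, hℓ, hC =>
      have hX : X.Nonempty := Finset.card_pos.1 hℓ
      rw [kmeansPP, PMF.support_map] at hC
      obtain ⟨c, hc, rfl⟩ := hC
      have := (mem_of_mem_support_sampleBy (by simpa using hX.ne_empty) (by simp) hc).1
      simpa using this
    | ℓ + 2, ih, hℓ, hC =>
      rw [kmeansPP, PMF.mem_support_bind_iff] at hC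
      obtain ⟨C', hC', hC⟩ := hC
      obtain ⟨h1, h2⟩ := ih (ℓ + 1) (by omega) (by omega) hC'
      have hne : C'.Nonempty := Finset.card_pos.1 (by omega)
      rw [sampleBy_congr (fun y hy => h.2 C' h1 hne y hy), PMF.support_map] at hC
      obtain ⟨c, hc, rfl⟩ := hC
      obtain ⟨h3, h4⟩ := mem_support_sampleTrunc h.1 (by omega) hc
      exact ⟨Finset.insert_subset h3 h1, by simp [h4, h2]⟩

/-- Makes seeding a homogeneous chain started at `∅`, without a special first step. -/
theorem kmeansPP_succ {X : Finset (Pt d)} {Θ : ℝ≥0∞} {Θ' : ℝ} (h : PenaltyEquiv X Θ Θ')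
    (hX : X.Nonempty) {ℓ : ℕ} (hℓ : ℓ < X.card) :
    kmeansPP X Θ (ℓ + 1) =
      (kmeansPP X Θ ℓ).bind fun C => (sampleTrunc X Θ' C).map fun c => insert c C := by
  match ℓ, hℓ with
  | 0, _ =>
    have := h.1
    rw [kmeansPP, kmeansPP, PMF.pure_bind, sampleTrunc]
    simp only [truncSq_empty]
    rw [sampleBy_const hX (c := ENNReal.ofReal Θ') (by simpa using this) (by simp)]
    simp only [insert_empty_eq]
  | ℓ + 1, hℓ =>
    rw [kmeansPP]
    refine PMF.bind_congr_support _ fun C hC => ?_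
    obtain ⟨h1, h2⟩ := kmeansPP_support h (by omega) hC
    rw [sampleTrunc, sampleBy_congr fun y hy => h.2 C h1 (Finset.card_pos.1 (by omega)) y hy]

theorem localSearchStep_eq {X : Finset (Pt d)} {Θ : ℝ≥0∞} {Θ' : ℝ} (h : PenaltyEquiv X Θ Θ')
    (am : ArgminRule (Pt d)) {C : Finset (Pt d)} (hC : C ⊆ X) (hne : C.Nonempty) :
    localSearchStep am X Θ C = (sampleTrunc X Θ' C).map fun c =>
      (insert c C).erase (am.pick (insert c C) fun e => tau Θ X ((insert c C).erase e)) := by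
  rw [localSearchStep, sampleTrunc, sampleBy_congr fun y hy => h.2 C hC hne y hy]

/-- A current center has cost 0 and is never drawn, so the insertion adds a new element and the
deletion restores the cardinality. -/
theorem localSearchStep_support {X : Finset (Pt d)} {Θ : ℝ≥0∞} {Θ' : ℝ} (h : PenaltyEquiv X Θ Θ')
    (am : ArgminRule (Pt d)) {C C' : Finset (Pt d)} (hC : C ⊆ X) (hne : C.Nonempty)
    (hcard : C.card < X.card) (hC' : C' ∈ (localSearchStep am X Θ C).support) :
    C' ⊆ X ∧ C'.card = C.card := by
  rw [localSearchStep_eq h am hC hne, PMF.support_map] at hC'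
  obtain ⟨c, hc, rfl⟩ := hC'
  obtain ⟨h1, h2⟩ := mem_support_sampleTrunc h.1 hcard hc
  refine ⟨(Finset.erase_subset _ _).trans (Finset.insert_subset h1 hC), ?_⟩
  rw [Finset.card_erase_of_mem (am.pick_mem _ _ (Finset.insert_nonempty _ _)),
    Finset.card_insert_of_notMem h2, Nat.add_sub_cancel]

end Steps

/-! ### Clusters and seeding -/

section Clusters
variable {d : ℕ}

/-- The cluster of the points of `X \ O` that are assigned to `i` by `σ`. -/
noncomputable def clusterOf (X O : Finset (Pt d)) (σ : Pt d → Pt d) (i : Pt d) : Finset (Pt d) :=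
  (X \ O).filter fun x => σ x = i

theorem mem_clusterOf {X O : Finset (Pt d)} {σ : Pt d → Pt d} {i x : Pt d} :
    x ∈ clusterOf X O σ i ↔ (x ∈ X ∧ x ∉ O) ∧ σ x = i := by
  simp [clusterOf]

/-- The cost of a cluster with respect to its center. -/
noncomputable def clusterCost (X O : Finset (Pt d)) (σ : Pt d → Pt d) (i : Pt d) : ℝ :=
  ∑ x ∈ clusterOf X O σ i, dist x i ^ 2

theorem clusterCost_nonneg {X O : Finset (Pt d)} {σ : Pt d → Pt d} {i : Pt d} :
    0 ≤ clusterCost X O σ i :=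
  Finset.sum_nonneg fun _ _ => sq_nonneg _

theorem sum_eq_sum_outliers_add_sum_clusters {X O Cs : Finset (Pt d)} {σ : Pt d → Pt d}
    (hO : O ⊆ X) (hσ : ∀ x ∈ X \ O, σ x ∈ Cs) (g : Pt d → ℝ) :
    ∑ x ∈ X, g x = ∑ x ∈ O, g x + ∑ i ∈ Cs, ∑ x ∈ clusterOf X O σ i, g x := by
  rw [← Finset.sum_sdiff hO, add_comm]
  congr 1
  exact (Finset.sum_fiberwise_of_maps_to hσ g).symm

theorem truncSum_eq_outliers_add_clusters {X O Cs : Finset (Pt d)} {σ : Pt d → Pt d}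
    (hO : O ⊆ X) (hσ : ∀ x ∈ X \ O, σ x ∈ Cs) (Θ : ℝ) (C : Finset (Pt d)) :
    truncSum Θ X C = truncSum Θ O C + ∑ i ∈ Cs, truncSum Θ (clusterOf X O σ i) C :=
  sum_eq_sum_outliers_add_sum_clusters hO hσ _

theorem sq_dist_le_two_mul (x y i : Pt d) : dist x y ^ 2 ≤ 2 * dist x i ^ 2 + 2 * dist y i ^ 2 := by
  have h1 : dist x y ≤ dist x i + dist y i := dist_triangle_right x y i
  have h2 : dist x y ^ 2 ≤ (dist x i + dist y i) ^ 2 := by gcongr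
  nlinarith [sq_nonneg (dist x i - dist y i)]

/-- Sampling a center from a cluster proportionally to the current costs yields a constant factor
approximation of the cluster in expectation. -/
theorem sum_truncSq_mul_truncSum_insert_le {Θ : ℝ} (hΘ : 0 ≤ Θ) (Y C : Finset (Pt d)) (i : Pt d) :
    ∑ y ∈ Y, truncSq Θ y C * truncSum Θ Y (insert y C) ≤
      16 * (∑ x ∈ Y, dist x i ^ 2) * truncSum Θ Y C := by
  rcases Y.eq_empty_or_nonempty with rfl | hne
  · simp [truncSum]
  set n : ℝ := (Y.card : ℝ) with hn
  have hn0 : 0 < n := by rw [hn]; exact_mod_cast hne.card_pos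
  set τ := truncSum Θ Y C with hτ
  have hτ0 : 0 ≤ τ := truncSum_nonneg hΘ
  set P := ∑ x ∈ Y, dist x i ^ 2 with hP
  let D : Pt d → ℝ := fun y => ∑ x ∈ Y, dist x y ^ 2
  have hD0 : ∀ y, 0 ≤ D y := fun y => Finset.sum_nonneg fun _ _ => sq_nonneg _
  -- The cost of one point is at most twice the average cost of the cluster plus twice its average
  -- squared distance to the cluster.
  have h1 : ∀ y, n * truncSq Θ y C ≤ 2 * τ + 2 * D y := by
    intro y
    calc n * truncSq Θ y C = ∑ x ∈ Y, truncSq Θ y C := by simp [hn]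
      _ ≤ ∑ x ∈ Y, (2 * truncSq Θ x C + 2 * dist x y ^ 2) :=
          Finset.sum_le_sum fun x _ => truncSq_le_two_mul hΘ x y C
      _ = 2 * τ + 2 * D y := by rw [Finset.sum_add_distrib, ← Finset.mul_sum, ← Finset.mul_sum]; rfl
  have h2 : ∀ y, truncSum Θ Y (insert y C) ≤ τ := fun y =>
    truncSum_anti (Finset.subset_insert _ _)
  have h3 : ∀ y, truncSum Θ Y (insert y C) ≤ D y := fun y =>
    Finset.sum_le_sum fun x _ => truncSq_le_dist (Finset.mem_insert_self _ _)
  have h3' : ∀ y, 0 ≤ truncSum Θ Y (insert y C) := fun y => truncSum_nonneg hΘ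
  have h4 : ∑ y ∈ Y, D y ≤ 4 * n * P := by
    calc ∑ y ∈ Y, D y ≤ ∑ y ∈ Y, ∑ x ∈ Y, (2 * dist x i ^ 2 + 2 * dist y i ^ 2) :=
          Finset.sum_le_sum fun y _ => Finset.sum_le_sum fun x _ => sq_dist_le_two_mul x y i
      _ = 4 * n * P := by
          simp only [Finset.sum_add_distrib, ← Finset.mul_sum, Finset.sum_const, nsmul_eq_mul]
          rw [← hP, ← hn]; ring
  have h5 : n * ∑ y ∈ Y, truncSq Θ y C * truncSum Θ Y (insert y C) ≤ n * (16 * P * τ) := by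
    calc n * ∑ y ∈ Y, truncSq Θ y C * truncSum Θ Y (insert y C)
        = ∑ y ∈ Y, (n * truncSq Θ y C) * truncSum Θ Y (insert y C) := by
          rw [Finset.mul_sum]; exact Finset.sum_congr rfl fun _ _ => by ring
      -- Of the two terms from `h1`, the new cost is bounded by `D y` next to 2τ and by τ next to
      -- 2·`D y`.
      _ ≤ ∑ y ∈ Y, 4 * τ * D y := by
          refine Finset.sum_le_sum fun y _ => ?_
          have := mul_le_mul_of_nonneg_right (h1 y) (h3' y)
          have := mul_le_mul_of_nonneg_left (h3 y) hτ0
          have := mul_le_mul_of_nonneg_left (h2 y) (hD0 y)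
          nlinarith
      _ ≤ n * (16 * P * τ) := by
          rw [← Finset.mul_sum]
          have := mul_le_mul_of_nonneg_left h4 hτ0
          nlinarith
  exact le_of_mul_le_mul_left h5 hn0

/-- The clusters that contain no center of `C`. -/
noncomputable def uncovered (X O Cs : Finset (Pt d)) (σ : Pt d → Pt d) (C : Finset (Pt d)) :
    Finset (Pt d) :=
  Cs.filter fun i => Disjoint C (clusterOf X O σ i)

/-- The cost of the uncovered clusters. -/
noncomputable def uncoveredCost (X O Cs : Finset (Pt d)) (σ : Pt d → Pt d) (Θ : ℝ)
    (C : Finset (Pt d)) : ℝ :=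
  ∑ i ∈ uncovered X O Cs σ C, truncSum Θ (clusterOf X O σ i) C

/-- The potential for the analysis of the seeding. The last summand accounts for the steps in which
no new cluster was covered. -/
noncomputable def seedPotential (X O Cs : Finset (Pt d)) (σ : Pt d → Pt d) (Θ h : ℝ)
    (C : Finset (Pt d)) : ℝ :=
  (truncSum Θ X C - uncoveredCost X O Cs σ Θ C +
      16 * ∑ i ∈ uncovered X O Cs σ C, clusterCost X O σ i) * (1 + h) +
    ((C.card : ℝ) + (uncovered X O Cs σ C).card - Cs.card) * uncoveredCost X O Cs σ Θ C /
      (uncovered X O Cs σ C).card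

variable {X O Cs : Finset (Pt d)} {σ : Pt d → Pt d}

/-- Distinct covered clusters contain distinct centers. The difference of the two sides is the
number of wasted steps, the coefficient in `seedPotential`, which therefore is nonnegative. -/
theorem card_le_card_add_uncovered (C : Finset (Pt d)) :
    Cs.card ≤ C.card + (uncovered X O Cs σ C).card := by
  have h1 : (Cs \ uncovered X O Cs σ C).card ≤ C.card := by
    refine (Finset.card_le_card fun i hi => ?_).trans (Finset.card_image_le (s := C) (f := σ))
    rw [Finset.mem_sdiff, uncovered, Finset.mem_filter, not_and] at hi
    obtain ⟨c, hc, hc'⟩ := Finset.not_disjoint_iff.1 (hi.2 hi.1)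
    exact Finset.mem_image.2 ⟨c, hc, (mem_clusterOf.1 hc').2⟩
  have h2 := Finset.card_sdiff_add_card_eq_card (Finset.filter_subset
    (fun i => Disjoint C (clusterOf X O σ i)) Cs)
  unfold uncovered at h1 ⊢
  omega

theorem uncoveredCost_nonneg {Θ : ℝ} (hΘ : 0 ≤ Θ) (C : Finset (Pt d)) :
    0 ≤ uncoveredCost X O Cs σ Θ C :=
  Finset.sum_nonneg fun _ _ => truncSum_nonneg hΘ

/-- Written as a sum over outliers and covered clusters, the difference visibly decreases when
centers are added and the uncovered clusters stay the same. -/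
theorem truncSum_sub_uncoveredCost (hO : O ⊆ X) (hσ : ∀ x ∈ X \ O, σ x ∈ Cs) (Θ : ℝ)
    (C : Finset (Pt d)) :
    truncSum Θ X C - uncoveredCost X O Cs σ Θ C =
      truncSum Θ O C + ∑ i ∈ Cs \ uncovered X O Cs σ C, truncSum Θ (clusterOf X O σ i) C := by
  rw [truncSum_eq_outliers_add_clusters hO hσ, uncoveredCost,
    ← Finset.sum_sdiff (Finset.filter_subset (fun i => Disjoint C (clusterOf X O σ i)) Cs)]
  unfold uncovered
  ring

theorem uncoveredCost_le (hO : O ⊆ X) (hσ : ∀ x ∈ X \ O, σ x ∈ Cs) {Θ : ℝ} (hΘ : 0 ≤ Θ)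
    (C : Finset (Pt d)) : uncoveredCost X O Cs σ Θ C ≤ truncSum Θ X C := by
  have h := truncSum_sub_uncoveredCost hO hσ Θ C
  have h1 : 0 ≤ truncSum Θ O C := truncSum_nonneg hΘ
  have h2 : 0 ≤ ∑ i ∈ Cs \ uncovered X O Cs σ C, truncSum Θ (clusterOf X O σ i) C :=
    Finset.sum_nonneg fun _ _ => truncSum_nonneg hΘ
  linarith

theorem uncovered_insert_of_mem {C : Finset (Pt d)} {i y : Pt d}
    (hy : y ∈ clusterOf X O σ i) :
    uncovered X O Cs σ (insert y C) = (uncovered X O Cs σ C).erase i := by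
  ext j
  simp only [uncovered, Finset.mem_filter, Finset.mem_erase, Finset.disjoint_insert_left]
  have : y ∈ clusterOf X O σ j ↔ i = j := by
    rw [mem_clusterOf] at hy ⊢
    exact ⟨fun h => hy.2.symm.trans h.2, fun h => ⟨hy.1, hy.2.trans h⟩⟩
  rw [this]
  constructor
  · rintro ⟨h1, h2, h3⟩
    exact ⟨fun h => h2 h.symm, h1, h3⟩
  · rintro ⟨h1, h2, h3⟩
    exact ⟨h2, fun h => h1 h.symm, h3⟩

theorem uncovered_insert_of_outlier {C : Finset (Pt d)} {y : Pt d} (hy : y ∈ O) :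
    uncovered X O Cs σ (insert y C) = uncovered X O Cs σ C := by
  ext j
  simp only [uncovered, Finset.mem_filter, Finset.disjoint_insert_left]
  have : y ∉ clusterOf X O σ j := fun h => (mem_clusterOf.1 h).1.2 hy
  tauto

/-- The potential after the choice of a center that covers no new cluster. -/
theorem seedPotential_insert_of_uncovered_eq (hO : O ⊆ X) (hσ : ∀ x ∈ X \ O, σ x ∈ Cs) {Θ h : ℝ}
    (hh : 0 ≤ h) {C : Finset (Pt d)} {y : Pt d} (hyC : y ∉ C)
    (hU : uncovered X O Cs σ (insert y C) = uncovered X O Cs σ C) :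
    seedPotential X O Cs σ Θ h (insert y C) ≤
      (truncSum Θ X C - uncoveredCost X O Cs σ Θ C +
        16 * ∑ i ∈ uncovered X O Cs σ C, clusterCost X O σ i) * (1 + h) +
      ((C.card : ℝ) + (uncovered X O Cs σ C).card - Cs.card + 1) * uncoveredCost X O Cs σ Θ C /
        (uncovered X O Cs σ C).card := by
  have hw : (Cs.card : ℝ) ≤ C.card + (uncovered X O Cs σ C).card := by
    exact_mod_cast card_le_card_add_uncovered C
  have h1 : uncoveredCost X O Cs σ Θ (insert y C) ≤ uncoveredCost X O Cs σ Θ C := by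
    unfold uncoveredCost
    rw [hU]
    exact Finset.sum_le_sum fun i _ => truncSum_anti (Finset.subset_insert _ _)
  have h2 : truncSum Θ X (insert y C) - uncoveredCost X O Cs σ Θ (insert y C) ≤
      truncSum Θ X C - uncoveredCost X O Cs σ Θ C := by
    rw [truncSum_sub_uncoveredCost hO hσ, truncSum_sub_uncoveredCost hO hσ, hU]
    exact add_le_add (truncSum_anti (Finset.subset_insert _ _))
      (Finset.sum_le_sum fun i _ => truncSum_anti (Finset.subset_insert _ _))
  unfold seedPotential
  rw [hU, Finset.card_insert_of_notMem hyC]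
  push_cast
  have h3 : (C.card : ℝ) + 1 + (uncovered X O Cs σ C).card - Cs.card =
      (C.card : ℝ) + (uncovered X O Cs σ C).card - Cs.card + 1 := by ring
  rw [h3]
  gcongr

/-- The potential after the choice of a center in an uncovered cluster. -/
theorem seedPotential_insert_of_mem (hO : O ⊆ X) (hσ : ∀ x ∈ X \ O, σ x ∈ Cs) {Θ h : ℝ}
    (hh : 0 ≤ h) {C : Finset (Pt d)} {i y : Pt d} (hyC : y ∉ C)
    (hi : i ∈ uncovered X O Cs σ C) (hy : y ∈ clusterOf X O σ i) :
    seedPotential X O Cs σ Θ h (insert y C) ≤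
      (truncSum Θ X C - uncoveredCost X O Cs σ Θ C +
        16 * ∑ i ∈ uncovered X O Cs σ C, clusterCost X O σ i +
        (truncSum Θ (clusterOf X O σ i) (insert y C) - 16 * clusterCost X O σ i)) * (1 + h) +
      ((C.card : ℝ) + (uncovered X O Cs σ C).card - Cs.card) *
        (uncoveredCost X O Cs σ Θ C - truncSum Θ (clusterOf X O σ i) C) /
        ((uncovered X O Cs σ C).card - 1) := by
  have hU := uncovered_insert_of_mem (Cs := Cs) (C := C) hy
  have hw : (Cs.card : ℝ) ≤ C.card + (uncovered X O Cs σ C).card := by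
    exact_mod_cast card_le_card_add_uncovered C
  have hc1 : 1 ≤ (uncovered X O Cs σ C).card := Finset.card_pos.2 ⟨i, hi⟩
  have hc : (((uncovered X O Cs σ C).erase i).card : ℝ) = (uncovered X O Cs σ C).card - 1 := by
    rw [Finset.card_erase_of_mem hi]; push_cast [hc1]; ring
  have hsum : ∑ j ∈ (uncovered X O Cs σ C).erase i, truncSum Θ (clusterOf X O σ j) C =
      uncoveredCost X O Cs σ Θ C - truncSum Θ (clusterOf X O σ i) C := by
    rw [uncoveredCost, ← Finset.sum_erase_add _ _ hi]; ring
  have hsum' : ∑ j ∈ (uncovered X O Cs σ C).erase i, clusterCost X O σ j =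
      ∑ j ∈ uncovered X O Cs σ C, clusterCost X O σ j - clusterCost X O σ i := by
    rw [← Finset.sum_erase_add _ _ hi]; ring
  have h1 : uncoveredCost X O Cs σ Θ (insert y C) ≤
      uncoveredCost X O Cs σ Θ C - truncSum Θ (clusterOf X O σ i) C := by
    rw [← hsum, uncoveredCost, hU]
    exact Finset.sum_le_sum fun i _ => truncSum_anti (Finset.subset_insert _ _)
  have h2 : truncSum Θ X (insert y C) - uncoveredCost X O Cs σ Θ (insert y C) ≤
      truncSum Θ X C - uncoveredCost X O Cs σ Θ C +
        truncSum Θ (clusterOf X O σ i) (insert y C) := by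
    rw [truncSum_sub_uncoveredCost hO hσ, truncSum_sub_uncoveredCost hO hσ, hU]
    have hi' : i ∈ Cs := (Finset.mem_filter.1 hi).1
    have h3 : Cs \ (uncovered X O Cs σ C).erase i = insert i (Cs \ uncovered X O Cs σ C) := by
      rw [Finset.sdiff_erase hi']
    rw [h3, Finset.sum_insert (by simp [hi])]
    have h4 : truncSum Θ O (insert y C) ≤ truncSum Θ O C :=
      truncSum_anti (Finset.subset_insert _ _)
    have h5 : ∑ j ∈ Cs \ uncovered X O Cs σ C, truncSum Θ (clusterOf X O σ j) (insert y C) ≤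
        ∑ j ∈ Cs \ uncovered X O Cs σ C, truncSum Θ (clusterOf X O σ j) C :=
      Finset.sum_le_sum fun i _ => truncSum_anti (Finset.subset_insert _ _)
    linarith
  have hc1' : (1 : ℝ) ≤ (uncovered X O Cs σ C).card := by exact_mod_cast hc1
  unfold seedPotential
  rw [hU, Finset.card_insert_of_notMem hyC, hc, hsum']
  push_cast
  have h3 : (C.card : ℝ) + 1 + ((uncovered X O Cs σ C).card - 1) - Cs.card =
      (C.card : ℝ) + (uncovered X O Cs σ C).card - Cs.card := by ring
  rw [h3]
  have h6 : 0 ≤ (uncovered X O Cs σ C).card - (1 : ℝ) := by linarith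
  have h7 : 0 ≤ (C.card : ℝ) + (uncovered X O Cs σ C).card - Cs.card := by linarith
  refine add_le_add (mul_le_mul_of_nonneg_right (by linarith) (by linarith)) ?_
  exact div_le_div_of_nonneg_right (mul_le_mul_of_nonneg_left h1 h7) h6

/-- The potential is a supermartingale. -/
theorem sum_truncSq_mul_seedPotential_le (hO : O ⊆ X) (hσ : ∀ x ∈ X \ O, σ x ∈ Cs) {Θ h : ℝ}
    (hΘ : 0 ≤ Θ) (hh : 0 ≤ h) {C : Finset (Pt d)} (hC : C.card < Cs.card) :
    ∑ y ∈ X, truncSq Θ y C * seedPotential X O Cs σ Θ h (insert y C) ≤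
      truncSum Θ X C * seedPotential X O Cs σ Θ (h + 1 / (Cs.card - C.card)) C := by
  set U := uncovered X O Cs σ C with hUdef
  set tU := uncoveredCost X O Cs σ Θ C with htU
  set T := truncSum Θ X C with hT
  set A := T - tU + 16 * ∑ i ∈ U, clusterCost X O σ i with hA
  set w : ℝ := (C.card : ℝ) + U.card - Cs.card with hw
  have hw0 : 0 ≤ w := by
    have : (Cs.card : ℝ) ≤ C.card + U.card := by
      exact_mod_cast card_le_card_add_uncovered C
    linarith
  have hk : (0 : ℝ) < Cs.card - C.card := by
    have : (C.card : ℝ) < Cs.card := by exact_mod_cast hC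
    linarith
  have hu : (Cs.card : ℝ) - C.card ≤ U.card := by linarith
  have hu0 : (0 : ℝ) < U.card := hk.trans_le hu
  have hu1 : (1 : ℝ) ≤ U.card := by
    have : 0 < U.card := by exact_mod_cast hu0
    exact_mod_cast this
  have htU0 : 0 ≤ tU := uncoveredCost_nonneg hΘ C
  have htUT : tU ≤ T := uncoveredCost_le hO hσ hΘ C
  have hPU : 0 ≤ ∑ i ∈ U, clusterCost X O σ i := Finset.sum_nonneg fun _ _ => clusterCost_nonneg
  have ht0 : ∀ y, 0 ≤ truncSq Θ y C := fun y => truncSq_nonneg hΘ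
  have htH := truncSum_sub_uncoveredCost hO hσ Θ C
  rw [← hT, ← htU, ← hUdef] at htH
  -- Bound for the new potential after a wasted step, that is, after drawing an outlier or a point
  -- of a covered cluster.
  set R := A * (1 + h) + (w + 1) * tU / U.card with hR
  have hb1 : ∀ y, uncovered X O Cs σ (insert y C) = uncovered X O Cs σ C →
      truncSq Θ y C * seedPotential X O Cs σ Θ h (insert y C) ≤ truncSq Θ y C * R := by
    intro y hy
    by_cases hyC : y ∈ C
    · simp [truncSq_eq_zero hΘ hyC]
    · exact mul_le_mul_of_nonneg_left (seedPotential_insert_of_uncovered_eq (Θ := Θ) hO hσ hh hyC hy)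
        (ht0 y)
  have hS1 : ∑ y ∈ O, truncSq Θ y C * seedPotential X O Cs σ Θ h (insert y C) ≤
      truncSum Θ O C * R := by
    rw [truncSum, Finset.sum_mul]
    exact Finset.sum_le_sum fun y hy => hb1 y (uncovered_insert_of_outlier hy)
  have hS2 : ∑ i ∈ Cs \ U, ∑ y ∈ clusterOf X O σ i,
      truncSq Θ y C * seedPotential X O Cs σ Θ h (insert y C) ≤
      (∑ i ∈ Cs \ U, truncSum Θ (clusterOf X O σ i) C) * R := by
    rw [Finset.sum_mul]
    refine Finset.sum_le_sum fun i hi => ?_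
    rw [truncSum, Finset.sum_mul]
    refine Finset.sum_le_sum fun y hy => hb1 y ?_
    rw [uncovered_insert_of_mem hy, Finset.erase_eq_of_notMem (Finset.mem_sdiff.1 hi).2]
  let τ : Pt d → ℝ := fun i => truncSum Θ (clusterOf X O σ i) C
  have hτU : ∑ i ∈ U, τ i = tU := rfl
  have hτ0 : ∀ i, 0 ≤ τ i := fun i => truncSum_nonneg hΘ
  have hS3 : ∑ i ∈ U, ∑ y ∈ clusterOf X O σ i,
      truncSq Θ y C * seedPotential X O Cs σ Θ h (insert y C) ≤
      tU * (A * (1 + h)) + w * (tU * tU / U.card) := by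
    have h1 : ∀ i ∈ U, ∑ y ∈ clusterOf X O σ i,
        truncSq Θ y C * seedPotential X O Cs σ Θ h (insert y C) ≤
        τ i * (A * (1 + h)) + w * (τ i * (tU - τ i) / (U.card - 1)) := by
      intro i hi
      have h2 : ∑ y ∈ clusterOf X O σ i,
          truncSq Θ y C * seedPotential X O Cs σ Θ h (insert y C) ≤
          ∑ y ∈ clusterOf X O σ i, (truncSq Θ y C * (A * (1 + h) +
            w * (tU - τ i) / (U.card - 1) - 16 * clusterCost X O σ i * (1 + h)) +
            (1 + h) * (truncSq Θ y C * truncSum Θ (clusterOf X O σ i) (insert y C))) := by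
        refine Finset.sum_le_sum fun y hy => ?_
        by_cases hyC : y ∈ C
        · simp [truncSq_eq_zero hΘ hyC]
        · have := mul_le_mul_of_nonneg_left
            (seedPotential_insert_of_mem (Θ := Θ) hO hσ hh hyC hi hy) (ht0 y)
          refine this.trans (le_of_eq ?_)
          rw [← hUdef, ← htU, ← hT, ← hA, ← hw]
          ring
      refine h2.trans ?_
      rw [Finset.sum_add_distrib, ← Finset.sum_mul, ← Finset.mul_sum]
      have h3 := sum_truncSq_mul_truncSum_insert_le hΘ (clusterOf X O σ i) C i
      have h4 := mul_le_mul_of_nonneg_left h3 (by linarith : 0 ≤ 1 + h)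
      have h5 : ∑ y ∈ clusterOf X O σ i, truncSq Θ y C = τ i := rfl
      rw [h5]
      have h6 : ∑ x ∈ clusterOf X O σ i, dist x i ^ 2 = clusterCost X O σ i := rfl
      rw [h6] at h4
      change _ ≤ (1 + h) * (16 * clusterCost X O σ i * τ i) at h4
      have h7 : w * (τ i * (tU - τ i) / (U.card - 1)) = τ i * (w * (tU - τ i) / (U.card - 1)) := by
        ring
      rw [h7]
      linarith
    refine (Finset.sum_le_sum h1).trans ?_
    rw [Finset.sum_add_distrib, ← Finset.sum_mul, hτU, ← Finset.mul_sum, ← Finset.sum_div]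
    refine add_le_add le_rfl (mul_le_mul_of_nonneg_left ?_ hw0)
    have h8 : ∑ i ∈ U, τ i * (tU - τ i) = tU * tU - ∑ i ∈ U, τ i ^ 2 := by
      simp only [mul_sub, Finset.sum_sub_distrib, ← Finset.sum_mul, hτU, sq]
    -- Cauchy-Schwarz: covering a cluster drawn proportionally to its cost does not increase the
    -- average cost of the uncovered clusters in expectation.
    have h9 : tU ^ 2 ≤ U.card * ∑ i ∈ U, τ i ^ 2 := by
      rw [← hτU]; exact sq_sum_le_card_mul_sum_sq
    rw [h8]
    -- If only one cluster is uncovered, the denominator is 0 and the quotient is 0 by convention;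
    -- no uncovered cost remains in that case.
    rcases hu1.eq_or_lt with h10 | h10
    · rw [← h10]
      simp only [sub_self, div_zero]
      positivity
    · rw [div_le_div_iff₀ (by linarith) hu0]
      nlinarith
  rw [sum_eq_sum_outliers_add_sum_clusters hO hσ,
    ← Finset.sum_sdiff (Finset.filter_subset (fun i => Disjoint C (clusterOf X O σ i)) Cs)]
  have hfin : truncSum Θ O C * R + ((∑ i ∈ Cs \ U, truncSum Θ (clusterOf X O σ i) C) * R +
      (tU * (A * (1 + h)) + w * (tU * tU / U.card))) ≤
      T * seedPotential X O Cs σ Θ (h + 1 / (Cs.card - C.card)) C := by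
    unfold seedPotential
    rw [← hUdef, ← htU, ← hT, ← hA, ← hw]
    -- A wasted step has probability (T − tU)/T and adds tU/|U|. Since T − tU ≤ A, tU ≤ T and |U| is
    -- at least the number of centers still to be drawn, the new harmonic summand pays for it.
    have h1 : (T - tU) * (tU / U.card) ≤ A * (T / (Cs.card - C.card)) := by
      refine mul_le_mul (by linarith) ?_ (by positivity) (by linarith)
      exact div_le_div₀ (by linarith) htUT hk hu
    have h2 : truncSum Θ O C * R + ((∑ i ∈ Cs \ U, truncSum Θ (clusterOf X O σ i) C) * R +
      (tU * (A * (1 + h)) + w * (tU * tU / U.card))) =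
      (T - tU) * R + (tU * (A * (1 + h)) + w * (tU * tU / U.card)) := by rw [htH]; ring
    rw [h2, hR]
    have h3 : T * (A * (1 + (h + 1 / (Cs.card - C.card))) + w * tU / U.card) =
      T * A * (1 + h) + A * (T / (Cs.card - C.card)) + T * w * (tU / U.card) := by ring
    rw [h3]
    have h4 : (T - tU) * (A * (1 + h) + (w + 1) * tU / U.card) +
      (tU * (A * (1 + h)) + w * (tU * tU / U.card)) = T * A * (1 + h) +
      (T - tU) * (tU / U.card) + T * w * (tU / U.card) := by ring
    rw [h4]
    linarith
  refine le_trans ?_ hfin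
  exact add_le_add hS1 (add_le_add hS2 hS3)

theorem seedPotential_nonneg (hO : O ⊆ X) (hσ : ∀ x ∈ X \ O, σ x ∈ Cs) {Θ h : ℝ}
    (hΘ : 0 ≤ Θ) (hh : 0 ≤ h) (C : Finset (Pt d)) : 0 ≤ seedPotential X O Cs σ Θ h C := by
  have h1 := uncoveredCost_le hO hσ hΘ C
  have h2 : (Cs.card : ℝ) ≤ C.card + (uncovered X O Cs σ C).card := by
    exact_mod_cast card_le_card_add_uncovered C
  have h3 : 0 ≤ ∑ i ∈ uncovered X O Cs σ C, clusterCost X O σ i :=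
    Finset.sum_nonneg fun _ _ => clusterCost_nonneg
  have h4 : 0 ≤ uncoveredCost X O Cs σ Θ C := uncoveredCost_nonneg hΘ C
  exact add_nonneg (mul_nonneg (by linarith) (by linarith))
    (div_nonneg (mul_nonneg (by linarith) h4) (by positivity))

/-- When all centers have been drawn, there are as many wasted steps as uncovered clusters, so the
last summand of the potential is the whole uncovered cost. -/
theorem truncSum_le_seedPotential {Θ : ℝ} {C : Finset (Pt d)} (hC : C.card = Cs.card) :
    truncSum Θ X C ≤ seedPotential X O Cs σ Θ 0 C := by
  have h3 : 0 ≤ ∑ i ∈ uncovered X O Cs σ C, clusterCost X O σ i :=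
    Finset.sum_nonneg fun _ _ => clusterCost_nonneg
  unfold seedPotential
  rw [hC, add_sub_cancel_left]
  by_cases h : uncovered X O Cs σ C = ∅
  · simp [h, uncoveredCost]
  · have : ((uncovered X O Cs σ C).card : ℝ) ≠ 0 := by simpa using h
    rw [mul_div_assoc, mul_div_cancel₀ _ this]
    linarith

theorem seedPotential_empty (hO : O ⊆ X) (hσ : ∀ x ∈ X \ O, σ x ∈ Cs) {Θ h : ℝ} :
    seedPotential X O Cs σ Θ h ∅ =
      (O.card * Θ + 16 * ∑ i ∈ Cs, clusterCost X O σ i) * (1 + h) := by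
  have hU : uncovered X O Cs σ ∅ = Cs := by simp [uncovered]
  unfold seedPotential
  rw [truncSum_sub_uncoveredCost hO hσ, hU]
  simp [truncSum, truncSq_empty]

/-- The expected cost after `k`-means++ seeding with penalties. -/
theorem kmeansPP_expect_le (hO : O ⊆ X) (hσ : ∀ x ∈ X \ O, σ x ∈ Cs) {Θ : ℝ≥0∞} {Θ' : ℝ}
    (h : PenaltyEquiv X Θ Θ') (hk : Cs.card < X.card) :
    (kmeansPP X Θ Cs.card).expect (fun C => ENNReal.ofReal (truncSum Θ' X C)) ≤
      ENNReal.ofReal ((O.card * Θ' + 16 * ∑ i ∈ Cs, clusterCost X O σ i) *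
        (1 + (harmonic Cs.card : ℝ))) := by
  have key : ∀ ℓ ≤ Cs.card, (kmeansPP X Θ ℓ).expect (fun C => ENNReal.ofReal
      (seedPotential X O Cs σ Θ' (harmonic (Cs.card - ℓ) : ℝ) C)) ≤
      ENNReal.ofReal ((O.card * Θ' + 16 * ∑ i ∈ Cs, clusterCost X O σ i) *
        (1 + (harmonic Cs.card : ℝ))) := by
    intro ℓ
    induction ℓ with
    | zero =>
      intro _
      rw [kmeansPP, PMF.expect_pure, seedPotential_empty hO hσ, Nat.sub_zero]
    | succ ℓ ih =>
      intro hℓ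
      refine le_trans ?_ (ih (by omega))
      rw [kmeansPP_succ h (Finset.card_pos.1 (by omega)) (by omega), PMF.expect_bind]
      refine PMF.expect_mono _ fun C hC => ?_
      obtain ⟨h1, h2⟩ := kmeansPP_support h (by omega) hC
      have hh : (0 : ℝ) ≤ harmonic (Cs.card - (ℓ + 1)) := by
        rw [harmonic]; push_cast; positivity
      rw [PMF.expect_map]
      refine sampleTrunc_expect_le h.1 (by omega)
        (fun x _ => seedPotential_nonneg hO hσ h.1.le hh _) ?_
      have h3 := sum_truncSq_mul_seedPotential_le hO hσ h.1.le hh (C := C) (by omega)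
      refine h3.trans (le_of_eq ?_)
      congr 2
      have h4 : Cs.card - ℓ = (Cs.card - (ℓ + 1)) + 1 := by omega
      rw [h4, harmonic_succ, h2]
      push_cast [hℓ]
      rw [one_div]
      congr 2
      ring
  refine le_trans (PMF.expect_mono _ fun C hC => ?_) (key Cs.card le_rfl)
  obtain ⟨_, h2⟩ := kmeansPP_support h hk.le hC
  rw [Nat.sub_self, harmonic_zero, Rat.cast_zero]
  exact ENNReal.ofReal_le_ofReal (truncSum_le_seedPotential h2)

end Clusters

/-! ### One step of local search -/

section Nearest
variable {d : ℕ}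

/-- A center of `C` that is nearest to `x`. -/
noncomputable def nearest (C : Finset (Pt d)) (x : Pt d) : Pt d :=
  if h : C.Nonempty then (Finset.exists_min_image C (fun c => dist x c) h).choose else 0

theorem nearest_mem {C : Finset (Pt d)} (h : C.Nonempty) (x : Pt d) : nearest C x ∈ C := by
  rw [nearest, dif_pos h]
  exact (Finset.exists_min_image C (fun c => dist x c) h).choose_spec.1

theorem dist_nearest_le {C : Finset (Pt d)} {c : Pt d} (hc : c ∈ C) (x : Pt d) :
    dist x (nearest C x) ≤ dist x c := by
  rw [nearest, dif_pos ⟨c, hc⟩]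
  exact (Finset.exists_min_image C (fun c => dist x c) ⟨c, hc⟩).choose_spec.2 c hc

theorem truncSq_eq_min_nearest {C : Finset (Pt d)} (h : C.Nonempty) (Θ : ℝ) (x : Pt d) :
    truncSq Θ x C = min Θ (dist x (nearest C x) ^ 2) := by
  refine le_antisymm (le_min truncSq_le (truncSq_le_dist (nearest_mem h x)))
    (le_truncSq.2 ⟨min_le_left _ _, fun c hc => (min_le_right _ _).trans ?_⟩)
  have := dist_nearest_le hc x
  gcongr

theorem phiPt_eq_nearest {C : Finset (Pt d)} (h : C.Nonempty) (x : Pt d) :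
    phiPt x C = ENNReal.ofReal (dist x (nearest C x) ^ 2) := by
  rw [← edist_sq_eq_ofReal]
  refine le_antisymm (iInf₂_le _ (nearest_mem h x)) (le_iInf₂ fun c hc => ?_)
  rw [edist_sq_eq_ofReal, edist_sq_eq_ofReal]
  have := dist_nearest_le hc x
  gcongr

/-- The center `i` is far from `C`, compared to the penalty. -/
def IsFar (Θ : ℝ) (C : Finset (Pt d)) (i : Pt d) : Prop := 4 * Θ ≤ dist i (nearest C i) ^ 2

/-- A bound for the increase of the cost of `x` when its center is deleted. -/
noncomputable def swapCharge (Θ : ℝ) (O : Finset (Pt d)) (σ : Pt d → Pt d) (C : Finset (Pt d))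
    (x : Pt d) : ℝ :=
  if x ∈ O then Θ - truncSq Θ x C
  else if IsFar Θ C (σ x) then dist x (σ x) ^ 2
  else truncSq Θ x C / 4 + 20 * dist x (σ x) ^ 2

/-- The sum of the charges of the points that are served by `c`. -/
noncomputable def centerCharge (Θ : ℝ) (X O : Finset (Pt d)) (σ : Pt d → Pt d)
    (C : Finset (Pt d)) (c : Pt d) : ℝ :=
  ∑ x ∈ X.filter fun x => nearest C x = c, swapCharge Θ O σ C x

variable {X O Cs : Finset (Pt d)} {σ : Pt d → Pt d}

theorem swapCharge_nonneg {Θ : ℝ} (hΘ : 0 ≤ Θ) (C : Finset (Pt d)) (x : Pt d) :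
    0 ≤ swapCharge Θ O σ C x := by
  have h1 : truncSq Θ x C ≤ Θ := truncSq_le
  have h2 : 0 ≤ truncSq Θ x C := truncSq_nonneg hΘ
  unfold swapCharge
  split_ifs
  · linarith
  · positivity
  · positivity

theorem centerCharge_nonneg {Θ : ℝ} (hΘ : 0 ≤ Θ) (C : Finset (Pt d)) (c : Pt d) :
    0 ≤ centerCharge Θ X O σ C c :=
  Finset.sum_nonneg fun _ _ => swapCharge_nonneg hΘ C _

/-- Each point is charged to exactly one center, so the charges can be regrouped by outliers and
reference clusters. -/
theorem sum_centerCharge (hO : O ⊆ X) (hσ : ∀ x ∈ X \ O, σ x ∈ Cs) (Θ : ℝ)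
    {C : Finset (Pt d)} (hC : C.Nonempty) :
    ∑ c ∈ C, centerCharge Θ X O σ C c = (O.card * Θ - truncSum Θ O C) +
      ∑ i ∈ Cs, if IsFar Θ C i then clusterCost X O σ i
        else truncSum Θ (clusterOf X O σ i) C / 4 + 20 * clusterCost X O σ i := by
  unfold centerCharge
  rw [Finset.sum_fiberwise_of_maps_to fun x _ => nearest_mem hC x,
    sum_eq_sum_outliers_add_sum_clusters hO hσ]
  congr 1
  · rw [Finset.sum_congr rfl fun x hx => by rw [swapCharge, if_pos hx]]
    simp [truncSum]
  · refine Finset.sum_congr rfl fun i _ => ?_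
    split_ifs with h
    · refine Finset.sum_congr rfl fun x hx => ?_
      obtain ⟨⟨_, h1⟩, rfl⟩ := mem_clusterOf.1 hx
      rw [swapCharge, if_neg h1, if_pos h]
    · rw [truncSum, clusterCost, Finset.sum_div, Finset.mul_sum, ← Finset.sum_add_distrib]
      refine Finset.sum_congr rfl fun x hx => ?_
      obtain ⟨⟨_, h1⟩, rfl⟩ := mem_clusterOf.1 hx
      rw [swapCharge, if_neg h1, if_neg h]

/-- Let `x` lose its center, at distance b with b² ≤ Θ, and let a be its distance to its reference
center. If that center is far, then 4Θ ≤ (a+b)², so paying Θ costs at most a² more than b².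
Otherwise `x` moves to the current center nearest to its reference center, at distance at most 2a+b,
and (2a+b)² ≤ b² + b²/4 + 20a². The admissibility of `c` says that this replacement is not `c`
itself. -/
theorem truncSq_swap_le {Θ : ℝ} (hΘ : 0 ≤ Θ) {C : Finset (Pt d)} (hC : C.Nonempty) {c i x y : Pt d}
    (hadm : ∀ j ∈ Cs, ¬ IsFar Θ C j → j ≠ i → nearest C j ≠ c) (hx : x ∈ O ∨ σ x ∈ Cs)
    (hxi : x ∈ O ∨ σ x ≠ i) :
    truncSq Θ x (insert y (C.erase c)) ≤
      truncSq Θ x C + if nearest C x = c then swapCharge Θ O σ C x else 0 := by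
  have ht : truncSq Θ x C = min Θ (dist x (nearest C x) ^ 2) := truncSq_eq_min_nearest hC Θ x
  have hle : truncSq Θ x (insert y (C.erase c)) ≤ Θ := truncSq_le
  split_ifs with hc
  · have h0 := swapCharge_nonneg (O := O) (σ := σ) hΘ C x
    rcases le_total Θ (dist x (nearest C x) ^ 2) with h1 | h1
    · rw [min_eq_left h1] at ht
      linarith
    rw [min_eq_right h1] at ht
    by_cases hxO : x ∈ O
    · rw [swapCharge, if_pos hxO]; linarith
    rw [swapCharge, if_neg hxO]
    have hσx := hx.resolve_left hxO
    have hσi := hxi.resolve_left hxO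
    have htri : dist (σ x) (nearest C (σ x)) ≤ dist x (σ x) + dist x (nearest C x) :=
      (dist_nearest_le (nearest_mem hC x) (σ x)).trans (dist_triangle_left _ _ _)
    split_ifs with hF
    · have h2 : dist (σ x) (nearest C (σ x)) ^ 2 ≤ (dist x (σ x) + dist x (nearest C x)) ^ 2 := by
        gcongr
      have h3 : 4 * Θ ≤ (dist x (σ x) + dist x (nearest C x)) ^ 2 := le_trans hF h2
      nlinarith [sq_nonneg (dist x (σ x) - dist x (nearest C x)), sq_nonneg (dist x (nearest C x))]
    · have h2 : nearest C (σ x) ∈ C.erase c :=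
        Finset.mem_erase.2 ⟨hadm _ hσx hF hσi, nearest_mem hC _⟩
      have h3 : truncSq Θ x (insert y (C.erase c)) ≤ dist x (nearest C (σ x)) ^ 2 :=
        truncSq_le_dist (Finset.mem_insert_of_mem h2)
      have h4 : dist x (nearest C (σ x)) ≤ 2 * dist x (σ x) + dist x (nearest C x) := by
        have := dist_triangle x (σ x) (nearest C (σ x))
        linarith
      have h5 : dist x (nearest C (σ x)) ^ 2 ≤ (2 * dist x (σ x) + dist x (nearest C x)) ^ 2 := by
        gcongr
      rw [ht]
      nlinarith [sq_nonneg (8 * dist x (σ x) - dist x (nearest C x))]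
  · rw [add_zero, ht]
    exact le_min hle (truncSq_le_dist (Finset.mem_insert_of_mem
      (Finset.mem_erase.2 ⟨hc, nearest_mem hC x⟩)))

/-- The cost after the exchange of `c` for a point `y`, if no center that is not far from `C`,
except possibly `i`, is served by `c`. -/
theorem truncSum_swap_le (hσ : ∀ x ∈ X \ O, σ x ∈ Cs) {Θ : ℝ} (hΘ : 0 ≤ Θ)
    {C : Finset (Pt d)} (hC : C.Nonempty) {c i y : Pt d}
    (hadm : ∀ j ∈ Cs, ¬ IsFar Θ C j → j ≠ i → nearest C j ≠ c) :
    truncSum Θ X (insert y (C.erase c)) ≤ truncSum Θ X C + centerCharge Θ X O σ C c -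
      truncSum Θ (clusterOf X O σ i) C + ∑ x ∈ clusterOf X O σ i, dist x y ^ 2 := by
  have hsub : clusterOf X O σ i ⊆ X := fun x hx => (mem_clusterOf.1 hx).1.1
  have h1 : ∑ x ∈ X \ clusterOf X O σ i, truncSq Θ x (insert y (C.erase c)) ≤
      ∑ x ∈ X \ clusterOf X O σ i,
        (truncSq Θ x C + if nearest C x = c then swapCharge Θ O σ C x else 0) := by
    refine Finset.sum_le_sum fun x hx => ?_
    rw [Finset.mem_sdiff, mem_clusterOf] at hx
    refine truncSq_swap_le (Cs := Cs) hΘ hC hadm ?_ ?_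
    · by_cases h : x ∈ O
      · exact Or.inl h
      · exact Or.inr (hσ x (Finset.mem_sdiff.2 ⟨hx.1, h⟩))
    · by_cases h : x ∈ O
      · exact Or.inl h
      · exact Or.inr fun h2 => hx.2 ⟨⟨hx.1, h⟩, h2⟩
  have h2 : ∑ x ∈ clusterOf X O σ i, truncSq Θ x (insert y (C.erase c)) ≤
      ∑ x ∈ clusterOf X O σ i, dist x y ^ 2 :=
    Finset.sum_le_sum fun x _ => truncSq_le_dist (Finset.mem_insert_self _ _)
  have h3 : ∑ x ∈ X \ clusterOf X O σ i, (if nearest C x = c then swapCharge Θ O σ C x else 0) ≤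
      centerCharge Θ X O σ C c := by
    rw [centerCharge, Finset.sum_filter]
    refine Finset.sum_le_sum_of_subset_of_nonneg Finset.sdiff_subset fun x _ _ => ?_
    split_ifs
    · exact swapCharge_nonneg hΘ C x
    · exact le_rfl
  rw [Finset.sum_add_distrib] at h1
  have h4 := Finset.sum_sdiff hsub (f := fun x => truncSq Θ x (insert y (C.erase c)))
  have h5 := Finset.sum_sdiff hsub (f := fun x => truncSq Θ x C)
  unfold truncSum
  linarith

/-- At least a quarter of the excess cost of a cluster is carried by points that are good centers
of it. -/
theorem exists_good_centers {Θ : ℝ} (hΘ : 0 ≤ Θ) (Y C : Finset (Pt d)) (i : Pt d) :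
    ∃ S ⊆ Y, (∀ y ∈ S, ∑ x ∈ Y, dist x y ^ 2 ≤ 6 * ∑ x ∈ Y, dist x i ^ 2) ∧
      truncSum Θ Y C - 12 * ∑ x ∈ Y, dist x i ^ 2 ≤ 4 * ∑ y ∈ S, truncSq Θ y C := by
  set P := ∑ x ∈ Y, dist x i ^ 2 with hP
  have hP0 : 0 ≤ P := Finset.sum_nonneg fun _ _ => sq_nonneg _
  set n : ℝ := (Y.card : ℝ) with hn
  have hn0 : 0 ≤ n := Nat.cast_nonneg _
  -- By Markov's inequality at least half of the cluster lies within twice the mean squared distance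
  -- from the center. Such a point serves the cluster at cost at most 2P + 4P.
  let S := Y.filter fun y => n * dist y i ^ 2 ≤ 2 * P
  have hS : ∀ y ∈ S, ∑ x ∈ Y, dist x y ^ 2 ≤ 6 * P := by
    intro y hy
    have h1 : n * dist y i ^ 2 ≤ 2 * P := (Finset.mem_filter.1 hy).2
    calc ∑ x ∈ Y, dist x y ^ 2 ≤ ∑ x ∈ Y, (2 * dist x i ^ 2 + 2 * dist y i ^ 2) :=
          Finset.sum_le_sum fun x _ => sq_dist_le_two_mul x y i
      _ = 2 * P + 2 * (n * dist y i ^ 2) := by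
          simp only [Finset.sum_add_distrib, ← Finset.mul_sum, Finset.sum_const, nsmul_eq_mul]
          rw [← hP, ← hn]
      _ ≤ 6 * P := by linarith
  refine ⟨S, Finset.filter_subset _ _, hS, ?_⟩
  -- A good center is itself expensive under `C`: otherwise the whole cluster would be served well
  -- through it.
  have ht : ∀ y ∈ S, truncSum Θ Y C - 12 * P ≤ 2 * n * truncSq Θ y C := by
    intro y hy
    have h1 : truncSum Θ Y C ≤ ∑ x ∈ Y, (2 * truncSq Θ y C + 2 * dist x y ^ 2) := by
      refine Finset.sum_le_sum fun x _ => ?_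
      have := truncSq_le_two_mul hΘ y x C
      rwa [dist_comm y x] at this
    rw [Finset.sum_add_distrib, Finset.sum_const, nsmul_eq_mul, ← hn, ← Finset.mul_sum] at h1
    have := hS y hy
    linarith
  rcases le_or_gt (truncSum Θ Y C - 12 * P) 0 with hneg | hpos
  · exact hneg.trans (mul_nonneg (by norm_num) (Finset.sum_nonneg fun _ _ => truncSq_nonneg hΘ))
  have hYne : Y.Nonempty := by
    by_contra h
    rw [Finset.not_nonempty_iff_eq_empty] at h
    simp [h, truncSum] at hpos
    linarith
  have hn1 : 0 < n := by rw [hn]; exact_mod_cast hYne.card_pos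
  have hcount : n ≤ 2 * S.card := by
    let B := Y.filter fun y => ¬ n * dist y i ^ 2 ≤ 2 * P
    have hSB : (S.card : ℝ) + B.card = n := by
      rw [hn, ← Finset.card_filter_add_card_filter_not (s := Y) fun y => n * dist y i ^ 2 ≤ 2 * P]
      push_cast; rfl
    rcases B.eq_empty_or_nonempty with hB | hB
    · rw [hB] at hSB
      simp at hSB
      linarith
    · have h1 : ∑ y ∈ B, 2 * P < ∑ y ∈ B, n * dist y i ^ 2 :=
        Finset.sum_lt_sum_of_nonempty hB fun y hy => not_le.1 (Finset.mem_filter.1 hy).2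
      have h2 : ∑ y ∈ B, n * dist y i ^ 2 ≤ n * P := by
        rw [← Finset.mul_sum]
        exact mul_le_mul_of_nonneg_left (Finset.sum_le_sum_of_subset_of_nonneg
          (Finset.filter_subset _ _) fun _ _ _ => sq_nonneg _) hn0
      rw [Finset.sum_const, nsmul_eq_mul] at h1
      have h3 : (B.card : ℝ) * 2 * P < n * P := by linarith
      have h4 : (B.card : ℝ) * 2 < n := lt_of_mul_lt_mul_right h3 hP0
      linarith
  have h1 : S.card * (truncSum Θ Y C - 12 * P) ≤ 2 * n * ∑ y ∈ S, truncSq Θ y C := by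
    have := Finset.sum_le_sum ht
    rwa [← Finset.mul_sum, Finset.sum_const, nsmul_eq_mul] at this
  have h2 : n * (truncSum Θ Y C - 12 * P) ≤ n * (4 * ∑ y ∈ S, truncSq Θ y C) := by
    nlinarith
  exact le_of_mul_le_mul_left h2 hn1

end Nearest

/-- Every `i` can be assigned a `c` to be exchanged in such a way that the charges add up. -/
theorem exists_charging {α β : Type*} {I : Finset α} {C : Finset β} (hcard : I.card = C.card)
    (far : α → Prop) {f : α → β} (hf : ∀ i ∈ I, f i ∈ C) {ρ : β → ℝ} (hρ : ∀ c ∈ C, 0 ≤ ρ c) :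
    ∃ g : α → β, (∀ i ∈ I, g i ∈ C ∧ ∀ j ∈ I, ¬ far j → j ≠ i → f j ≠ g i) ∧
      ∑ i ∈ I, (if far i then 1 else 1 / 2) * ρ (g i) ≤ ∑ c ∈ C, ρ c := by
  -- `H` holds the non-far elements that are the only non-far preimage of their image, `G` those
  -- that share it, and `L` the elements of `C` that are the image of no non-far element. An element
  -- of `H` may take its own image, and any element may take a member of `L`.
  let N := I.filter fun i => ¬ far i
  let H := N.filter fun i => ∀ j ∈ N, f j = f i → j = i
  let G := N.filter fun i => ¬ ∀ j ∈ N, f j = f i → j = i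
  let F := I.filter fun i => far i
  let L := C \ N.image f
  have hNI : N ⊆ I := Finset.filter_subset _ _
  have hHN : H ⊆ N := Finset.filter_subset _ _
  have himg : N.image f ⊆ C := Finset.image_subset_iff.2 fun i hi => hf i (hNI hi)
  have hNcard : H.card + G.card = N.card := Finset.card_filter_add_card_filter_not _
  have hIcard : F.card + N.card = I.card := Finset.card_filter_add_card_filter_not _
  have hLcard : L.card + (N.image f).card = C.card := Finset.card_sdiff_add_card_eq_card himg
  -- Every image of `G` has at least two preimages in `G`.
  have hGcard : 2 * (G.image f).card ≤ G.card := by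
    refine Finset.mul_card_image_le_card G 2 fun c hc => ?_
    obtain ⟨i, hi, rfl⟩ := Finset.mem_image.1 hc
    obtain ⟨hiN, hi'⟩ := Finset.mem_filter.1 hi
    push Not at hi'
    obtain ⟨j, hj, hji, hne⟩ := hi'
    have hjG : j ∈ G := by
      refine Finset.mem_filter.2 ⟨hj, fun h => hne (h i hiN hji.symm).symm⟩
    exact Finset.one_lt_card.2 ⟨i, Finset.mem_filter.2 ⟨hi, rfl⟩, j,
      Finset.mem_filter.2 ⟨hjG, hji⟩, hne.symm⟩
  have himgcard : (N.image f).card ≤ H.card + (G.image f).card := by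
    have h1 : N.image f ⊆ H.image f ∪ G.image f := by
      rw [← Finset.image_union, Finset.filter_union_filter_not_eq]
    calc (N.image f).card ≤ (H.image f ∪ G.image f).card := Finset.card_le_card h1
      _ ≤ (H.image f).card + (G.image f).card := Finset.card_union_le _ _
      _ ≤ H.card + (G.image f).card := by gcongr; exact Finset.card_image_le
  -- Since |I| = |C|, the image of the non-far elements leaves out at least |F| + |G|/2 elements.
  -- This is the total weight of `F` and `G`, which explains the weight 1/2 for non-far elements.
  have hL : 2 * F.card + G.card ≤ 2 * L.card := by omega
  have hinj : Set.InjOn f H := fun i hi j hj hij =>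
    ((Finset.mem_filter.1 hj).2 i (hHN hi) hij)
  have hHsum : ∑ i ∈ H, ρ (f i) ≤ ∑ c ∈ N.image f, ρ c := by
    rw [← Finset.sum_image (f := ρ) hinj]
    exact Finset.sum_le_sum_of_subset_of_nonneg (Finset.image_subset_image hHN)
      fun c hc _ => hρ c (himg hc)
  have hCsum := Finset.sum_sdiff himg (f := ρ)
  have hHadm : ∀ i ∈ H, f i ∈ C ∧ ∀ j ∈ I, ¬ far j → j ≠ i → f j ≠ f i := fun i hi =>
    ⟨hf i (hNI (hHN hi)), fun j hj hfar hne h =>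
      hne ((Finset.mem_filter.1 hi).2 j (Finset.mem_filter.2 ⟨hj, hfar⟩) h)⟩
  have hsplit : ∀ w : α → ℝ, ∑ i ∈ I, w i = ∑ i ∈ F, w i + (∑ i ∈ H, w i + ∑ i ∈ G, w i) := by
    intro w
    rw [Finset.sum_filter_add_sum_filter_not, Finset.sum_filter_add_sum_filter_not]
  have hfarH : ∀ i ∈ H, ¬ far i := fun i hi => (Finset.mem_filter.1 (hHN hi)).2
  have hfarG : ∀ i ∈ G, ¬ far i := fun i hi =>
    (Finset.mem_filter.1 ((Finset.filter_subset _ _ : G ⊆ N) hi)).2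
  have hHρ : 0 ≤ ∑ i ∈ H, ρ (f i) := Finset.sum_nonneg fun i hi => hρ _ (hHadm i hi).1
  rcases L.eq_empty_or_nonempty with hLe | hLne
  · have hF0 : F = ∅ := by
      rw [hLe, Finset.card_empty] at hL
      exact Finset.card_eq_zero.1 (by omega)
    have hG0 : G = ∅ := by
      rw [hLe, Finset.card_empty] at hL
      exact Finset.card_eq_zero.1 (by omega)
    refine ⟨f, fun i hi => hHadm i ?_, ?_⟩
    · by_contra h
      by_cases hfar : far i
      · exact Finset.notMem_empty i (hF0 ▸ Finset.mem_filter.2 ⟨hi, hfar⟩)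
      · have hiN : i ∈ N := Finset.mem_filter.2 ⟨hi, hfar⟩
        exact Finset.notMem_empty i (hG0 ▸ Finset.mem_filter.2
          ⟨hiN, fun h2 => h (Finset.mem_filter.2 ⟨hiN, h2⟩)⟩)
    · have h1 : ∑ i ∈ H, (if far i then (1 : ℝ) else 1 / 2) * ρ (f i) =
          1 / 2 * ∑ i ∈ H, ρ (f i) := by
        rw [Finset.mul_sum]
        exact Finset.sum_congr rfl fun i hi => by rw [if_neg (hfarH i hi)]
      rw [hsplit, hF0, hG0, h1]
      change ∑ c ∈ L, ρ c + _ = _ at hCsum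
      rw [hLe] at hCsum
      simp only [Finset.sum_empty] at hCsum ⊢
      linarith
  -- One cheapest member of `L` serves all of `F` and `G`. Repetition does no harm, since a local
  -- search step makes a single exchange.
  · obtain ⟨ℓ, hℓ, hmin⟩ := Finset.exists_min_image L ρ hLne
    have hℓC : ℓ ∈ C := (Finset.mem_sdiff.1 hℓ).1
    have hℓρ := hρ ℓ hℓC
    refine ⟨fun i => if i ∈ H then f i else ℓ, fun i hi => ?_, ?_⟩
    · by_cases h : i ∈ H
      · simp only [h, if_true]
        exact hHadm i h
      · simp only [h, if_false]
        refine ⟨hℓC, fun j hj hfar _ h2 => (Finset.mem_sdiff.1 hℓ).2 ?_⟩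
        exact Finset.mem_image.2 ⟨j, Finset.mem_filter.2 ⟨hj, hfar⟩, h2⟩
    · have h1 : ∑ i ∈ F, (if far i then (1 : ℝ) else 1 / 2) * ρ (if i ∈ H then f i else ℓ) =
          F.card * ρ ℓ := by
        rw [Finset.sum_congr rfl fun i hi => by
          rw [if_pos (Finset.mem_filter.1 hi).2, if_neg fun h => hfarH i h
            (Finset.mem_filter.1 hi).2, one_mul]]
        simp
      have h2 : ∑ i ∈ H, (if far i then (1 : ℝ) else 1 / 2) * ρ (if i ∈ H then f i else ℓ) =
          1 / 2 * ∑ i ∈ H, ρ (f i) := by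
        rw [Finset.mul_sum]
        exact Finset.sum_congr rfl fun i hi => by rw [if_neg (hfarH i hi), if_pos hi]
      have h3 : ∑ i ∈ G, (if far i then (1 : ℝ) else 1 / 2) * ρ (if i ∈ H then f i else ℓ) =
          G.card * (1 / 2 * ρ ℓ) := by
        rw [Finset.sum_congr rfl fun i hi => by
          rw [if_neg (hfarG i hi), if_neg fun h => (Finset.mem_filter.1 hi).2
            (Finset.mem_filter.1 h).2]]
        simp
      rw [hsplit, h1, h2, h3]
      have h4 : L.card * ρ ℓ ≤ ∑ c ∈ L, ρ c := by
        rw [← nsmul_eq_mul, ← Finset.sum_const]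
        exact Finset.sum_le_sum hmin
      have h5 : (2 * F.card + G.card : ℝ) ≤ 2 * L.card := by exact_mod_cast hL
      have h6 := mul_le_mul_of_nonneg_right h5 hℓρ
      change ∑ c ∈ L, ρ c + _ = _ at hCsum
      linarith

/-! ### Expected progress of an exchange, and the meaning of near-optimality -/

section Progress
variable {d : ℕ}

/-- The cost of the clusters whose optimal center is far from `C`. -/
noncomputable def farCost (X O Cs : Finset (Pt d)) (σ : Pt d → Pt d) (Θ : ℝ) (C : Finset (Pt d)) :
    ℝ :=
  ∑ i ∈ Cs, if IsFar Θ C i then truncSum Θ (clusterOf X O σ i) C else 0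

/-- The solutions that local search need not improve any more. -/
def NearOptimal (X O Cs : Finset (Pt d)) (σ : Pt d → Pt d) (Θ P : ℝ) (C : Finset (Pt d)) : Prop :=
  farCost X O Cs σ Θ C + truncSum Θ O C ≤ O.card * Θ + 64 * P ∧
    truncSum Θ X C ≤ 8 * (O.card * Θ + 64 * P)

variable {X O Cs : Finset (Pt d)} {σ : Pt d → Pt d}

/-- Near-optimality is designed to make this true. If its first condition fails, then far + τ(O) − B
exceeds 64P, and half of it remains after subtracting 32P. If the second fails, then T/4 alone
dominates B + 32P and T/8. -/
theorem le_truncSum_sub_of_not_nearOptimal (hO : O ⊆ X) (hσ : ∀ x ∈ X \ O, σ x ∈ Cs) {Θ P : ℝ}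
    (hΘ : 0 ≤ Θ) (hP : 0 ≤ P) {C : Finset (Pt d)} (h : ¬ NearOptimal X O Cs σ Θ P C) :
    64 * P ≤ truncSum Θ X C - O.card * Θ ∧
      (truncSum Θ X C - O.card * Θ) / 8 ≤ farCost X O Cs σ Θ C +
        (∑ i ∈ Cs, if IsFar Θ C i then 0 else truncSum Θ (clusterOf X O σ i) C) / 4 -
        (O.card * Θ - truncSum Θ O C) - 32 * P := by
  have hT := truncSum_eq_outliers_add_clusters hO hσ Θ C
  have h1 : ∑ i ∈ Cs, truncSum Θ (clusterOf X O σ i) C = farCost X O Cs σ Θ C +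
      ∑ i ∈ Cs, if IsFar Θ C i then 0 else truncSum Θ (clusterOf X O σ i) C := by
    rw [farCost, ← Finset.sum_add_distrib]
    exact Finset.sum_congr rfl fun i _ => by split_ifs <;> simp
  have h2 : 0 ≤ ∑ i ∈ Cs, if IsFar Θ C i then 0 else truncSum Θ (clusterOf X O σ i) C :=
    Finset.sum_nonneg fun i _ => by split_ifs; exacts [le_rfl, truncSum_nonneg hΘ]
  have h3 : 0 ≤ farCost X O Cs σ Θ C :=
    Finset.sum_nonneg fun i _ => by split_ifs; exacts [truncSum_nonneg hΘ, le_rfl]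
  have h4 : 0 ≤ truncSum Θ O C := truncSum_nonneg hΘ
  have h5 : 0 ≤ O.card * Θ := by positivity
  rw [NearOptimal, not_and_or, not_le, not_le] at h
  rcases h with h | h <;> constructor <;> linarith

/-- The expected progress of a local search step. -/
theorem sq_le_sum_truncSq_mul_min (hO : O ⊆ X) (hσ : ∀ x ∈ X \ O, σ x ∈ Cs) {Θ : ℝ}
    (hΘ : 0 ≤ Θ) {C : Finset (Pt d)} (hC : C.Nonempty) (hcard : Cs.card = C.card) {P : ℝ}
    (hP : ∑ i ∈ Cs, clusterCost X O σ i = P)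
    (hne : ¬ NearOptimal X O Cs σ Θ P C) {T' : Pt d → ℝ} (hT1 : ∀ y ∈ X, T' y ≤ truncSum Θ X C)
    (hT2 : ∀ y ∈ X, y ∉ C → ∀ c ∈ C, T' y ≤ truncSum Θ X (insert y (C.erase c))) :
    (truncSum Θ X C - O.card * Θ) ^ 2 ≤ 256 * C.card *
      ∑ y ∈ X, truncSq Θ y C *
        min (truncSum Θ X C - T' y) (truncSum Θ X C - O.card * Θ) := by
  have hP0 : 0 ≤ P := hP ▸ Finset.sum_nonneg fun _ _ => clusterCost_nonneg
  obtain ⟨hE1, hE2⟩ := le_truncSum_sub_of_not_nearOptimal hO hσ hΘ hP0 hne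
  set T := truncSum Θ X C with hT
  set E := T - O.card * Θ with hE
  have hE0 : 0 ≤ E := by linarith
  obtain ⟨g, hg, hgsum⟩ := exists_charging hcard (IsFar Θ C) (f := nearest C)
    (fun i _ => nearest_mem hC i) (ρ := centerCharge Θ X O σ C)
    (fun c _ => centerCharge_nonneg hΘ C c)
  let gain : Pt d → ℝ := fun i => truncSum Θ (clusterOf X O σ i) C -
    12 * clusterCost X O σ i - centerCharge Θ X O σ C (g i)
  -- The gain is capped at E because progress below the cost B of the outliers is not counted. The
  -- cap does no harm: a single capped term already supplies E ≥ E/8.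
  let m : Pt d → ℝ := fun i => min (max (gain i) 0) E
  have hm0 : ∀ i, 0 ≤ m i := fun i => le_min (le_max_right _ _) hE0
  have hgain : E / 8 ≤ ∑ i ∈ Cs, max (gain i) 0 := by
    have h1 : ∑ i ∈ Cs, (if IsFar Θ C i then 1 else 1 / 2) * gain i ≤
        ∑ i ∈ Cs, max (gain i) 0 := by
      refine Finset.sum_le_sum fun i _ => ?_
      have := le_max_left (gain i) 0
      have := le_max_right (gain i) 0
      split_ifs <;> linarith
    refine le_trans ?_ h1
    have h2 : ∑ i ∈ Cs, (if IsFar Θ C i then 1 else 1 / 2) * gain i =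
        ∑ i ∈ Cs, (if IsFar Θ C i then 1 else 1 / 2) * (truncSum Θ (clusterOf X O σ i) C -
          12 * clusterCost X O σ i) -
        ∑ i ∈ Cs, (if IsFar Θ C i then 1 else 1 / 2) * centerCharge Θ X O σ C (g i) := by
      rw [← Finset.sum_sub_distrib]
      exact Finset.sum_congr rfl fun i _ => by ring
    rw [sum_centerCharge hO hσ Θ hC] at hgsum
    -- Per cluster: a far one keeps τ − 12p − p. A non-far one has weight 1/2 and keeps τ/2 − 6p −
    -- (τ/4 + 20p) = τ/4 − 26p. Both are covered by the common loss of 32p.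
    have h3 : ∑ i ∈ Cs, ((if IsFar Θ C i then truncSum Θ (clusterOf X O σ i) C else 0) +
        (if IsFar Θ C i then 0 else truncSum Θ (clusterOf X O σ i) C) / 4 -
        32 * clusterCost X O σ i) ≤
        ∑ i ∈ Cs, ((if IsFar Θ C i then 1 else 1 / 2) * (truncSum Θ (clusterOf X O σ i) C -
          12 * clusterCost X O σ i) - (if IsFar Θ C i then clusterCost X O σ i
        else truncSum Θ (clusterOf X O σ i) C / 4 + 20 * clusterCost X O σ i)) := by
      refine Finset.sum_le_sum fun i _ => ?_
      have : 0 ≤ clusterCost X O σ i := clusterCost_nonneg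
      split_ifs <;> linarith
    rw [Finset.sum_sub_distrib, Finset.sum_sub_distrib, Finset.sum_add_distrib, ← Finset.sum_div,
      ← Finset.mul_sum, hP] at h3
    unfold farCost at hE2
    rw [h2]
    linarith
  have hmsum : E / 8 ≤ ∑ i ∈ Cs, m i := by
    by_cases h : ∃ i ∈ Cs, E ≤ max (gain i) 0
    · obtain ⟨i, hi, h⟩ := h
      calc E / 8 ≤ E := by linarith
        _ = m i := (min_eq_right h).symm
        _ ≤ ∑ i ∈ Cs, m i := Finset.single_le_sum (fun j _ => hm0 j) hi
    · push Not at h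
      rwa [Finset.sum_congr rfl fun i hi => min_eq_left (h i hi).le]
  have hmin0 : ∀ y ∈ X, 0 ≤ truncSq Θ y C * min (T - T' y) E := fun y hy =>
    mul_nonneg (truncSq_nonneg hΘ) (le_min (sub_nonneg.2 (hT1 y hy)) hE0)
  -- One factor `m i` is the gain of any good center of the cluster, the other bounds the sampling
  -- weight of the good centers from below; both come from the same excess cost.
  have hcl : ∀ i ∈ Cs, m i ^ 2 ≤
      4 * ∑ y ∈ clusterOf X O σ i, truncSq Θ y C * min (T - T' y) E := by
    intro i hi
    have hsub : clusterOf X O σ i ⊆ X := fun x hx => (mem_clusterOf.1 hx).1.1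
    obtain ⟨S, hS, hS1, hS2⟩ := exists_good_centers hΘ (clusterOf X O σ i) C i
    obtain ⟨hg1, hg2⟩ := hg i hi
    have hρ := centerCharge_nonneg (X := X) (O := O) (σ := σ) hΘ C (g i)
    have h1 : ∑ y ∈ S, truncSq Θ y C * m i ≤
        ∑ y ∈ clusterOf X O σ i, truncSq Θ y C * min (T - T' y) E := by
      refine le_trans (Finset.sum_le_sum fun y hy => ?_)
        (Finset.sum_le_sum_of_subset_of_nonneg hS fun y hy _ => hmin0 y (hsub hy))
      by_cases hyC : y ∈ C
      · simp [truncSq_eq_zero hΘ hyC]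
      · refine mul_le_mul_of_nonneg_left (min_le_min_right _ (max_le ?_
          (sub_nonneg.2 (hT1 y (hsub (hS hy)))))) (truncSq_nonneg hΘ)
        have h2 := hT2 y (hsub (hS hy)) hyC (g i) hg1
        have h3 := truncSum_swap_le hσ hΘ hC (y := y) hg2
        have h4 := hS1 y hy
        have h5 : 0 ≤ clusterCost X O σ i := clusterCost_nonneg
        change truncSum Θ (clusterOf X O σ i) C -
          12 * clusterCost X O σ i - centerCharge Θ X O σ C (g i) ≤ _
        unfold clusterCost at h5 ⊢
        linarith
    rw [← Finset.sum_mul] at h1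
    have h6 : m i ≤ 4 * ∑ y ∈ S, truncSq Θ y C := by
      refine (min_le_left _ _).trans (max_le ?_ ?_)
      · change truncSum Θ (clusterOf X O σ i) C -
          12 * clusterCost X O σ i - centerCharge Θ X O σ C (g i) ≤ _
        unfold clusterCost
        linarith
      · exact mul_nonneg (by norm_num) (Finset.sum_nonneg fun _ _ => truncSq_nonneg hΘ)
    have h7 := mul_le_mul_of_nonneg_right h6 (hm0 i)
    nlinarith
  have h8 : ∑ i ∈ Cs, m i ^ 2 ≤ 4 * ∑ y ∈ X, truncSq Θ y C * min (T - T' y) E := by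
    rw [sum_eq_sum_outliers_add_sum_clusters hO hσ, mul_add, Finset.mul_sum (s := Cs)]
    have : 0 ≤ ∑ y ∈ O, truncSq Θ y C * min (T - T' y) E :=
      Finset.sum_nonneg fun y hy => hmin0 y (hO hy)
    have := Finset.sum_le_sum hcl
    linarith
  have h9 : (∑ i ∈ Cs, m i) ^ 2 ≤ Cs.card * ∑ i ∈ Cs, m i ^ 2 := sq_sum_le_card_mul_sum_sq
  have h10 : (E / 8) ^ 2 ≤ (∑ i ∈ Cs, m i) ^ 2 := by gcongr
  have h11 : (Cs.card : ℝ) * ∑ i ∈ Cs, m i ^ 2 ≤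
      Cs.card * (4 * ∑ y ∈ X, truncSq Θ y C * min (T - T' y) E) := by gcongr
  rw [← hcard]
  nlinarith

/-- The number of points that are far from the centers of a near-optimal solution. -/
theorem NearOptimal.card_le (hO : O ⊆ X) (hσ : ∀ x ∈ X \ O, σ x ∈ Cs) {Θ P : ℝ}
    (hΘ : 0 < Θ) {C : Finset (Pt d)} (hC : C.Nonempty) (hP : ∑ i ∈ Cs, clusterCost X O σ i = P)
    (h : NearOptimal X O Cs σ Θ P C) :
    (X.filter fun x => 10 * Θ ≤ dist x (nearest C x) ^ 2).card * Θ ≤ O.card * Θ + 65 * P := by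
  have h1 : (X.filter fun x => 10 * Θ ≤ dist x (nearest C x) ^ 2).card * Θ =
      ∑ x ∈ X, if 10 * Θ ≤ dist x (nearest C x) ^ 2 then Θ else 0 := by
    rw [← Finset.sum_filter, Finset.sum_const, nsmul_eq_mul]
  -- Outliers and far clusters pay Θ for each distant point out of their truncated cost; points of
  -- the other clusters will pay out of their reference cost.
  have ht : ∀ x, (if 10 * Θ ≤ dist x (nearest C x) ^ 2 then Θ else 0) ≤ truncSq Θ x C := by
    intro x
    rw [truncSq_eq_min_nearest hC]
    split_ifs with hx
    · exact le_min le_rfl (by linarith)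
    · exact le_min hΘ.le (sq_nonneg _)
  have hcl : ∀ i ∈ Cs, ∑ x ∈ clusterOf X O σ i,
      (if 10 * Θ ≤ dist x (nearest C x) ^ 2 then Θ else 0) ≤
      (if IsFar Θ C i then truncSum Θ (clusterOf X O σ i) C else 0) + clusterCost X O σ i := by
    intro i _
    split_ifs with hi
    · have : 0 ≤ clusterCost X O σ i := clusterCost_nonneg
      have := Finset.sum_le_sum fun x (_ : x ∈ clusterOf X O σ i) => ht x
      unfold truncSum
      linarith
    · rw [zero_add]
      refine Finset.sum_le_sum fun x _ => ?_
      split_ifs with hx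
      · have h2 : dist x (nearest C x) ≤ dist x i + dist i (nearest C i) :=
          (dist_nearest_le (nearest_mem hC i) x).trans (dist_triangle _ _ _)
        have h3 : dist x (nearest C x) ^ 2 ≤ (dist x i + dist i (nearest C i)) ^ 2 := by gcongr
        rw [IsFar, not_le] at hi
        -- With a² < Θ and b² < 4Θ, the bound (a+b)² ≤ 5a² + 5b²/4 stays below 10Θ. This is why
        -- outliers are taken at 10Θ when far means 4Θ.
        by_contra h4
        rw [not_le] at h4
        nlinarith [sq_nonneg (2 * dist x i - dist i (nearest C i))]
      · exact sq_nonneg _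
  rw [h1, sum_eq_sum_outliers_add_sum_clusters hO hσ]
  have h2 := Finset.sum_le_sum hcl
  rw [Finset.sum_add_distrib, hP] at h2
  have h3 := Finset.sum_le_sum fun x (_ : x ∈ O) => ht x
  have h4 := h.1
  unfold farCost truncSum at h4
  unfold truncSum at h2
  linarith

end Progress

/-! ### The drift of local search -/

section Drift
variable {d : ℕ}

/-- The concave potential for the time that local search needs to reduce the excess cost `W`. -/
noncomputable def hittingPotential (K B m W : ℝ) : ℝ := K * (Real.log (W / m) + B / m - B / W)

theorem hittingPotential_nonneg {K B m W : ℝ} (hK : 0 ≤ K) (hB : 0 ≤ B) (hm : 0 < m)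
    (hW : m ≤ W) : 0 ≤ hittingPotential K B m W := by
  have h1 : 0 ≤ Real.log (W / m) := Real.log_nonneg ((one_le_div hm).2 hW)
  have h2 : B / W ≤ B / m := div_le_div_of_nonneg_left hB hm hW
  exact mul_nonneg hK (by linarith)

/-- Concavity in `W`, with derivative K(W+B)/W². This replaces Jensen's inequality both in the drift
argument and for the seeding. -/
theorem hittingPotential_le_tangent {K B m W W' : ℝ} (hK : 0 ≤ K) (hB : 0 ≤ B) (hm : 0 < m)
    (hW : 0 < W) (hW' : 0 < W') :
    hittingPotential K B m W' ≤ hittingPotential K B m W + K * ((W + B) / W ^ 2) * (W' - W) := by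
  have h1 : Real.log (W' / m) ≤ Real.log (W / m) + (W' - W) / W := by
    have h2 : Real.log (W' / W) ≤ W' / W - 1 := Real.log_le_sub_one_of_pos (by positivity)
    rw [Real.log_div hW'.ne' hW.ne'] at h2
    rw [Real.log_div hW'.ne' hm.ne', Real.log_div hW.ne' hm.ne']
    have h3 : (W' - W) / W = W' / W - 1 := by field_simp
    linarith
  have h4 : -(B / W') ≤ -(B / W) + B / W ^ 2 * (W' - W) := by
    have h5 : -(B / W) + B / W ^ 2 * (W' - W) - -(B / W') =
        B * (W' - W) ^ 2 / (W ^ 2 * W') := by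
      field_simp
      ring
    have h6 : 0 ≤ B * (W' - W) ^ 2 / (W ^ 2 * W') := by positivity
    linarith
  have h7 : K * ((W + B) / W ^ 2) * (W' - W) =
      K * ((W' - W) / W + B / W ^ 2 * (W' - W)) := by
    field_simp
  unfold hittingPotential
  rw [h7, ← mul_add]
  exact mul_le_mul_of_nonneg_left (by linarith) hK

/-- The cost in excess of the unavoidable cost `B` of the outliers, shifted by `m`. -/
noncomputable def excess (X : Finset (Pt d)) (Θ B m : ℝ) (C : Finset (Pt d)) : ℝ :=
  max (truncSum Θ X C - B) 0 + m

theorem le_excess {X : Finset (Pt d)} {Θ B m : ℝ} {C : Finset (Pt d)} : m ≤ excess X Θ B m C := by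
  have := le_max_right (truncSum Θ X C - B) 0
  unfold excess
  linarith

variable {X O Cs : Finset (Pt d)} {σ : Pt d → Pt d}

/-- Transfers minimality from extended to real costs. They agree only for nonempty sets, which holds
here since the deletion follows an insertion into a nonempty set. -/
theorem truncSum_localSearch_le {Θ : ℝ≥0∞} {Θ' : ℝ} (h : PenaltyEquiv X Θ Θ')
    (am : ArgminRule (Pt d)) {C : Finset (Pt d)} (hC : C ⊆ X) (hne : C.Nonempty) {y : Pt d}
    (hy : y ∈ X) (hyC : y ∉ C) {e : Pt d} (he : e ∈ insert y C) :
    truncSum Θ' X ((insert y C).erase (am.pick (insert y C)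
      fun e => tau Θ X ((insert y C).erase e))) ≤ truncSum Θ' X ((insert y C).erase e) := by
  have hcard : ∀ e ∈ insert y C, ((insert y C).erase e).Nonempty := fun e he => by
    rw [← Finset.card_pos, Finset.card_erase_of_mem he, Finset.card_insert_of_notMem hyC]
    simpa using hne
  have hsub : ∀ e, (insert y C).erase e ⊆ X := fun e =>
    (Finset.erase_subset _ _).trans (Finset.insert_subset hy hC)
  have hp := am.pick_mem (insert y C) (fun e => tau Θ X ((insert y C).erase e))
    (Finset.insert_nonempty _ _)
  have h1 := am.pick_le (insert y C) (fun e => tau Θ X ((insert y C).erase e)) e he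
  rw [h.tau_eq (hsub _) (hcard _ hp), h.tau_eq (hsub _) (hcard _ he)] at h1
  exact (ENNReal.ofReal_le_ofReal_iff (truncSum_nonneg h.1.le)).1 h1

theorem localSearchStep_truncSum_le {Θ : ℝ≥0∞} {Θ' : ℝ} (h : PenaltyEquiv X Θ Θ')
    (am : ArgminRule (Pt d)) {C : Finset (Pt d)} (hC : C ⊆ X) (hne : C.Nonempty) {y : Pt d}
    (hy : y ∈ X) (hyC : y ∉ C) :
    truncSum Θ' X ((insert y C).erase (am.pick (insert y C)
      fun e => tau Θ X ((insert y C).erase e))) ≤ truncSum Θ' X C := by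
  have := truncSum_localSearch_le h am hC hne hy hyC (Finset.mem_insert_self y C)
  rwa [Finset.erase_insert hyC] at this

theorem hittingPotential_mono {K B m : ℝ} (hK : 0 ≤ K) (hB : 0 ≤ B) (hm : 0 < m) {Θ : ℝ}
    {C C' : Finset (Pt d)} (h : truncSum Θ X C' ≤ truncSum Θ X C) :
    hittingPotential K B m (excess X Θ B m C') ≤ hittingPotential K B m (excess X Θ B m C) := by
  have h1 : excess X Θ B m C' ≤ excess X Θ B m C := by
    unfold excess
    gcongr
  have h2 : 0 < excess X Θ B m C := hm.trans_le le_excess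
  have h3 := hittingPotential_le_tangent hK hB hm h2 (W' := excess X Θ B m C') (hm.trans_le le_excess)
  have h4 : 0 ≤ K * ((excess X Θ B m C + B) / excess X Θ B m C ^ 2) := by positivity
  nlinarith

/-- The new point may itself be deleted, so the cost never rises. This covers a first step from
seeded centers that are already good but have not been tested. -/
theorem localSearchStep_expect_le {Θ : ℝ≥0∞} {Θ' : ℝ} (h : PenaltyEquiv X Θ Θ')
    (am : ArgminRule (Pt d)) {C : Finset (Pt d)} (hC : C ⊆ X) (hne : C.Nonempty)
    (hcard : C.card < X.card) {K B m : ℝ} (hK : 0 ≤ K) (hB : 0 ≤ B) (hm : 0 < m) :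
    (localSearchStep am X Θ C).expect
        (fun C' => ENNReal.ofReal (hittingPotential K B m (excess X Θ' B m C'))) ≤
      ENNReal.ofReal (hittingPotential K B m (excess X Θ' B m C)) := by
  rw [localSearchStep_eq h am hC hne, PMF.expect_map,
    ← PMF.expect_const (sampleTrunc X Θ' C)
      (ENNReal.ofReal (hittingPotential K B m (excess X Θ' B m C)))]
  refine PMF.expect_mono _ fun y hy => ENNReal.ofReal_le_ofReal ?_
  obtain ⟨h1, h2⟩ := mem_support_sampleTrunc h.1 hcard hy
  exact hittingPotential_mono hK hB hm (localSearchStep_truncSum_le h am hC hne h1 h2)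

/-- As long as the solution is not near-optimal, the potential decreases by `1` in expectation. -/
theorem localSearchStep_expect_add_one_le (hO : O ⊆ X) (hσ : ∀ x ∈ X \ O, σ x ∈ Cs)
    {Θ : ℝ≥0∞} {Θ' : ℝ} (h : PenaltyEquiv X Θ Θ')
    (am : ArgminRule (Pt d)) {C : Finset (Pt d)} (hC : C ⊆ X) (hne : C.Nonempty)
    (hcard : C.card < X.card) (hCs : Cs.card = C.card) {P : ℝ} (hP0 : 0 < P)
    (hP : ∑ i ∈ Cs, clusterCost X O σ i = P) (hopt : ¬ NearOptimal X O Cs σ Θ' P C) :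
    (localSearchStep am X Θ C).expect (fun C' => ENNReal.ofReal
        (hittingPotential (1024 * C.card) (O.card * Θ') (64 * P)
          (excess X Θ' (O.card * Θ') (64 * P) C'))) + 1 ≤
      ENNReal.ofReal (hittingPotential (1024 * C.card) (O.card * Θ') (64 * P)
          (excess X Θ' (O.card * Θ') (64 * P) C)) := by
  have hΘ := h.1
  set B := O.card * Θ' with hB
  set m := 64 * P with hm
  set K : ℝ := 1024 * C.card with hK
  have hB0 : 0 ≤ B := by positivity
  have hm0 : 0 < m := by positivity
  have hk : (0 : ℝ) < C.card := by exact_mod_cast hne.card_pos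
  have hK0 : 0 < K := by positivity
  set T := truncSum Θ' X C with hT
  have hTpos : 0 < T := truncSum_pos hΘ hcard
  obtain ⟨hE1, -⟩ := le_truncSum_sub_of_not_nearOptimal hO hσ hΘ.le hP0.le hopt
  set E := T - B with hE
  let next : Pt d → Finset (Pt d) := fun y =>
    (insert y C).erase (am.pick (insert y C) fun e => tau Θ X ((insert y C).erase e))
  -- Centers in `C` have sampling weight 0; the value `T` for them only keeps `T' y ≤ T` true.
  let T' : Pt d → ℝ := fun y => if y ∈ C then T else truncSum Θ' X (next y)
  have hT1 : ∀ y ∈ X, T' y ≤ T := fun y hy => by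
    by_cases hyC : y ∈ C
    · simp [T', hyC]
    · simp only [T', hyC, if_false]
      exact localSearchStep_truncSum_le h am hC hne hy hyC
  have hT2 : ∀ y ∈ X, y ∉ C → ∀ c ∈ C, T' y ≤ truncSum Θ' X (insert y (C.erase c)) := by
    intro y hy hyC c hc
    simp only [T', hyC, if_false]
    have hyc : y ≠ c := fun h => hyC (h ▸ hc)
    have h2 := truncSum_localSearch_le h am hC hne hy hyC (Finset.mem_insert_of_mem hc)
    rwa [Finset.erase_insert_of_ne hyc] at h2
  have hprog := sq_le_sum_truncSq_mul_min hO hσ hΘ.le hne hCs hP hopt hT1 hT2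
  rw [← hT, ← hB, ← hE] at hprog
  set W := excess X Θ' B m C with hW
  have hWE : W = E + m := by
    rw [hW, excess, max_eq_left (by linarith)]
  let W' : Pt d → ℝ := fun y => max (T' y - B) 0 + m
  have hW'm : ∀ y, m ≤ W' y := fun y => by
    have := le_max_right (T' y - B) 0
    simp only [W']; linarith
  have hWW : ∀ y, W' y - W = - min (T - T' y) E := fun y => by
    simp only [W', hWE]
    rcases le_total (T' y) B with h2 | h2
    · rw [max_eq_right (by linarith), min_eq_right (by linarith)]; ring
    · rw [max_eq_left (by linarith), min_eq_left (by linarith)]; ring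
  let f : Pt d → ℝ := fun y => hittingPotential K B m (W' y)
  have hf0 : ∀ y ∈ X, 0 ≤ f y := fun y _ => hittingPotential_nonneg hK0.le hB0 hm0 (hW'm y)
  have hsum : ∑ y ∈ X, truncSq Θ' y C * f y ≤ T * (hittingPotential K B m W - 1) := by
    have h2 : ∑ y ∈ X, truncSq Θ' y C * f y ≤ ∑ y ∈ X, (truncSq Θ' y C * hittingPotential K B m W -
        K * ((W + B) / W ^ 2) * (truncSq Θ' y C * min (T - T' y) E)) := by
      refine Finset.sum_le_sum fun y _ => ?_
      have h3 := hittingPotential_le_tangent (W := W) hK0.le hB0 hm0 (by linarith)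
        (hm0.trans_le (hW'm y))
      rw [hWW] at h3
      have := mul_le_mul_of_nonneg_left h3 (truncSq_nonneg hΘ.le (x := y) (C := C))
      linarith
    refine h2.trans ?_
    rw [Finset.sum_sub_distrib, ← Finset.sum_mul, ← Finset.mul_sum]
    set D := ∑ y ∈ X, truncSq Θ' y C * min (T - T' y) E
    -- Since m ≤ E, W = E + m ≤ 2E and W² ≤ 4E² ≤ 1024·k·D, which fixes K. The slope supplies the
    -- factor W + B ≥ T that cancels the normalization of the sampling.
    have h4 : T ≤ K * ((W + B) / W ^ 2) * D := by
      have hW0 : 0 < W := by linarith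
      have h5 : W ^ 2 ≤ K * D := by nlinarith
      calc T ≤ W + B := by linarith
        _ = (W + B) / W ^ 2 * W ^ 2 := by field_simp
        _ ≤ (W + B) / W ^ 2 * (K * D) := by gcongr
        _ = _ := by ring
    change T * _ - _ ≤ _
    linarith
  -- Needed to add 1 back after `ENNReal.ofReal`, which would hide a negative bound; it follows from
  -- the left side of `hsum` being nonnegative.
  have hb0 : 0 ≤ hittingPotential K B m W - 1 := by
    have h2 : 0 ≤ ∑ y ∈ X, truncSq Θ' y C * f y :=
      Finset.sum_nonneg fun y hy => mul_nonneg (truncSq_nonneg hΘ.le) (hf0 y hy)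
    exact nonneg_of_mul_nonneg_right (h2.trans hsum) hTpos
  have hexp := sampleTrunc_expect_le hΘ hcard hf0 hsum
  rw [localSearchStep_eq h am hC hne, PMF.expect_map]
  have h6 : (sampleTrunc X Θ' C).expect (fun y => ENNReal.ofReal
      (hittingPotential K B m (excess X Θ' B m (next y)))) ≤
      (sampleTrunc X Θ' C).expect fun y => ENNReal.ofReal (f y) := by
    refine PMF.expect_mono _ fun y hy => le_of_eq ?_
    obtain ⟨-, h2⟩ := mem_support_sampleTrunc hΘ hcard hy
    simp only [f, W', T', h2, if_false, excess]
  calc _ ≤ ENNReal.ofReal (hittingPotential K B m W - 1) + 1 := by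
        gcongr
        exact h6.trans hexp
    _ = ENNReal.ofReal (hittingPotential K B m W) := by
        rw [← ENNReal.ofReal_one, ← ENNReal.ofReal_add hb0 zero_le_one, sub_add_cancel]

end Drift

/-! ### The best solution -/

section Best
variable {d : ℕ}

/-- The current centers `C` yield a solution with few outliers and cost at most `b`. -/
def GoodCenters (X : Finset (Pt d)) (z : ℕ) (ε : ℝ) (Θ b : ℝ≥0∞) (C : Finset (Pt d)) : Prop :=
  ((outPts (10 * Θ) X C).card : ℝ) ≤ (1 + ε) * z ∧ phi (X \ outPts (10 * Θ) X C) C ≤ b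

/-- A solution with `k` centers, few outliers and cost at most `b`. -/
def GoodSolution (X : Finset (Pt d)) (k z : ℕ) (ε : ℝ) (b : ℝ≥0∞)
    (o : Finset (Pt d) × Finset (Pt d)) : Prop :=
  o.1.card = k ∧ o.2 ⊆ X ∧ (o.2.card : ℝ) ≤ (1 + ε) * z ∧ phi (X \ o.2) o.1 ≤ b

/-- The best solution is the initial one, or has `k` centers and few outliers. -/
def ValidBest (X : Finset (Pt d)) (k z : ℕ) (ε : ℝ) (o : Finset (Pt d) × Finset (Pt d)) : Prop :=
  o = (∅, ∅) ∨ (o.1.card = k ∧ o.2 ⊆ X ∧ (o.2.card : ℝ) ≤ (1 + ε) * z)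

variable {X : Finset (Pt d)} {k z : ℕ} {ε : ℝ} {b : ℝ≥0∞}

theorem validBest_keepBest (Θ : ℝ≥0∞) {C : Finset (Pt d)} (hC : C.card = k)
    {o : Finset (Pt d) × Finset (Pt d)} (ho : ValidBest X k z ε o) :
    ValidBest X k z ε (keepBest X z ε Θ C o) := by
  unfold keepBest
  split_ifs with h
  · exact Or.inr ⟨hC, Finset.filter_subset _ _, h.1⟩
  · exact ho

theorem GoodSolution.keepBest {Θ : ℝ≥0∞} {C : Finset (Pt d)} (hC : C.card = k)
    {o : Finset (Pt d) × Finset (Pt d)} (ho : GoodSolution X k z ε b o) :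
    GoodSolution X k z ε b (keepBest X z ε Θ C o) := by
  unfold _root_.keepBest
  split_ifs with h
  · exact ⟨hC, Finset.filter_subset _ _, h.1, h.2.le.trans ho.2.2.2⟩
  · exact ho

/-- If the good centers do not replace the stored solution, that solution costs no more than they
do. It cannot be the initial one, whose cost is infinite. -/
theorem GoodCenters.keepBest {Θ : ℝ≥0∞} (hb : b ≠ ∞) (hX : X.Nonempty) {C : Finset (Pt d)}
    (hC : C.card = k) (h : GoodCenters X z ε Θ b C) {o : Finset (Pt d) × Finset (Pt d)}
    (ho : ValidBest X k z ε o) : GoodSolution X k z ε b (keepBest X z ε Θ C o) := by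
  unfold _root_.keepBest
  split_ifs with h1
  · exact ⟨hC, Finset.filter_subset _ _, h.1, h.2⟩
  · rw [not_and, not_lt] at h1
    have h2 := (h1 h.1).trans h.2
    rcases ho with rfl | ho
    · obtain ⟨x, hx⟩ := hX
      exfalso
      have h3 : phiPt x ∅ ≤ phi (X \ ∅) ∅ := by
        rw [phi]
        exact Finset.single_le_sum (f := fun x => phiPt x ∅) (fun _ _ => zero_le) (by simpa using hx)
      have h4 : phiPt x ∅ = ∞ := by simp [phiPt]
      exact hb (top_le_iff.1 (h4 ▸ h3.trans h2))
    · exact ⟨ho.1, ho.2.1, ho.2.2, h2⟩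

/-- The states that the algorithm can reach. -/
theorem innerLoop_support {Θ : ℝ≥0∞} {Θ' : ℝ} (h : PenaltyEquiv X Θ Θ') (am : ArgminRule (Pt d))
    (hk : 1 ≤ k) (hkX : k < X.card) (hb : b ≠ ∞)
    {s : Finset (Pt d) × (Finset (Pt d) × Finset (Pt d))} (hs : s.1 ⊆ X ∧ s.1.card = k)
    (ho : ValidBest X k z ε s.2) (N : ℕ) :
    ∀ s' ∈ (innerLoop am X z ε Θ N s).support, (s'.1 ⊆ X ∧ s'.1.card = k) ∧
      ValidBest X k z ε s'.2 ∧ (GoodSolution X k z ε b s.2 → GoodSolution X k z ε b s'.2) ∧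
      (1 ≤ N → GoodCenters X z ε Θ b s'.1 → GoodSolution X k z ε b s'.2) := by
  induction N with
  | zero =>
    intro s' hs'
    have : s' = s := by simpa [innerLoop] using hs'
    subst this
    exact ⟨hs, ho, id, fun h => absurd h (by norm_num)⟩
  | succ N ih =>
    intro s' hs'
    rw [innerLoop, PMF.mem_support_bind_iff] at hs'
    obtain ⟨s₁, hs₁, hs'⟩ := hs'
    obtain ⟨⟨h1, h2⟩, h3, h4, -⟩ := ih s₁ hs₁
    rw [PMF.support_map] at hs'
    obtain ⟨C, hC, rfl⟩ := hs'
    obtain ⟨h5, h6⟩ := localSearchStep_support h am h1 (Finset.card_pos.1 (by omega)) (by omega) hC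
    rw [h2] at h6
    exact ⟨⟨h5, h6⟩, validBest_keepBest Θ h6 h3, fun h => (h4 h).keepBest h6,
      fun _ hg => hg.keepBest hb (Finset.card_pos.1 (by omega)) h6 h3⟩

/-- If the potential `Φ` decreases by `1` in expectation until good centers are found, then a good
solution is found after about `Φ` steps. -/
theorem innerLoop_expect_le {Θ : ℝ≥0∞} {Θ' : ℝ} (h : PenaltyEquiv X Θ Θ') (am : ArgminRule (Pt d))
    (hk : 1 ≤ k) (hkX : k < X.card) (hb : b ≠ ∞)
    {s : Finset (Pt d) × (Finset (Pt d) × Finset (Pt d))} (hs : s.1 ⊆ X ∧ s.1.card = k)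
    (ho : ValidBest X k z ε s.2) (Φ : Finset (Pt d) → ℝ≥0∞)
    (hΦ : ∀ C ⊆ X, C.card = k → (localSearchStep am X Θ C).expect Φ ≤ Φ C)
    (hΦ1 : ∀ C ⊆ X, C.card = k → ¬ GoodCenters X z ε Θ b C →
      (localSearchStep am X Θ C).expect Φ + 1 ≤ Φ C) (N : ℕ) :
    N * (innerLoop am X z ε Θ (N + 1) s).expect
        (fun s' => if GoodSolution X k z ε b s'.2 then 0 else 1) +
      (innerLoop am X z ε Θ (N + 1) s).expect
        (fun s' => if GoodSolution X k z ε b s'.2 then 0 else Φ s'.1) ≤ Φ s.1 := by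
  induction N with
  | zero =>
    -- The initial centers are never tested by `keepBest`, so the first step earns no decrease;
    -- hence N + 1 steps against the factor N.
    rw [Nat.cast_zero, zero_mul, zero_add, zero_add, innerLoop, innerLoop, PMF.pure_bind,
      PMF.expect_map]
    refine le_trans (PMF.expect_mono _ fun C _ => ?_) (hΦ s.1 hs.1 hs.2)
    split_ifs <;> simp
  | succ N ih =>
    refine le_trans ?_ ih
    have hsup := innerLoop_support h am hk hkX hb hs ho (N + 1)
    rw [innerLoop, PMF.expect_bind, PMF.expect_bind]
    set p := innerLoop am X z ε Θ (N + 1) s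
    have h1 : p.expect (fun s' => ((localSearchStep am X Θ s'.1).map
        fun C => (C, keepBest X z ε Θ C s'.2)).expect
          fun s' => if GoodSolution X k z ε b s'.2 then 0 else 1) ≤
        p.expect (fun s' => if GoodSolution X k z ε b s'.2 then 0 else 1) := by
      refine PMF.expect_mono _ fun s' hs' => ?_
      obtain ⟨⟨h2, h3⟩, -⟩ := hsup s' hs'
      rw [PMF.expect_map, ← PMF.expect_const (localSearchStep am X Θ s'.1)
        (if GoodSolution X k z ε b s'.2 then 0 else 1)]
      refine PMF.expect_mono _ fun C hC => ?_
      obtain ⟨-, h6⟩ := localSearchStep_support h am h2 (Finset.card_pos.1 (by omega)) (by omega) hC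
      by_cases hg : GoodSolution X k z ε b s'.2
      · simp [hg, hg.keepBest (Θ := Θ) (h6.trans h3)]
      · simp only [hg, if_false]
        split_ifs <;> simp
    -- Once a solution is good it stays good. Otherwise the current centers, having been tested, are
    -- not good, so the potential pays 1 for this step.
    have h4 : p.expect (fun s' => ((localSearchStep am X Θ s'.1).map
        fun C => (C, keepBest X z ε Θ C s'.2)).expect
          fun s' => if GoodSolution X k z ε b s'.2 then 0 else Φ s'.1) +
        p.expect (fun s' => if GoodSolution X k z ε b s'.2 then 0 else 1) ≤
        p.expect (fun s' => if GoodSolution X k z ε b s'.2 then 0 else Φ s'.1) := by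
      rw [← PMF.expect_add]
      refine PMF.expect_mono _ fun s' hs' => ?_
      obtain ⟨⟨h2, h3⟩, -, -, h5⟩ := hsup s' hs'
      rw [PMF.expect_map]
      by_cases hg : GoodSolution X k z ε b s'.2
      · simp only [hg, if_true, add_zero]
        refine le_trans (PMF.expect_mono _ (g := fun _ => 0) fun C hC => ?_)
          (PMF.expect_const _ _).le
        obtain ⟨-, h6⟩ := localSearchStep_support h am h2 (Finset.card_pos.1 (by omega))
          (by omega) hC
        simp [hg.keepBest (Θ := Θ) (h6.trans h3)]
      · simp only [hg, if_false]
        refine le_trans ?_ (hΦ1 s'.1 h2 h3 fun h7 => hg (h5 (by omega) h7))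
        gcongr
        refine PMF.expect_mono _ fun C _ => ?_
        split_ifs <;> simp
    push_cast
    calc _ ≤ (N + 1 : ℝ≥0∞) * p.expect (fun s' => if GoodSolution X k z ε b s'.2 then 0 else 1) +
          p.expect (fun s' => ((localSearchStep am X Θ s'.1).map
            fun C => (C, keepBest X z ε Θ C s'.2)).expect
              fun s' => if GoodSolution X k z ε b s'.2 then 0 else Φ s'.1) := by gcongr
      _ = N * p.expect (fun s' => if GoodSolution X k z ε b s'.2 then 0 else 1) +
          (p.expect (fun s' => ((localSearchStep am X Θ s'.1).map
            fun C => (C, keepBest X z ε Θ C s'.2)).expect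
              fun s' => if GoodSolution X k z ε b s'.2 then 0 else Φ s'.1) +
            p.expect (fun s' => if GoodSolution X k z ε b s'.2 then 0 else 1)) := by ring
      _ ≤ _ := by gcongr

theorem guessRound_support {Δ : ℝ} (hε : 0 < ε) (hX : SpreadBetween X Δ) (am : ArgminRule (Pt d))
    (hk : 1 ≤ k) (hkX : k < X.card) (hb : b ≠ ∞) {o : Finset (Pt d) × Finset (Pt d)}
    (ho : ValidBest X k z ε o) (N i : ℕ) :
    ∀ o' ∈ (guessRound am X k z ε N i o).support, ValidBest X k z ε o' ∧
      (GoodSolution X k z ε b o → GoodSolution X k z ε b o') := by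
  intro o' ho'
  have h := penaltyEquiv_penalty (z := z) hε hX i
  rw [guessRound, PMF.mem_support_bind_iff] at ho'
  obtain ⟨C, hC, ho'⟩ := ho'
  rw [PMF.support_map] at ho'
  obtain ⟨s', hs', rfl⟩ := ho'
  obtain ⟨-, h2, h3, -⟩ := innerLoop_support h am hk hkX hb (s := (C, o))
    (kmeansPP_support h hkX.le hC) ho N s' hs'
  exact ⟨h2, h3⟩

theorem guessRounds_support {Δ : ℝ} (hε : 0 < ε) (hX : SpreadBetween X Δ) (am : ArgminRule (Pt d))
    (hk : 1 ≤ k) (hkX : k < X.card) (N r : ℕ) :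
    ∀ o ∈ (guessRounds am X k z ε N r).support, ValidBest X k z ε o := by
  induction r with
  | zero =>
    intro o ho
    exact Or.inl (by simpa [guessRounds] using ho)
  | succ r ih =>
    intro o ho
    rw [guessRounds, PMF.mem_support_bind_iff] at ho
    obtain ⟨o₁, ho₁, ho⟩ := ho
    exact (guessRound_support (b := 0) hε hX am hk hkX (by simp) (ih o₁ ho₁) N r o ho).1

/-- A round that succeeds with constant probability suffices. -/
theorem guessRounds_expect_le {Δ : ℝ} (hε : 0 < ε) (hX : SpreadBetween X Δ)
    (am : ArgminRule (Pt d)) (hk : 1 ≤ k) (hkX : k < X.card) (hb : b ≠ ∞) {N i : ℕ} {q : ℝ≥0∞}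
    (hq : ∀ o, ValidBest X k z ε o → (guessRound am X k z ε N i o).expect
      (fun o' => if GoodSolution X k z ε b o' then 0 else 1) ≤ q) {r : ℕ} (hr : i < r) :
    (guessRounds am X k z ε N r).expect
      (fun o' => if GoodSolution X k z ε b o' then 0 else 1) ≤ q := by
  induction r, hr using Nat.le_induction with
  | base =>
    rw [guessRounds, PMF.expect_bind]
    refine le_trans (PMF.expect_mono _ fun o ho => ?_) (PMF.expect_const _ q).le
    exact hq o (guessRounds_support hε hX am hk hkX N i o ho)
  | succ r hr ih =>
    refine le_trans ?_ ih
    rw [guessRounds, PMF.expect_bind]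
    refine PMF.expect_mono _ fun o ho => ?_
    have ho' := guessRounds_support hε hX am hk hkX N r o ho
    rw [← PMF.expect_const (guessRound am X k z ε N r o)
      (if GoodSolution X k z ε b o then 0 else 1)]
    refine PMF.expect_mono _ fun o' h' => ?_
    have h2 := (guessRound_support hε hX am hk hkX hb ho' N r o' h').2
    by_cases hg : GoodSolution X k z ε b o
    · simp [hg, h2 hg]
    · simp only [hg, if_false]
      split_ifs <;> simp

end Best

/-! ### The guarantee of the algorithm -/

section Guarantee
variable {d : ℕ}

/-- For z = 0 both sides are empty: finite costs never equal `∞`, and squared distances in `X` stay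
below Δ² + 1. -/
theorem outPts_penalty {X : Finset (Pt d)} {z : ℕ} {ε Δ : ℝ} (hε : 0 < ε)
    (hX : SpreadBetween X Δ) (i : ℕ) {C : Finset (Pt d)} (hC : C ⊆ X) (hne : C.Nonempty) :
    outPts (10 * penalty z ε i) X C =
      X.filter fun x => 10 * realPenalty z ε Δ i ≤ dist x (nearest C x) ^ 2 := by
  refine Finset.filter_congr fun x hx => ?_
  rw [tauPt, phiPt_eq_nearest hne]
  have hpos := (penaltyEquiv_penalty (z := z) hε hX i).1
  by_cases hz : z = 0
  · subst hz
    rw [penalty_zero hε, ENNReal.mul_top (by norm_num), top_inf_eq, realPenalty, if_pos rfl]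
    have := hX.sq_le hx (hC (nearest_mem hne x))
    simp only [ENNReal.ofReal_ne_top, false_iff, not_le]
    nlinarith [sq_nonneg Δ]
  · rw [penalty_eq_ofReal hz]
    rw [realPenalty, if_neg hz] at hpos ⊢
    have h10 : (10 : ℝ≥0∞) = ENNReal.ofReal 10 := by norm_num
    rw [h10, ← ENNReal.ofReal_mul (by norm_num), min_eq_left_iff,
      ENNReal.ofReal_le_ofReal_iff (sq_nonneg _)]

theorem phi_eq_ofReal_sum {Y C : Finset (Pt d)} (hne : C.Nonempty) :
    phi Y C = ENNReal.ofReal (∑ x ∈ Y, dist x (nearest C x) ^ 2) := by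
  rw [phi, ENNReal.ofReal_sum_of_nonneg fun _ _ => sq_nonneg _]
  exact Finset.sum_congr rfl fun x _ => phiPt_eq_nearest hne x

/-- The choice β = 300/ε gives εzΘ = 300·2^i ≥ 65P, which absorbs the surplus of outliers. A point
that is not an outlier costs at most 10 times its truncated cost. -/
theorem goodCenters_of_nearOptimal {X O Cs : Finset (Pt d)} {σ : Pt d → Pt d} (hO : O ⊆ X)
    (hσ : ∀ x ∈ X \ O, σ x ∈ Cs) {ε Δ : ℝ} (hε : 0 < ε) (hX : SpreadBetween X Δ)
    {P : ℝ} (hP : ∑ i ∈ Cs, clusterCost X O σ i = P) {i : ℕ} (hPi : 65 * P ≤ 300 * 2 ^ i)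
    {C : Finset (Pt d)} (hC : C ⊆ X) (hne : C.Nonempty) {b : ℝ}
    (hb : 80 * (O.card * realPenalty O.card ε Δ i + 64 * P) ≤ b)
    (h : NearOptimal X O Cs σ (realPenalty O.card ε Δ i) P C) :
    GoodCenters X O.card ε (penalty O.card ε i) (ENNReal.ofReal b) C := by
  have hpos := (penaltyEquiv_penalty (z := O.card) hε hX i).1
  have hcard := h.card_le hO hσ hpos hne hP
  rw [GoodCenters, outPts_penalty hε hX i hC hne]
  constructor
  · by_cases hz : O.card = 0
    · rw [hz, Nat.cast_zero, mul_zero, Nat.cast_nonpos, Finset.card_eq_zero,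
        Finset.filter_eq_empty_iff]
      intro x hx
      rw [realPenalty, if_pos rfl]
      have := hX.sq_le hx (hC (nearest_mem hne x))
      nlinarith [sq_nonneg Δ]
    · have hz' : (0 : ℝ) < O.card := by exact_mod_cast Nat.pos_of_ne_zero hz
      have hΘ : ε * O.card * realPenalty O.card ε Δ i = 300 * 2 ^ i := by
        rw [realPenalty, if_neg hz]
        field_simp
      refine le_of_mul_le_mul_right ?_ hpos
      nlinarith
  · rw [phi_eq_ofReal_sum hne]
    refine ENNReal.ofReal_le_ofReal (le_trans ?_ hb)
    have h1 : ∑ x ∈ X \ X.filter (fun x => 10 * realPenalty O.card ε Δ i ≤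
        dist x (nearest C x) ^ 2), dist x (nearest C x) ^ 2 ≤
        ∑ x ∈ X, 10 * truncSq (realPenalty O.card ε Δ i) x C := by
      refine le_trans (Finset.sum_le_sum fun x hx => ?_) (Finset.sum_le_sum_of_subset_of_nonneg
        Finset.sdiff_subset fun x _ _ => mul_nonneg (by norm_num) (truncSq_nonneg hpos.le))
      rw [Finset.mem_sdiff, Finset.mem_filter, not_and, not_le] at hx
      have h2 := hx.2 hx.1
      rw [truncSq_eq_min_nearest hne, mul_min_of_nonneg _ _ (by norm_num : (0 : ℝ) ≤ 10)]
      exact le_min h2.le (by nlinarith [sq_nonneg (dist x (nearest C x))])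
    rw [← Finset.mul_sum] at h1
    have h2 := h.2
    unfold truncSum at h2
    linarith

theorem optCost_le {X : Finset (Pt d)} {k z : ℕ} {Δ : ℝ} (hX : SpreadBetween X Δ) (hk : 1 ≤ k)
    (hkz : k + z < X.card) : optCost X k z ≤ ENNReal.ofReal (X.card * Δ ^ 2) := by
  obtain ⟨C, hC, hCk⟩ := Finset.exists_subset_card_eq (s := X) (n := k) (by omega)
  obtain ⟨O, hO, hOz⟩ := Finset.exists_subset_card_eq (s := X) (n := z) (by omega)
  have hne : C.Nonempty := Finset.card_pos.1 (by omega)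
  refine (iInf₂_le C hCk).trans ((iInf₂_le O ⟨hO, hOz⟩).trans ?_)
  rw [phi_eq_ofReal_sum hne]
  refine ENNReal.ofReal_le_ofReal ?_
  calc ∑ x ∈ X \ O, dist x (nearest C x) ^ 2 ≤ ∑ x ∈ X, dist x (nearest C x) ^ 2 :=
        Finset.sum_le_sum_of_subset_of_nonneg Finset.sdiff_subset fun _ _ _ => sq_nonneg _
    _ ≤ ∑ x ∈ X, Δ ^ 2 := Finset.sum_le_sum fun x hx => hX.sq_le hx (hC (nearest_mem hne x))
    _ = X.card * Δ ^ 2 := by simp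

/-- More than k points remain, so two of them share a nearest center. Being at distance at least 1
from each other, they have squared distances to it that sum to at least 1/2. This lower bound lets
the guesses start at 1. -/
theorem half_le_optCost {X : Finset (Pt d)} {k z : ℕ} {Δ : ℝ} (hX : SpreadBetween X Δ)
    (hk : 1 ≤ k) (hkz : k + z < X.card) : ENNReal.ofReal (1 / 2) ≤ optCost X k z := by
  refine le_iInf₂ fun C hC => le_iInf₂ fun O hO => ?_
  have hne : C.Nonempty := Finset.card_pos.1 (by omega)
  have hcard : C.card < (X \ O).card := by
    have := Finset.card_sdiff_of_subset hO.1
    omega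
  obtain ⟨x, hx, y, hy, hxy, h⟩ := Finset.exists_ne_map_eq_of_card_lt_of_maps_to hcard
    (f := nearest C) fun x _ => nearest_mem hne x
  rw [phi_eq_ofReal_sum hne]
  refine ENNReal.ofReal_le_ofReal ?_
  have h1 : ∑ u ∈ {x, y}, dist u (nearest C u) ^ 2 ≤
      ∑ u ∈ X \ O, dist u (nearest C u) ^ 2 :=
    Finset.sum_le_sum_of_subset_of_nonneg (Finset.insert_subset hx (Finset.singleton_subset_iff.2 hy))
      fun _ _ _ => sq_nonneg _
  rw [Finset.sum_pair hxy, ← h] at h1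
  have h2 := (hX x (Finset.mem_sdiff.1 hx).1 y (Finset.mem_sdiff.1 hy).1 hxy).1
  have h3 := dist_triangle_right x y (nearest C x)
  nlinarith [sq_nonneg (dist x (nearest C x) - dist y (nearest C x))]

/-- A nearly optimal solution, with the induced clusters. -/
theorem exists_nearly_optimal {X : Finset (Pt d)} {k z : ℕ} {Δ : ℝ} (hX : SpreadBetween X Δ)
    (hk : 1 ≤ k) (hkz : k + z < X.card) :
    ∃ (opt : ℝ) (Cs O : Finset (Pt d)) (σ : Pt d → Pt d), optCost X k z = ENNReal.ofReal opt ∧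
      1 / 2 ≤ opt ∧ opt ≤ X.card * Δ ^ 2 ∧ Cs.card = k ∧ O ⊆ X ∧ O.card = z ∧
      (∀ x ∈ X \ O, σ x ∈ Cs) ∧ opt ≤ ∑ i ∈ Cs, clusterCost X O σ i ∧
      ∑ i ∈ Cs, clusterCost X O σ i ≤ 2 * opt := by
  have h1 := half_le_optCost hX hk hkz
  have h2 := optCost_le hX hk hkz
  have htop : optCost X k z ≠ ∞ := (h2.trans_lt ENNReal.ofReal_lt_top).ne
  have h3 : optCost X k z = ENNReal.ofReal (optCost X k z).toReal :=
    (ENNReal.ofReal_toReal htop).symm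
  set opt := (optCost X k z).toReal with hopt
  have hopt0 : 0 ≤ opt := ENNReal.toReal_nonneg
  rw [h3] at h1 h2
  have h4 : 1 / 2 ≤ opt := (ENNReal.ofReal_le_ofReal_iff hopt0).1 h1
  have h5 : opt ≤ X.card * Δ ^ 2 := (ENNReal.ofReal_le_ofReal_iff (mul_nonneg (Nat.cast_nonneg _) (sq_nonneg _))).1 h2
  -- The factor 2 makes it unnecessary to know that the infimum is attained; `opt > 0` makes the
  -- inequality strict.
  have h6 : optCost X k z < ENNReal.ofReal (2 * opt) := by
    rw [h3]; exact (ENNReal.ofReal_lt_ofReal_iff (by linarith)).2 (by linarith)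
  rw [optCost] at h6
  simp only [iInf_lt_iff] at h6
  obtain ⟨Cs, hCs, O, hO, h6⟩ := h6
  have hne : Cs.Nonempty := Finset.card_pos.1 (by omega)
  have hσ : ∀ x ∈ X \ O, nearest Cs x ∈ Cs := fun x _ => nearest_mem hne x
  have h7 : ∑ i ∈ Cs, clusterCost X O (nearest Cs) i =
      ∑ x ∈ X \ O, dist x (nearest Cs x) ^ 2 := by
    rw [← Finset.sum_fiberwise_of_maps_to hσ]
    refine Finset.sum_congr rfl fun i _ => Finset.sum_congr rfl fun x hx => ?_
    rw [(mem_clusterOf.1 hx).2]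
  have h8 : optCost X k z ≤ phi (X \ O) Cs := (iInf₂_le Cs hCs).trans (iInf₂_le O hO)
  rw [phi_eq_ofReal_sum hne, ← h7] at h6 h8
  rw [h3] at h8
  have h9 : 0 ≤ ∑ i ∈ Cs, clusterCost X O (nearest Cs) i :=
    Finset.sum_nonneg fun _ _ => clusterCost_nonneg
  exact ⟨opt, Cs, O, nearest Cs, h3, h4, h5, hCs, hO.1, hO.2, hσ,
    (ENNReal.ofReal_le_ofReal_iff h9).1 h8,
    ((ENNReal.ofReal_lt_ofReal_iff (by linarith)).1 h6).le⟩

/-- One of the guesses `2^i` is the optimal cost up to a factor `2`. -/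
theorem exists_guess {opt v : ℝ} (h1 : 1 / 2 ≤ opt) (h2 : opt ≤ v) :
    ∃ i < ⌈Real.logb 2 v⌉₊ + 1, opt ≤ 2 ^ i ∧ (2 : ℝ) ^ i ≤ 2 * opt := by
  have hv : 0 < v := by linarith
  have hex : ∃ i : ℕ, opt ≤ 2 ^ i := by
    refine ⟨⌈Real.logb 2 v⌉₊, h2.trans ?_⟩
    rw [← Real.rpow_natCast, ← Real.logb_le_iff_le_rpow (by norm_num) hv]
    exact Nat.le_ceil _
  refine ⟨Nat.find hex, ?_, Nat.find_spec hex, ?_⟩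
  · refine Nat.lt_succ_of_le (Nat.find_min' hex (h2.trans ?_))
    rw [← Real.rpow_natCast, ← Real.logb_le_iff_le_rpow (by norm_num) hv]
    exact Nat.le_ceil _
  -- If already the first guess 1 is large enough, then 1 ≤ 2·opt holds because opt ≥ 1/2.
  · rcases h : Nat.find hex with _ | i
    · simp; linarith
    · have := Nat.find_min hex (m := i) (by omega)
      rw [not_le] at this
      rw [pow_succ]
      linarith

theorem log_two_add_log_le (k : ℕ) :
    Real.log (2 + Real.log k) ≤ 2 + max 1 (Real.log (Real.log k)) := by
  have hL : 0 ≤ Real.log k := Real.log_natCast_nonneg k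
  set L := Real.log k
  have h3 : Real.log 3 ≤ 2 := by
    have := Real.log_le_sub_one_of_pos (x := 3) (by norm_num)
    linarith
  rcases le_or_gt L 1 with h | h
  · have h1 : Real.log (2 + L) ≤ Real.log 3 := Real.log_le_log (by linarith) (by linarith)
    have := le_max_left 1 (Real.log L)
    linarith
  · have h1 : Real.log (2 + L) ≤ Real.log (3 * L) := Real.log_le_log (by linarith) (by linarith)
    rw [Real.log_mul (by norm_num) (by linarith)] at h1
    have := le_max_right 1 (Real.log L)
    linarith

/-- The number of steps exceeds the initial potential. -/
theorem hittingPotential_le_numSteps {A ε B P : ℝ} {k : ℕ} (hA : 50000 ≤ A) (hε : 0 < ε)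
    (hε1 : ε ≤ 1) (hk : 1 ≤ k) (hB0 : 0 ≤ B) (hP : 0 < P) (hB : B ≤ 600 / ε * P) :
    hittingPotential (1024 * k) B (64 * P) ((B + 16 * P) * (2 + Real.log k) + 64 * P) ≤
      ((numSteps A k ε : ℝ) - 1) / 2 := by
  have hk' : (1 : ℝ) ≤ k := by exact_mod_cast hk
  have hL : 0 ≤ Real.log k := Real.log_natCast_nonneg k
  have hinv : 1 ≤ 1 / ε := (one_le_div hε).2 hε1
  set e := 1 / ε with he
  set L := Real.log k
  set W := (B + 16 * P) * (2 + L) + 64 * P with hW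
  have hW0 : 0 < W := by positivity
  have hBm : B / (64 * P) ≤ 10 * e := by
    rw [div_le_iff₀ (by positivity)]
    have : 600 / ε * P = 600 * e * P := by rw [he]; ring
    nlinarith [mul_pos (show 0 < e by linarith) hP]
  have hWm : W / (64 * P) ≤ (10 * e + 2) * (2 + L) := by
    have h1 : W / (64 * P) = (B / (64 * P) + 1 / 4) * (2 + L) + 1 := by
      rw [hW]; field_simp; ring
    rw [h1]
    nlinarith [mul_nonneg (sub_nonneg.2 hBm) (by linarith : 0 ≤ 2 + L)]
  have hlog : Real.log (W / (64 * P)) ≤ 10 * e + 1 + (2 + max 1 (Real.log L)) := by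
    have h1 : Real.log (W / (64 * P)) ≤ Real.log ((10 * e + 2) * (2 + L)) :=
      Real.log_le_log (by positivity) hWm
    rw [Real.log_mul (by linarith) (by linarith)] at h1
    -- The crude linear bound suffices, as B/m contributes a term of order 1/ε anyway.
    have h2 : Real.log (10 * e + 2) ≤ 10 * e + 2 - 1 :=
      Real.log_le_sub_one_of_pos (by linarith)
    have := log_two_add_log_le k
    linarith
  have hBW : 0 ≤ B / W := by positivity
  set LL := max 1 (Real.log L) with hLL
  set LE := max 1 (Real.log (1 / ε)) with hLE
  have hLL1 : 1 ≤ LL := le_max_left _ _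
  have hLE1 : 1 ≤ LE := le_max_left _ _
  have hpot : hittingPotential (1024 * k) B (64 * P) W ≤ 1024 * k * (23 * e + LL) := by
    unfold hittingPotential
    refine mul_le_mul_of_nonneg_left ?_ (by positivity)
    linarith
  have hN : A * (k * LL + k * LE * e) ≤ numSteps A k ε := by
    have h1 : k * LE * e = k * LE / ε := by rw [he]; ring
    rw [h1]
    exact Nat.le_ceil _
  have h1 : (k : ℝ) * e ≤ k * LE * e := by
    have : (k : ℝ) * e * 1 ≤ k * e * LE := by gcongr
    linarith
  have h2 : (1 : ℝ) ≤ k * LL := by nlinarith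
  have h3 : 0 ≤ (k : ℝ) * e := by positivity
  -- 50000 exceeds 2·1024·23 = 47104 with room for the −1 on the right.
  have h4 : 50000 * (k * LL + k * LE * e) ≤ A * (k * LL + k * LE * e) := by
    gcongr
  nlinarith

theorem one_add_harmonic_le (k : ℕ) : 1 + (harmonic k : ℝ) ≤ 2 + Real.log k := by
  have := harmonic_le_one_add_log k
  linarith

/-- The round with the correct guess succeeds with probability at least `1/2`. -/
theorem guessRound_expect_le {X O Cs : Finset (Pt d)} {σ : Pt d → Pt d} (hO : O ⊆ X)
    (hσ : ∀ x ∈ X \ O, σ x ∈ Cs) {A ε Δ : ℝ} (hA : 50000 ≤ A) (hε : 0 < ε) (hε1 : ε ≤ 1)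
    (hX : SpreadBetween X Δ) (hk : 1 ≤ Cs.card) (hkX : Cs.card < X.card) {P : ℝ} (hP0 : 0 < P)
    (hP : ∑ i ∈ Cs, clusterCost X O σ i = P) {i : ℕ} (hPi : 65 * P ≤ 300 * 2 ^ i)
    (hiP : (2 : ℝ) ^ i ≤ 2 * P) {b : ℝ} (hb : 80 * (300 / ε * 2 ^ i + 64 * P) ≤ b)
    (am : ArgminRule (Pt d)) {o : Finset (Pt d) × Finset (Pt d)}
    (ho : ValidBest X Cs.card O.card ε o) :
    (guessRound am X Cs.card O.card ε (numSteps A Cs.card ε) i o).expect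
      (fun o' => if GoodSolution X Cs.card O.card ε (ENNReal.ofReal b) o' then 0 else 1) ≤
      1 / 2 := by
  have h := penaltyEquiv_penalty (z := O.card) hε hX i
  set Θ := penalty O.card ε i
  set Θ' := realPenalty O.card ε Δ i with hΘ'
  set k := Cs.card with hkdef
  set B := O.card * Θ' with hBdef
  set m := 64 * P with hm
  set K : ℝ := 1024 * k with hK
  have hB0 : 0 ≤ B := mul_nonneg (Nat.cast_nonneg _) h.1.le
  have hBle : B ≤ 300 / ε * 2 ^ i := by
    rw [hBdef, hΘ', realPenalty]
    split_ifs with hz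
    · rw [hz, Nat.cast_zero, zero_mul]; positivity
    · have hz' : (O.card : ℝ) ≠ 0 := by exact_mod_cast hz
      rw [mul_div_cancel₀ _ hz']
  let Φ : Finset (Pt d) → ℝ≥0∞ := fun C =>
    ENNReal.ofReal (hittingPotential K B m (excess X Θ' B m C))
  have hK0 : 0 ≤ K := by positivity
  have hm0 : 0 < m := by positivity
  have hpot := hittingPotential_le_numSteps hA hε hε1 hk hB0 hP0
    (hBle.trans (by
      have : 600 / ε * P = 300 / ε * (2 * P) := by ring
      rw [this]; gcongr))
  set N := numSteps A k ε with hN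
  set W := (B + 16 * P) * (2 + Real.log k) + 64 * P with hW
  have hL : 0 ≤ Real.log k := Real.log_natCast_nonneg k
  have hWm : m ≤ W := by
    have : 0 ≤ (B + 16 * P) * (2 + Real.log k) := by positivity
    linarith
  have hpos : 1 < N := by
    have h1 : A * (k * max 1 (Real.log (Real.log k)) + k * max 1 (Real.log (1 / ε)) / ε) ≤ N :=
      Nat.le_ceil _
    have h2 : (1 : ℝ) ≤ k * max 1 (Real.log (Real.log k)) := by
      have h3 : (1 : ℝ) ≤ k := by exact_mod_cast hk
      have h4 := le_max_left 1 (Real.log (Real.log k))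
      nlinarith
    have h3 : 0 ≤ k * max 1 (Real.log (1 / ε)) / ε := by
      have := le_max_left 1 (Real.log (1 / ε))
      positivity
    have h4 : (1 : ℝ) < N := by nlinarith
    exact_mod_cast h4
  have hseed : (kmeansPP X Θ k).expect Φ ≤ ENNReal.ofReal (hittingPotential K B m W) := by
    set s := K * ((W + B) / W ^ 2) with hs
    have hW0 : 0 < W := hm0.trans_le hWm
    have hs0 : 0 ≤ s := by positivity
    -- Jensen's inequality by the tangent at `W`, an upper bound for the expected excess after
    -- seeding. The term s·W stands on the left to avoid subtraction in `ℝ≥0∞`.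
    have h1 : ∀ C, Φ C + ENNReal.ofReal (s * W) ≤ ENNReal.ofReal (hittingPotential K B m W + s * m)
        + ENNReal.ofReal s * ENNReal.ofReal (truncSum Θ' X C) := by
      intro C
      have h2 := hittingPotential_le_tangent (W := W) (W' := excess X Θ' B m C) hK0 hB0 hm0 hW0
        (hm0.trans_le le_excess)
      have h3 : 0 ≤ hittingPotential K B m (excess X Θ' B m C) :=
        hittingPotential_nonneg hK0 hB0 hm0 le_excess
      have h4 : 0 ≤ hittingPotential K B m W := hittingPotential_nonneg hK0 hB0 hm0 hWm
      have h5 : excess X Θ' B m C ≤ truncSum Θ' X C + m := by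
        have : 0 ≤ truncSum Θ' X C := truncSum_nonneg h.1.le
        unfold excess
        gcongr
        exact max_le (by linarith) this
      have h6 := mul_le_mul_of_nonneg_left h5 hs0
      rw [← ENNReal.ofReal_mul hs0, ← ENNReal.ofReal_add h3 (by positivity),
        ← ENNReal.ofReal_add (by positivity) (mul_nonneg hs0 (truncSum_nonneg h.1.le))]
      refine ENNReal.ofReal_le_ofReal ?_
      linarith
    have h2 := PMF.expect_mono (kmeansPP X Θ k) fun C _ => h1 C
    rw [PMF.expect_add, PMF.expect_add, PMF.expect_const, PMF.expect_const,
      PMF.expect_const_mul] at h2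
    have h3 : (kmeansPP X Θ k).expect (fun C => ENNReal.ofReal (truncSum Θ' X C)) ≤
        ENNReal.ofReal (W - m) := by
      refine (kmeansPP_expect_le hO hσ h hkX).trans (ENNReal.ofReal_le_ofReal ?_)
      rw [hP, ← hkdef, ← hBdef, hW, hm, add_sub_cancel_right]
      have := one_add_harmonic_le k
      gcongr
    have h4 : 0 ≤ hittingPotential K B m W := hittingPotential_nonneg hK0 hB0 hm0 hWm
    have h5 : (kmeansPP X Θ k).expect Φ + ENNReal.ofReal (s * W) ≤
        ENNReal.ofReal (hittingPotential K B m W) + ENNReal.ofReal (s * W) := by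
      refine h2.trans ?_
      calc _ ≤ ENNReal.ofReal (hittingPotential K B m W + s * m) +
            ENNReal.ofReal s * ENNReal.ofReal (W - m) := by gcongr
        _ = ENNReal.ofReal (hittingPotential K B m W) + ENNReal.ofReal (s * W) := by
          rw [← ENNReal.ofReal_mul hs0, ← ENNReal.ofReal_add (by positivity)
            (mul_nonneg hs0 (by linarith)), ← ENNReal.ofReal_add h4 (by positivity)]
          congr 1
          ring
    exact (ENNReal.add_le_add_iff_right ENNReal.ofReal_ne_top).1 h5
  have hloop : ∀ C ∈ (kmeansPP X Θ k).support, ((N - 1 : ℕ) : ℝ≥0∞) *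
      (innerLoop am X O.card ε Θ N (C, o)).expect
        (fun s' => if GoodSolution X k O.card ε (ENNReal.ofReal b) s'.2 then 0 else 1) ≤ Φ C := by
    intro C hC
    have hC' := kmeansPP_support h hkX.le hC
    have h1 := innerLoop_expect_le (b := ENNReal.ofReal b) h am hk hkX ENNReal.ofReal_ne_top
      (s := (C, o)) hC' ho Φ
      (fun C hC hCk => localSearchStep_expect_le h am hC (Finset.card_pos.1 (by omega)) (by omega)
        hK0 hB0 hm0)
      (fun C hC hCk hgood => by
        have hne : C.Nonempty := Finset.card_pos.1 (by omega)
        have h2 := localSearchStep_expect_add_one_le hO hσ h am hC hne (by omega) hCk.symm hP0 hP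
          (fun h3 => hgood (goodCenters_of_nearOptimal hO hσ hε hX hP hPi hC hne
            (le_trans (by gcongr) hb) h3))
        rw [hCk] at h2
        exact h2) (N - 1)
    rw [Nat.sub_add_cancel hpos.le] at h1
    exact le_self_add.trans h1
  rw [guessRound, PMF.expect_bind]
  simp only [PMF.expect_map]
  have h1 := (PMF.expect_mono _ hloop).trans hseed
  rw [PMF.expect_const_mul] at h1
  have hN0 : ((N - 1 : ℕ) : ℝ≥0∞) ≠ 0 := by
    rw [Nat.cast_ne_zero]; omega
  have h2 : ENNReal.ofReal (hittingPotential K B m W) ≤ ((N - 1 : ℕ) : ℝ≥0∞) * (1 / 2) := by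
    have h3 : ((N - 1 : ℕ) : ℝ≥0∞) * (1 / 2) = ENNReal.ofReal (((N : ℝ) - 1) / 2) := by
      have h4 : ((N : ℝ) - 1) = ((N - 1 : ℕ) : ℝ) := by push_cast [hpos.le]; ring
      rw [h4, ENNReal.ofReal_div_of_pos (by norm_num), ENNReal.ofReal_natCast, one_div,
        ENNReal.div_eq_inv_mul, mul_comm]
      norm_num
    rw [h3]
    exact ENNReal.ofReal_le_ofReal hpot
  exact (ENNReal.mul_le_mul_iff_right hN0 (ENNReal.natCast_ne_top _)).1 (h1.trans h2)

/-- The algorithm succeeds with probability at least `1/2`. -/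
theorem half_le_localSearchOutliers {A ε Δ : ℝ} (hA : 50000 ≤ A) {k z : ℕ} {X : Finset (Pt d)}
    (hε : 0 < ε) (hε1 : ε ≤ 1) (hk : 1 ≤ k) (hkz : k + z < X.card) (hX : SpreadBetween X Δ)
    (am : ArgminRule (Pt d)) :
    ENNReal.ofReal (1 / 2) ≤ (localSearchOutliers am X k z ε Δ (numSteps A k ε)).toOuterMeasure
      {o | GoodOutput X k z ε 60000 o} := by
  obtain ⟨opt, Cs, O, σ, hopt, h1, h2, rfl, hO, rfl, hσ, h3, h4⟩ :=
    exists_nearly_optimal hX hk hkz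
  obtain ⟨i, hi, hi1, hi2⟩ := exists_guess h1 h2
  have hb : ENNReal.ofReal (60000 / ε) * optCost X Cs.card O.card =
      ENNReal.ofReal (60000 / ε * opt) := by
    rw [hopt, ENNReal.ofReal_mul (by positivity)]
  have hset : {o | GoodOutput X Cs.card O.card ε 60000 o} =
      {o | GoodSolution X Cs.card O.card ε (ENNReal.ofReal (60000 / ε * opt)) o} := by
    ext o
    simp only [Set.mem_ofPred_eq, GoodOutput, GoodSolution, hb]
  rw [hset, PMF.toOuterMeasure_eq_expect]
  set p := localSearchOutliers am X Cs.card O.card ε Δ (numSteps A Cs.card ε) with hp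
  have hbad : p.expect (fun o => if GoodSolution X Cs.card O.card ε
      (ENNReal.ofReal (60000 / ε * opt)) o then 0 else 1) ≤ 1 / 2 := by
    refine guessRounds_expect_le hε hX am hk (by omega) ENNReal.ofReal_ne_top
      (fun o ho => guessRound_expect_le hO hσ hA hε hε1 hX hk (by omega) (by linarith) rfl
        (by linarith) (by linarith) ?_ am ho) hi
    -- Since 2^i ≤ 2·opt, P ≤ 2·opt and ε ≤ 1, the cost is at most 80·(600 + 128)·opt/ε =
    -- 58240·opt/ε.
    have hinv : 1 ≤ 1 / ε := (one_le_div hε).2 hε1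
    have h5 : 300 / ε * 2 ^ i ≤ 300 / ε * (2 * opt) := by gcongr
    have h6 : 300 / ε * (2 * opt) = 600 * (1 / ε * opt) := by ring
    have h7 : 60000 / ε * opt = 60000 * (1 / ε * opt) := by ring
    have h8 : opt ≤ 1 / ε * opt := by nlinarith
    rw [h7]
    linarith
  have hsum : p.expect ({o | GoodSolution X Cs.card O.card ε
      (ENNReal.ofReal (60000 / ε * opt)) o}.indicator 1) +
      p.expect (fun o => if GoodSolution X Cs.card O.card ε
      (ENNReal.ofReal (60000 / ε * opt)) o then 0 else 1) = 1 := by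
    rw [← PMF.expect_add]
    refine Eq.trans ?_ (PMF.expect_const p 1)
    congr 1
    funext o
    by_cases hg : GoodSolution X Cs.card O.card ε (ENNReal.ofReal (60000 / ε * opt)) o <;> simp [hg]
  have h9 : ENNReal.ofReal (1 / 2) + 1 / 2 = 1 := by
    rw [one_div, ENNReal.ofReal_inv_of_pos (by norm_num), one_div]
    simpa using ENNReal.inv_two_add_inv_two
  have h10 : ENNReal.ofReal (1 / 2) + 1 / 2 ≤ p.expect ({o | GoodSolution X Cs.card O.card ε
      (ENNReal.ofReal (60000 / ε * opt)) o}.indicator 1) + 1 / 2 := by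
    rw [h9]
    exact hsum.symm.le.trans (add_le_add le_rfl hbad)
  exact (ENNReal.add_le_add_iff_right (by norm_num)).1 h10

end Guarantee

/-! ### A program logic for the machine -/

section Logic

/-- Started in `s`, the machine halts after at most `T` steps, and the law of the result `f` is
`ν`. -/
def Halts {Ω : Type} (D : ℕ → ℕ → ℝ) (f : Mem → Ω) (T : ℕ) (s : Config) (ν : PMF Ω) : Prop :=
  (∀ s' ∈ (runFor D T s).support, s'.1 = []) ∧ (runFor D T s).map (fun s' => f s'.2) = ν

variable {D : ℕ → ℕ → ℝ}

/-- `runFor` appends steps at the end, whereas reasoning about a program peels off the first one. -/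
theorem runFor_succ_eq (T : ℕ) (s : Config) :
    runFor D (T + 1) s = (machineStep D s).bind (runFor D T) := by
  induction T generalizing s with
  | zero => simp [runFor]
  | succ T ih =>
    rw [runFor, ih, PMF.bind_bind]
    rfl

theorem Halts.step {Ω : Type} {f : Mem → Ω} {T : ℕ} {s : Config} {G : Config → PMF Ω}
    (h : ∀ s' ∈ (machineStep D s).support, Halts D f T s' (G s')) :
    Halts D f (T + 1) s ((machineStep D s).bind G) := by
  refine ⟨fun s' hs' => ?_, ?_⟩
  · rw [runFor_succ_eq, PMF.mem_support_bind_iff] at hs'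
    obtain ⟨s₁, h1, h2⟩ := hs'
    exact (h s₁ h1).1 s' h2
  · rw [runFor_succ_eq, PMF.map_bind]
    exact PMF.bind_congr_support _ fun s' hs' => (h s' hs').2

theorem Halts.step_pure {Ω : Type} {f : Mem → Ω} {T : ℕ} {s s' : Config} {ν : PMF Ω}
    (hs : machineStep D s = PMF.pure s') (h : Halts D f T s' ν) : Halts D f (T + 1) s ν := by
  have := Halts.step (D := D) (f := f) (T := T) (s := s) (G := fun _ => ν) (by
    rw [hs]; intro s₁ h1; rw [PMF.support_pure, Set.mem_singleton_iff] at h1; rwa [h1])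
  rwa [PMF.bind_const] at this

/-- Halted configurations are fixed points of the machine, so step bounds may be rounded up. -/
theorem Halts.mono {Ω : Type} {f : Mem → Ω} {T T' : ℕ} {s : Config} {ν : PMF Ω}
    (h : Halts D f T s ν) (hT : T ≤ T') : Halts D f T' s ν := by
  induction T', hT using Nat.le_induction with
  | base => exact h
  | succ T' _ ih =>
    have : runFor D (T' + 1) s = runFor D T' s := by
      rw [runFor]
      conv_rhs => rw [← PMF.bind_pure (runFor D T' s)]
      refine PMF.bind_congr_support _ fun s' hs' => ?_
      obtain ⟨K, m⟩ := s'
      have : K = [] := ih.1 _ hs'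
      subst this
      rfl
    unfold Halts
    rw [this]
    exact ih

/-- Started in the memory `m`, the program `P` needs at most `t` steps and yields a random result
with law `κ`; if the result is `b`, then the memory satisfies `Q b`. -/
def Wp (D : ℕ → ℕ → ℝ) (P : Prog) (m : Mem) (t : ℕ) {β : Type} (κ : PMF β)
    (Q : β → Mem → Prop) : Prop :=
  ∀ (Ω : Type) (f : Mem → Ω) (K : List Prog) (u : ℕ) (G : β → PMF Ω),
    (∀ b ∈ κ.support, ∀ m', Q b m' → Halts D f u (K, m') (G b)) →
      Halts D f (t + u) (P :: K, m) (κ.bind G)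

/-- The program `P` needs at most `t` steps and yields a memory that satisfies `Q`. -/
def Det (D : ℕ → ℕ → ℝ) (P : Prog) (m : Mem) (t : ℕ) (Q : Mem → Prop) : Prop :=
  Wp D P m t (PMF.pure ()) fun _ => Q

variable {β γ : Type} {P R : Prog} {m : Mem} {t t' : ℕ} {κ : PMF β}

theorem Wp.conseq {Q Q' : β → Mem → Prop} (h : Wp D P m t κ Q) (ht : t ≤ t')
    (hQ : ∀ b ∈ κ.support, ∀ m', Q b m' → Q' b m') : Wp D P m t' κ Q' :=
  fun Ω f K u G hG => (h Ω f K u G fun b hb m' hm' => hG b hb m' (hQ b hb m' hm')).mono (by omega)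

theorem Det.conseq {Q Q' : Mem → Prop} (h : Det D P m t Q) (ht : t ≤ t')
    (hQ : ∀ m', Q m' → Q' m') : Det D P m t' Q' :=
  Wp.conseq h ht fun _ _ => hQ

theorem Det.wp {Q : β → Mem → Prop} {b : β} (h : Det D P m t (Q b)) :
    Wp D P m t (PMF.pure b) Q := by
  intro Ω f K u G hG
  have := h Ω f K u (fun _ => G b) fun _ _ m' hm' => hG b (by simp) m' hm'
  rwa [PMF.pure_bind] at this ⊢

theorem Wp.map {Q : γ → Mem → Prop} {g : β → γ} (h : Wp D P m t κ fun b => Q (g b)) :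
    Wp D P m t (κ.map g) Q := by
  intro Ω f K u G hG
  rw [PMF.bind_map]
  refine h Ω f K u (G ∘ g) fun b hb m' hm' => hG (g b) ?_ m' hm'
  rw [PMF.support_map]
  exact ⟨b, hb, rfl⟩

/-- For `P`, the continuation is `R` on top of the stack; the laws compose by associativity of
`bind`. The memory enters only through `Q`, so the law of the rest depends on the abstract result
and not on leftovers in the memory. -/
theorem Wp.append {Q : β → Mem → Prop} {κ' : β → PMF γ} {Q' : γ → Mem → Prop}
    (h : Wp D P m t κ Q) (h' : ∀ b ∈ κ.support, ∀ m', Q b m' → Wp D R m' t' (κ' b) Q')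
    {Ω : Type} (f : Mem → Ω) (K : List Prog) (u : ℕ) (G : γ → PMF Ω)
    (hG : ∀ c ∈ (κ.bind κ').support, ∀ m', Q' c m' → Halts D f u (K, m') (G c)) :
    Halts D f (t + t' + u) (P :: R :: K, m) ((κ.bind κ').bind G) := by
  rw [PMF.bind_bind, add_assoc]
  refine h Ω f (R :: K) (t' + u) _ fun b hb m' hm' => h' b hb m' hm' Ω f K u G fun c hc m'' hm'' => ?_
  exact hG c ((PMF.mem_support_bind_iff _ _ _).2 ⟨b, hb, hc⟩) m'' hm''

theorem Wp.seq {Q : β → Mem → Prop} {κ' : β → PMF γ} {Q' : γ → Mem → Prop}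
    (h : Wp D P m t κ Q) (h' : ∀ b ∈ κ.support, ∀ m', Q b m' → Wp D R m' t' (κ' b) Q') :
    Wp D (.seq P R) m (t + t' + 1) (κ.bind κ') Q' := by
  intro Ω f K u G hG
  have := Halts.step_pure (s := (.seq P R :: K, m)) rfl (h.append h' f K u G hG)
  exact this.mono (by omega)

theorem Wp.seq_det {Q Q' : β → Mem → Prop}
    (h : Wp D P m t κ Q) (h' : ∀ b ∈ κ.support, ∀ m', Q b m' → Det D R m' t' (Q' b)) :
    Wp D (.seq P R) m (t + t' + 1) κ Q' := by
  have := h.seq (κ' := PMF.pure) fun b hb m' hm' => (h' b hb m' hm').wp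
  rwa [PMF.bind_pure] at this

theorem Det.seq_wp {Q : Mem → Prop} {Q' : β → Mem → Prop}
    (h : Det D P m t Q) (h' : ∀ m', Q m' → Wp D R m' t' κ Q') :
    Wp D (.seq P R) m (t + t' + 1) κ Q' := by
  have := Wp.seq h (κ' := fun _ => κ) fun _ _ m' hm' => h' m' hm'
  rwa [PMF.pure_bind] at this

theorem Det.seq {Q Q' : Mem → Prop} (h : Det D P m t Q) (h' : ∀ m', Q m' → Det D R m' t' Q') :
    Det D (.seq P R) m (t + t' + 1) Q' :=
  Det.seq_wp h h'

theorem Wp.while_true {c : BExpr} {Q : β → Mem → Prop} {κ' : β → PMF γ} {Q' : γ → Mem → Prop}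
    (hc : c.holds D m) (h : Wp D P m t κ Q)
    (h' : ∀ b ∈ κ.support, ∀ m', Q b m' → Wp D (.while c P) m' t' (κ' b) Q') :
    Wp D (.while c P) m (t + t' + 1) (κ.bind κ') Q' := by
  intro Ω f K u G hG
  have := Halts.step_pure (s := (.while c P :: K, m)) (by rw [machineStep, if_pos hc])
    (h.append h' f K u G hG)
  exact this.mono (by omega)

theorem Det.while_false {c : BExpr} {Q : Mem → Prop} (hc : ¬ c.holds D m) (hQ : Q m) :
    Det D (.while c P) m 1 Q := by
  intro Ω f K u G hG
  rw [PMF.pure_bind, add_comm]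
  exact Halts.step_pure (by rw [machineStep, if_neg hc]) (hG () (by simp) m hQ)

theorem Det.while_true {c : BExpr} {Q Q' : Mem → Prop} (hc : c.holds D m) (h : Det D P m t Q)
    (h' : ∀ m', Q m' → Det D (.while c P) m' t' Q') : Det D (.while c P) m (t + t' + 1) Q' := by
  have := Wp.while_true hc h (κ' := fun _ => PMF.pure ()) fun _ _ m' hm' => h' m' hm'
  rwa [PMF.pure_bind] at this

theorem Det.ite {c : BExpr} {Q : Mem → Prop} (h : c.holds D m → Det D P m t Q)
    (h' : ¬ c.holds D m → Det D R m t Q) : Det D (.ite c P R) m (t + 1) Q := by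
  intro Ω f K u G hG
  by_cases hc : c.holds D m
  · exact (Halts.step_pure (by rw [machineStep, if_pos hc]) (h hc Ω f K u G hG)).mono (by omega)
  · exact (Halts.step_pure (by rw [machineStep, if_neg hc]) (h' hc Ω f K u G hG)).mono (by omega)

/-- The outcome is read back from the bit just stored, because `Halts.step` indexes the subsequent
laws by configurations. -/
theorem wp_flip (a : ℕ) (i j : NExpr) (p : RExpr) :
    Wp D (.flip a i j p) m 1 (coin (p.eval D m))
      fun b m' => m' = m.setNat a (i.eval m) (j.eval m) (if b then 1 else 0) := by
  intro Ω f K u G hG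
  have h := Halts.step (D := D) (f := f) (T := u) (s := (.flip a i j p :: K, m))
    (G := fun s' => G (decide (s'.2.nat a (i.eval m) (j.eval m) = 1))) (fun s' hs' => by
      rw [machineStep, PMF.support_map] at hs'
      obtain ⟨b, hb, rfl⟩ := hs'
      have : decide ((m.setNat a (i.eval m) (j.eval m) (if b then 1 else 0)).nat a
        (i.eval m) (j.eval m) = 1) = b := by cases b <;> simp [Mem.setNat]
      simp only [this]
      exact hG b hb _ rfl)
  rw [add_comm]
  rw [machineStep, PMF.bind_map] at h
  convert h using 2
  funext b
  have : decide ((m.setNat a (i.eval m) (j.eval m) (if b then 1 else 0)).nat a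
    (i.eval m) (j.eval m) = 1) = b := by cases b <;> simp [Mem.setNat]
  simp only [Function.comp, this]

/-! #### Straight-line programs -/

/-- Programs without loops and coin flips. -/
def Prog.Straight : Prog → Prop
  | .skip => True
  | .setNat _ _ _ _ => True
  | .setReal _ _ _ _ => True
  | .flip _ _ _ _ => False
  | .seq P Q => P.Straight ∧ Q.Straight
  | .ite _ P Q => P.Straight ∧ Q.Straight
  | .while _ _ => False

/-- The effect of a straight-line program. -/
noncomputable def Prog.sem (D : ℕ → ℕ → ℝ) : Prog → Mem → Mem
  | .skip, m => m
  | .setNat a i j e, m => m.setNat a (i.eval m) (j.eval m) (e.eval m)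
  | .setReal a i j e, m => m.setReal a (i.eval m) (j.eval m) (e.eval D m)
  | .flip _ _ _ _, m => m
  | .seq P Q, m => Q.sem D (P.sem D m)
  | .ite b P Q, m => if b.holds D m then P.sem D m else Q.sem D m
  | .while _ _, m => m

/-- A bound for the number of steps of a straight-line program. -/
def Prog.size : Prog → ℕ
  | .skip => 1
  | .setNat _ _ _ _ => 1
  | .setReal _ _ _ _ => 1
  | .flip _ _ _ _ => 1
  | .seq P Q => P.size + Q.size + 1
  | .ite _ P Q => P.size + Q.size + 1
  | .while _ _ => 1

theorem det_sem (P : Prog) (h : P.Straight) (m : Mem) :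
    Det D P m P.size fun m' => m' = P.sem D m := by
  induction P generalizing m with
  | skip =>
    intro Ω f K u G hG
    rw [PMF.pure_bind, add_comm]
    exact Halts.step_pure rfl (hG () (by simp) m rfl)
  | setNat a i j e =>
    intro Ω f K u G hG
    rw [PMF.pure_bind, add_comm]
    exact Halts.step_pure rfl (hG () (by simp) _ rfl)
  | setReal a i j e =>
    intro Ω f K u G hG
    rw [PMF.pure_bind, add_comm]
    exact Halts.step_pure rfl (hG () (by simp) _ rfl)
  | seq P Q ihP ihQ =>
    exact (ihP h.1 m).seq fun m' hm' => by rw [hm']; exact ihQ h.2 _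
  | ite b P Q ihP ihQ =>
    refine Det.ite (fun hb => (ihP h.1 m).conseq (by omega) fun m' hm' => ?_)
      (fun hb => (ihQ h.2 m).conseq (by omega) fun m' hm' => ?_)
    · rw [hm', Prog.sem, if_pos hb]
    · rw [hm', Prog.sem, if_neg hb]
  | _ => exact h.elim

theorem Det.of_sem {Q : Mem → Prop} (h : P.Straight) (ht : P.size ≤ t) (hQ : Q (P.sem D m)) :
    Det D P m t Q :=
  (det_sem P h m).conseq ht fun _ hm' => hm' ▸ hQ

/-! #### Loops -/

/-- The law after `n` random steps. -/
noncomputable def iterLaw (κ : ℕ → β → PMF β) : ℕ → β → PMF β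
  | 0, b => PMF.pure b
  | n + 1, b => (iterLaw κ n b).bind (κ n)

/-- A loop executes its first round first, so the induction in `Wp.while_iter` shifts the kernels
and the invariants by one. -/
theorem iterLaw_succ_eq (κ : ℕ → β → PMF β) (n : ℕ) (b : β) :
    iterLaw κ (n + 1) b = (κ 0 b).bind (iterLaw (fun i => κ (i + 1)) n) := by
  induction n with
  | zero => simp [iterLaw]
  | succ n ih =>
    rw [iterLaw, ih, PMF.bind_bind]
    rfl

theorem iterLaw_pure (n : ℕ) (b : β) : iterLaw (fun _ => PMF.pure) n b = PMF.pure b := by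
  induction n with
  | zero => rfl
  | succ n ih => rw [iterLaw, ih, PMF.pure_bind]

theorem Wp.while_iter {c : BExpr} {κ : ℕ → β → PMF β} {I : ℕ → β → Mem → Prop} {n : ℕ}
    (htest : ∀ i b m, I i b m → (c.holds D m ↔ i < n))
    (hbody : ∀ i < n, ∀ b m, I i b m → Wp D P m t (κ i b) (I (i + 1))) {b : β} (h0 : I 0 b m) :
    Wp D (.while c P) m (n * (t + 1) + 1) (iterLaw κ n b) (I n) := by
  induction n generalizing κ I m b with
  | zero =>
    exact (Det.while_false (by rw [htest 0 b m h0]; omega) h0).wp.conseq (by omega)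
      fun _ _ _ h => h
  | succ n ih =>
    rw [iterLaw_succ_eq]
    refine (Wp.while_true ((htest 0 b m h0).2 (by omega)) (hbody 0 (by omega) b m h0)
      fun b' _ m' hm' => ih (κ := fun i => κ (i + 1)) (I := fun i => I (i + 1))
        (fun i b m h => by rw [htest (i + 1) b m h]; omega)
        (fun i hi b m h => hbody (i + 1) (by omega) b m h) hm').conseq ?_ fun _ _ _ h => h
    rw [Nat.succ_mul]
    omega

/-- An integer scalar: the cell `(0, 0)` of an array of its own. -/
def nvar (a : ℕ) : NExpr := .load a (.lit 0) (.lit 0)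

/-- A real scalar. -/
def rvar (a : ℕ) : RExpr := .load a (.lit 0) (.lit 0)

/-- Assignment to an integer scalar. -/
def setNvar (a : ℕ) (e : NExpr) : Prog := .setNat a (.lit 0) (.lit 0) e

/-- Assignment to a real scalar. -/
def setRvar (a : ℕ) (e : RExpr) : Prog := .setReal a (.lit 0) (.lit 0) e

/-- The loop `for a = 0, …, N - 1 do P`. -/
def forLoop (a : ℕ) (N : NExpr) (P : Prog) : Prog :=
  .seq (setNvar a (.lit 0))
    (.while (.natLT (nvar a) N) (.seq P (setNvar a (.add (nvar a) (.lit 1)))))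

/-- Besides its body, a round spends one step each on the test, on splitting the sequence and on the
counter. Three more are the initialization, the outer sequence and the last test. -/
theorem Wp.forLoop {a : ℕ} {N : NExpr} {κ : ℕ → β → PMF β} {I : ℕ → β → Mem → Prop} {n : ℕ}
    (hI : ∀ i b m, I i b m → m.nat a 0 0 = i ∧ N.eval m = n)
    (hbody : ∀ i < n, ∀ b m, I i b m → Wp D P m t (κ i b)
      fun b' m' => m'.nat a 0 0 = i ∧ I (i + 1) b' (m'.setNat a 0 0 (i + 1)))
    {b : β} (h0 : I 0 b (m.setNat a 0 0 0)) (ht : n * (t + 3) + 3 ≤ t') :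
    Wp D (forLoop a N P) m t' (iterLaw κ n b) (I n) := by
  have h1 : Wp D (.while (.natLT (nvar a) N) (.seq P (setNvar a (.add (nvar a) (.lit 1)))))
      (m.setNat a 0 0 0) (n * (t + 1 + 1 + 1) + 1) (iterLaw κ n b) (I n) := by
    refine Wp.while_iter (fun i b m h => ?_) (fun i hi b m h => ?_) h0
    · obtain ⟨h1, h2⟩ := hI i b m h
      simp only [BExpr.holds, nvar, NExpr.eval, h1, h2]
    · refine (hbody i hi b m h).seq_det fun b' _ m' hm' => Det.of_sem trivial le_rfl ?_
      obtain ⟨h1, h2⟩ := hm'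
      simpa [Prog.sem, setNvar, nvar, NExpr.eval, h1] using h2
  have h2 := Det.seq_wp (P := setNvar a (.lit 0)) (m := m) (Q := fun m' => m' = m.setNat a 0 0 0)
    (Det.of_sem (P := setNvar a (.lit 0)) trivial le_rfl rfl) (fun m' hm' => by rw [hm']; exact h1)
  refine h2.conseq ?_ fun _ _ _ h => h
  have : n * (t + 1 + 1 + 1) = n * (t + 3) := rfl
  simp only [Prog.size, setNvar]
  omega

theorem Det.forLoop {a : ℕ} {N : NExpr} {I : ℕ → Mem → Prop} {n : ℕ}
    (hI : ∀ i m, I i m → m.nat a 0 0 = i ∧ N.eval m = n)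
    (hbody : ∀ i < n, ∀ m, I i m → Det D P m t
      fun m' => m'.nat a 0 0 = i ∧ I (i + 1) (m'.setNat a 0 0 (i + 1)))
    (h0 : I 0 (m.setNat a 0 0 0)) (ht : n * (t + 3) + 3 ≤ t') :
    Det D (forLoop a N P) m t' (I n) := by
  have := Wp.forLoop (D := D) (κ := fun _ => PMF.pure) (I := fun i (_ : Unit) => I i) (b := ())
    (fun i _ m h => hI i m h) (fun i hi _ m h => hbody i hi m h) h0 ht
  rwa [iterLaw_pure] at this

/-- The arrays outside of `W` (integers) and `V` (reals) are unchanged. -/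
def Frame (W V : List ℕ) (m m' : Mem) : Prop :=
  (∀ a ∉ W, m'.nat a = m.nat a) ∧ ∀ a ∉ V, m'.real a = m.real a

theorem Frame.refl (W V : List ℕ) (m : Mem) : Frame W V m m := ⟨fun _ _ => rfl, fun _ _ => rfl⟩

theorem Frame.trans {W V W' V' : List ℕ} {m m' m'' : Mem} (h : Frame W V m m')
    (h' : Frame W' V' m' m'') (W'' V'' : List ℕ) (hW : W ⊆ W'') (hW' : W' ⊆ W'') (hV : V ⊆ V'')
    (hV' : V' ⊆ V'') : Frame W'' V'' m m'' :=
  ⟨fun a ha => (h'.1 a fun h => ha (hW' h)).trans (h.1 a fun h => ha (hW h)),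
    fun a ha => (h'.2 a fun h => ha (hV' h)).trans (h.2 a fun h => ha (hV h))⟩

theorem Frame.setNat {W V : List ℕ} {m m' : Mem} (h : Frame W V m m') {a : ℕ} (ha : a ∈ W)
    (i j v : ℕ) : Frame W V m (m'.setNat a i j v) := by
  refine ⟨fun b hb => ?_, h.2⟩
  have : b ≠ a := fun h => hb (h ▸ ha)
  rw [← h.1 b hb]
  funext i' j'
  simp [Mem.setNat, this]

theorem Frame.setReal {W V : List ℕ} {m m' : Mem} (h : Frame W V m m') {a : ℕ} (ha : a ∈ V)
    (i j : ℕ) (v : ℝ) : Frame W V m (m'.setReal a i j v) := by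
  refine ⟨h.1, fun b hb => ?_⟩
  have : b ≠ a := fun h => hb (h ▸ ha)
  rw [← h.2 b hb]
  funext i' j'
  simp [Mem.setReal, this]

end Logic

/-! ### Tournament trees

For each point `x` the row `x` of the arrays with number `3` holds a tournament tree with `n` leaves;
the children of the node `v` are `2v` and `2v+1`, the leaf for the point `y` is `n + y`. The key of a
leaf is `f y` if `y` belongs to the set that is represented, and else `0`. -/

section Tree

/-- The node `v` holds the larger one of the keys of its children, with its argument. -/
def NodeOK (key : ℕ → ℝ) (arg : ℕ → ℕ) (v : ℕ) : Prop :=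
  if key (v + v) < key (v + v + 1) then key v = key (v + v + 1) ∧ arg v = arg (v + v + 1)
  else key v = key (v + v) ∧ arg v = arg (v + v)

/-- The tournament tree with `n` leaves that represents the set `S` with the keys `f`. -/
structure TreeRow (n : ℕ) (f : ℕ → ℝ) (S : Set ℕ) (key : ℕ → ℝ) (arg : ℕ → ℕ) : Prop where
  key_leaf : ∀ y < n, key (n + y) = if y ∈ S then f y else 0
  arg_leaf : ∀ y < n, y ∈ S → arg (n + y) = y
  node : ∀ v, 1 ≤ v → v < n → NodeOK key arg v

variable {n : ℕ} {f : ℕ → ℝ} {S : Set ℕ} {key : ℕ → ℝ} {arg : ℕ → ℕ}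

theorem NodeOK.le {v : ℕ} (h : NodeOK key arg v) : key (v + v) ≤ key v ∧ key (v + v + 1) ≤ key v := by
  unfold NodeOK at h
  split_ifs at h with hlt
  · rw [h.1]; exact ⟨hlt.le, le_rfl⟩
  · rw [h.1]; exact ⟨le_rfl, not_lt.1 hlt⟩

/-- Climb from `v` to `v / 2`. The number of leaves need not be a power of two: for 1 ≤ v < n both
children lie among the nodes below 2n. -/
theorem TreeRow.le_root (h : TreeRow n f S key arg) {v : ℕ} (hv : 1 ≤ v) (hvn : v < 2 * n) :
    key v ≤ key 1 := by
  induction v using Nat.strong_induction_on with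
  | _ v ih =>
    rcases hv.eq_or_lt with rfl | hv1
    · exact le_rfl
    · have h1 := (h.node (v / 2) (by omega) (by omega)).le
      refine le_trans ?_ (ih (v / 2) (by omega) (by omega) (by omega))
      rcases Nat.even_or_odd' v with ⟨w, rfl | rfl⟩
      · have : 2 * w / 2 = w := by omega
        rw [this] at h1 ⊢
        rw [two_mul]; exact h1.1
      · have : (2 * w + 1) / 2 = w := by omega
        rw [this] at h1 ⊢
        rw [two_mul]; exact h1.2

/-- Descends to the leaf from which the node was copied. Arguments are unspecified at leaves outside
of `S`, hence the alternative with key 0. -/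
theorem TreeRow.spec (h : TreeRow n f S key arg) {v : ℕ} (hv : 1 ≤ v) (hvn : v < 2 * n) :
    (arg v < n ∧ arg v ∈ S ∧ key v = f (arg v)) ∨ key v = 0 := by
  induction hk : 2 * n - v using Nat.strong_induction_on generalizing v with
  | _ k ih =>
    rcases lt_or_ge v n with hlt | hge
    · have h1 := ih (2 * n - (v + v)) (by omega) (v := v + v) (by omega) (by omega) rfl
      have h2 := ih (2 * n - (v + v + 1)) (by omega) (v := v + v + 1) (by omega) (by omega) rfl
      have h3 := h.node v hv hlt
      unfold NodeOK at h3
      split_ifs at h3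
      · rw [h3.1, h3.2]; exact h2
      · rw [h3.1, h3.2]; exact h1
    · have h1 := h.key_leaf (v - n) (by omega)
      have h2 := h.arg_leaf (v - n) (by omega)
      have h3 : n + (v - n) = v := by omega
      rw [h3] at h1 h2
      split_ifs at h1 with hS
      · rw [h2 hS]
        exact Or.inl ⟨by omega, hS, h1⟩
      · exact Or.inr h1

theorem TreeRow.root_of_mem (h : TreeRow n f S key arg) (hf : ∀ y ∈ S, 0 < f y) {y : ℕ}
    (hy : y < n) (hyS : y ∈ S) :
    arg 1 < n ∧ arg 1 ∈ S ∧ key 1 = f (arg 1) ∧ ∀ y < n, y ∈ S → f y ≤ key 1 := by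
  have hle : ∀ y < n, y ∈ S → f y ≤ key 1 := fun y hy hyS => by
    have h1 := h.le_root (v := n + y) (by omega) (by omega)
    rwa [h.key_leaf y hy, if_pos hyS] at h1
  have hpos : 0 < key 1 := (hf y hyS).trans_le (hle y hy hyS)
  rcases h.spec (v := 1) le_rfl (by omega) with ⟨h1, h2, h3⟩ | h1
  · exact ⟨h1, h2, h3, hle⟩
  · exact absurd h1 hpos.ne'

theorem TreeRow.root_of_empty (h : TreeRow n f S key arg) (hn : 0 < n) (hS : ∀ y < n, y ∉ S) :
    key 1 = 0 := by
  rcases h.spec (v := 1) le_rfl (by omega) with ⟨h1, h2, -⟩ | h1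
  · exact absurd h2 (hS _ h1)
  · exact h1

/-! #### Updating a tree -/

/-- The node `v` of the tree of the current point. -/
def keyAt (v : NExpr) : RExpr := .load 3 (nvar 10) v

/-- The argument of the node `v` of the tree of the current point. -/
def argAt (v : NExpr) : NExpr := .load 3 (nvar 10) v

/-- Copy the node `w` to the node `v` (scalar `11`). -/
def copyNode (w : NExpr) : Prog :=
  .seq (.setReal 3 (nvar 10) (nvar 11) (keyAt w)) (.setNat 3 (nvar 10) (nvar 11) (argAt w))

/-- The left child of the node `v` (scalar `11`). -/
def leftChild : NExpr := .add (nvar 11) (nvar 11)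

/-- The right child of the node `v` (scalar `11`). -/
def rightChild : NExpr := .add leftChild (.lit 1)

/-- Recompute the node `v` (scalar `11`) and pass on to its parent. -/
def nodeStep : Prog :=
  .seq (.ite (.realLT (keyAt leftChild) (keyAt rightChild)) (copyNode rightChild)
    (copyNode leftChild)) (setNvar 11 (.half (nvar 11)))

/-- Recompute the nodes on the path from `v` to the root. -/
def pathLoop : Prog := .while (.natLT (.lit 0) (nvar 11)) nodeStep

/-- The leaf of the point `y` (scalar `12`). -/
def leafPos : NExpr := .add (.load 0 (.lit 0) (.lit 0)) (nvar 12)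

/-- In the tree of the current point (scalar `10`), set the key of the point `y` (scalar `12`) to the
real scalar `14`. -/
def updateRow : Prog :=
  .seq (.setReal 3 (nvar 10) leafPos (rvar 14)) (.seq (.setNat 3 (nvar 10) leafPos (nvar 12))
    (.seq (setNvar 11 (.half leafPos)) pathLoop))

/-- Only the row `x` of the trees, and the scalar `11`, have changed. -/
structure RowFrame (x : ℕ) (m m' : Mem) : Prop where
  nat : ∀ a, a ≠ 3 → a ≠ 11 → m'.nat a = m.nat a
  real : ∀ a, a ≠ 3 → m'.real a = m.real a
  row : ∀ x', x' ≠ x → m'.nat 3 x' = m.nat 3 x' ∧ m'.real 3 x' = m.real 3 x'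

theorem RowFrame.trans {x : ℕ} {m m' m'' : Mem} (h : RowFrame x m m') (h' : RowFrame x m' m'') :
    RowFrame x m m'' :=
  ⟨fun a h1 h2 => (h'.nat a h1 h2).trans (h.nat a h1 h2), fun a h1 => (h'.real a h1).trans
    (h.real a h1), fun x' hx => ⟨((h'.row x' hx).1).trans (h.row x' hx).1,
      ((h'.row x' hx).2).trans (h.row x' hx).2⟩⟩

variable {D : ℕ → ℕ → ℝ}

theorem sem_nodeStep (m : Mem) {x v : ℕ} (hx : m.nat 10 0 0 = x) (hv : m.nat 11 0 0 = v)
    (hv0 : 0 < v) :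
    (nodeStep.sem D m).nat 11 0 0 = v / 2 ∧ RowFrame x m (nodeStep.sem D m) ∧
      (∀ w, w ≠ v → (nodeStep.sem D m).real 3 x w = m.real 3 x w ∧
        (nodeStep.sem D m).nat 3 x w = m.nat 3 x w) ∧
      NodeOK ((nodeStep.sem D m).real 3 x) ((nodeStep.sem D m).nat 3 x) v := by
  have h2 : v + v + 1 ≠ v := by omega
  by_cases hlt : m.real 3 x (v + v) < m.real 3 x (v + v + 1)
  · have hsem : nodeStep.sem D m = ((m.setReal 3 x v (m.real 3 x (v + v + 1))).setNat 3 x v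
        (m.nat 3 x (v + v + 1))).setNat 11 0 0 (v / 2) := by
      simp [nodeStep, copyNode, Prog.sem, BExpr.holds, keyAt, argAt, leftChild, rightChild, nvar,
        NExpr.eval, RExpr.eval, hx, hv, hlt, setNvar, Mem.setReal, Mem.setNat]
    rw [hsem]
    refine ⟨by simp [Mem.setNat], ⟨fun a h3 h11 => ?_, fun a h3 => ?_, fun x' hx' => ⟨?_, ?_⟩⟩,
      fun w hw => by simp [Mem.setNat, Mem.setReal, hw], ?_⟩
    · funext i j; simp [Mem.setNat, Mem.setReal, h3, h11]
    · funext i j; simp [Mem.setNat, Mem.setReal, h3]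
    · funext j; simp [Mem.setNat, Mem.setReal, hx']
    · funext j; simp [Mem.setNat, Mem.setReal, hx']
    · simp [NodeOK, Mem.setNat, Mem.setReal, hv0.ne', not_le.2 hlt]
  · have hsem : nodeStep.sem D m = ((m.setReal 3 x v (m.real 3 x (v + v))).setNat 3 x v
        (m.nat 3 x (v + v))).setNat 11 0 0 (v / 2) := by
      simp [nodeStep, copyNode, Prog.sem, BExpr.holds, keyAt, argAt, leftChild, rightChild, nvar,
        NExpr.eval, RExpr.eval, hx, hv, hlt, setNvar, Mem.setReal, Mem.setNat]
    rw [hsem]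
    refine ⟨by simp [Mem.setNat], ⟨fun a h3 h11 => ?_, fun a h3 => ?_, fun x' hx' => ⟨?_, ?_⟩⟩,
      fun w hw => by simp [Mem.setNat, Mem.setReal, hw], ?_⟩
    · funext i j; simp [Mem.setNat, Mem.setReal, h3, h11]
    · funext i j; simp [Mem.setNat, Mem.setReal, h3]
    · funext j; simp [Mem.setNat, Mem.setReal, hx']
    · funext j; simp [Mem.setNat, Mem.setReal, hx']
    · simp [NodeOK, Mem.setNat, Mem.setReal, hv0.ne', h2, hlt]

/-- The condition at `u` reads only `u` and its two children, so a change at `v` affects just `v`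
and its parent. -/
theorem NodeOK.congr {key' : ℕ → ℝ} {arg' : ℕ → ℕ} {u v : ℕ}
    (h : ∀ w, w ≠ v → key' w = key w ∧ arg' w = arg w) (h1 : u ≠ v) (h2 : u ≠ v / 2)
    (hu : NodeOK key arg u) : NodeOK key' arg' u := by
  unfold NodeOK at hu ⊢
  rw [(h u h1).1, (h u h1).2, (h (u + u) (by omega)).1, (h (u + u) (by omega)).2,
    (h (u + u + 1) (by omega)).1, (h (u + u + 1) (by omega)).2]
  exact hu

/-- The invariant is that only `v` and its ancestors may be wrong. Recomputing `v` repairs it and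
leaves only the ancestors from `v / 2` on; `j` bounds the number of binary digits of `v`. -/
theorem det_pathLoop {x : ℕ} (j : ℕ) {m : Mem} {v : ℕ} (hx : m.nat 10 0 0 = x)
    (hv : m.nat 11 0 0 = v) (hvj : v < 2 ^ j) (hvn : v < n)
    (hnode : ∀ u, 1 ≤ u → u < n → (∀ i, v / 2 ^ i ≠ u) → NodeOK (m.real 3 x) (m.nat 3 x) u) :
    Det D pathLoop m (10 * j + 1) fun m' =>
      (∀ u, 1 ≤ u → u < n → NodeOK (m'.real 3 x) (m'.nat 3 x) u) ∧
      (∀ w, n ≤ w → m'.real 3 x w = m.real 3 x w ∧ m'.nat 3 x w = m.nat 3 x w) ∧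
      RowFrame x m m' := by
  induction j generalizing m v with
  | zero =>
    have hv0 : v = 0 := by simpa using hvj
    subst hv0
    refine Det.while_false (by simp [BExpr.holds, nvar, NExpr.eval, hv]) ⟨fun u hu hun => ?_,
      fun _ _ => ⟨rfl, rfl⟩, ⟨fun _ _ _ => rfl, fun _ _ => rfl, fun _ _ => ⟨rfl, rfl⟩⟩⟩
    exact hnode u hu hun fun i => by simp; omega
  | succ j ih =>
    rcases Nat.eq_zero_or_pos v with hv0 | hv0
    · subst hv0
      refine (Det.while_false (by simp [BExpr.holds, nvar, NExpr.eval, hv]) ⟨fun u hu hun => ?_,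
        fun _ _ => ⟨rfl, rfl⟩, ⟨fun _ _ _ => rfl, fun _ _ => rfl, fun _ _ => ⟨rfl, rfl⟩⟩⟩).conseq
          (by omega) fun _ h => h
      exact hnode u hu hun fun i => by simp; omega
    · obtain ⟨h1, h2, h3, h4⟩ := sem_nodeStep (D := D) m hx hv hv0
      refine (Det.while_true (by simpa [BExpr.holds, nvar, NExpr.eval, hv] using hv0)
        (det_sem nodeStep ⟨⟨⟨trivial, trivial⟩, trivial, trivial⟩, trivial⟩ m) (t' := 10 * j + 1)
        fun m' hm' => ?_).conseq (by simp only [nodeStep, Prog.size, copyNode, setNvar]; omega)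
          fun _ h => h
      rw [← hm'] at h1 h2 h3 h4
      refine (ih (m := m') (v := v / 2) ((congrFun (congrFun (h2.nat 10 (by decide) (by decide))
        0) 0).trans hx) h1 ?_ (by omega) ?_).conseq le_rfl ?_
      · rw [pow_succ] at hvj; omega
      · intro u hu hun hne
        by_cases huv : u = v
        · rw [huv]; exact h4
        · refine NodeOK.congr h3 huv (fun h => hne 0 (by simp [h])) (hnode u hu hun fun i => ?_)
          rcases i with _ | i
          · simpa using fun h => huv h.symm
          · rw [pow_succ', ← Nat.div_div_eq_div_mul]; exact hne i
      · rintro m'' ⟨h5, h6, h7⟩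
        refine ⟨h5, fun w hw => ?_, h2.trans h7⟩
        have h8 := h3 w (by omega)
        exact ⟨(h6 w hw).1.trans h8.1, (h6 w hw).2.trans h8.2⟩

theorem det_updateRow {x y L : ℕ} {m : Mem} {S' : Set ℕ} (hn : m.nat 0 0 0 = n)
    (hx : m.nat 10 0 0 = x) (hy : m.nat 12 0 0 = y) (hyn : y < n) (hL : n ≤ 2 ^ L)
    (h : TreeRow n f S (m.real 3 x) (m.nat 3 x)) (hS : ∀ y', y' ≠ y → (y' ∈ S' ↔ y' ∈ S))
    (hkv : m.real 14 0 0 = if y ∈ S' then f y else 0) :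
    Det D updateRow m (10 * L + 7) fun m' =>
      TreeRow n f S' (m'.real 3 x) (m'.nat 3 x) ∧ RowFrame x m m' := by
  let m₁ := ((m.setReal 3 x (n + y) (m.real 14 0 0)).setNat 3 x (n + y) y).setNat 11 0 0
    ((n + y) / 2)
  have hm₁ : ∀ w, w ≠ n + y → m₁.real 3 x w = m.real 3 x w ∧ m₁.nat 3 x w = m.nat 3 x w :=
    fun w hw => by simp [m₁, Mem.setNat, Mem.setReal, hw]
  have hfr : RowFrame x m m₁ := by
    refine ⟨fun a h3 h11 => ?_, fun a h3 => ?_, fun x' hx' => ⟨?_, ?_⟩⟩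
    · funext i j; simp [m₁, Mem.setNat, Mem.setReal, h3, h11]
    · funext i j; simp [m₁, Mem.setNat, Mem.setReal, h3]
    · funext j; simp [m₁, Mem.setNat, Mem.setReal, hx']
    · funext j; simp [m₁, Mem.setNat, Mem.setReal, hx']
  have hpath : Det D pathLoop m₁ (10 * L + 1) fun m' =>
      TreeRow n f S' (m'.real 3 x) (m'.nat 3 x) ∧ RowFrame x m m' := by
    refine (det_pathLoop (n := n) (x := x) L (v := (n + y) / 2) (by simp [m₁, Mem.setNat,
      Mem.setReal, hx]) (by simp [m₁, Mem.setNat]) (by omega) (by omega)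
      fun u hu hun hne => ?_).conseq le_rfl ?_
    · exact NodeOK.congr hm₁ (by omega) (fun h => hne 0 (by simp [h])) (h.node u hu hun)
    · rintro m' ⟨h1, h2, h3⟩
      refine ⟨⟨fun y' hy' => ?_, fun y' hy' hyS => ?_, h1⟩, hfr.trans h3⟩
      · rw [(h2 (n + y') (by omega)).1]
        by_cases hyy : y' = y
        · subst hyy
          simp [m₁, Mem.setNat, Mem.setReal, hkv]
        · rw [(hm₁ (n + y') (by omega)).1, h.key_leaf y' hy']
          simp only [hS y' hyy]
      · rw [(h2 (n + y') (by omega)).2]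
        by_cases hyy : y' = y
        · subst hyy
          simp [m₁, Mem.setNat, Mem.setReal]
        · rw [(hm₁ (n + y') (by omega)).2]
          exact h.arg_leaf y' hy' ((hS y' hyy).1 hyS)
  have h1 := Det.seq (P := .setReal 3 (nvar 10) leafPos (rvar 14)) (m := m)
    (Q := fun m' => m' = m.setReal 3 x (n + y) (m.real 14 0 0))
    (Q' := fun m' => TreeRow n f S' (m'.real 3 x) (m'.nat 3 x) ∧ RowFrame x m m')
    (Det.of_sem trivial le_rfl (by
      simp [Prog.sem, NExpr.eval, RExpr.eval, nvar, rvar, leafPos, hn, hx, hy]))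
    fun m' hm' => Det.seq (P := .setNat 3 (nvar 10) leafPos (nvar 12)) (m := m')
      (Q := fun m' => m' = (m.setReal 3 x (n + y) (m.real 14 0 0)).setNat 3 x (n + y) y)
      (Det.of_sem trivial le_rfl (by
        rw [hm']
        simp [Prog.sem, NExpr.eval, nvar, leafPos, hn, hx, hy, Mem.setReal]))
      fun m'' hm'' => Det.seq (P := setNvar 11 (.half leafPos)) (m := m'') (Q := fun m' => m' = m₁)
        (Det.of_sem trivial le_rfl (by
          rw [hm'']
          simp [Prog.sem, NExpr.eval, nvar, leafPos, hn, hy, Mem.setReal, Mem.setNat, setNvar, m₁]))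
        fun m₃ hm₃ => by rw [hm₃]; exact hpath
  exact h1.conseq (by simp only [Prog.size, setNvar]; omega) fun _ h => h

end Tree

theorem Det.seq_sem {D : ℕ → ℕ → ℝ} {P R : Prog} {m m₁ : Mem} {t' : ℕ} {Q : Mem → Prop}
    (hP : P.Straight) (hs : P.sem D m = m₁) (h : Det D R m₁ t' Q) :
    Det D (.seq P R) m (P.size + t' + 1) Q :=
  (det_sem P hP m).seq fun m' hm' => by rw [hm', hs]; exact h

/-! ### The points and their representation in the memory -/

section Points

variable {d n : ℕ} {x : Fin n → Pt d} {Δ : ℝ}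

/-- The points, indexed by all natural numbers. -/
noncomputable def pt {d n : ℕ} (x : Fin n → Pt d) (i : ℕ) : Pt d :=
  if h : i < n then x ⟨i, h⟩ else 0

theorem pt_val (i : Fin n) : pt x i = x i := by simp [pt]

theorem pt_inj (hx : Function.Injective x) {i j : ℕ} (hi : i < n) (hj : j < n)
    (h : pt x i = pt x j) : i = j := by
  rw [pt, pt, dif_pos hi, dif_pos hj] at h
  exact Fin.mk.inj_iff.1 (hx h)

theorem image_pt (x : Fin n → Pt d) : (Finset.range n).image (pt x) = Finset.univ.image x := by
  ext y
  simp only [Finset.mem_image, Finset.mem_range, Finset.mem_univ, true_and]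
  constructor
  · rintro ⟨i, hi, rfl⟩
    exact ⟨⟨i, hi⟩, by simp [pt, hi]⟩
  · rintro ⟨i, rfl⟩
    exact ⟨i, i.2, pt_val i⟩

theorem pt_mem {i : ℕ} (hi : i < n) : pt x i ∈ Finset.univ.image x := by
  rw [← image_pt]; exact Finset.mem_image_of_mem _ (Finset.mem_range.2 hi)

theorem exists_pt {y : Pt d} (hy : y ∈ Finset.univ.image x) : ∃ i < n, pt x i = y := by
  rw [← image_pt] at hy
  simpa using hy

theorem sum_image_pt {M : Type*} [AddCommMonoid M] (hx : Function.Injective x) (g : Pt d → M) :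
    ∑ y ∈ Finset.univ.image x, g y = ∑ i ∈ Finset.range n, g (pt x i) := by
  rw [← image_pt, Finset.sum_image]
  intro i hi j hj h
  exact pt_inj hx (Finset.mem_range.1 hi) (Finset.mem_range.1 hj) h

theorem sqDistOracle_eq {i j : ℕ} (hi : i < n) (hj : j < n) :
    sqDistOracle x i j = dist (pt x i) (pt x j) ^ 2 := by
  rw [sqDistOracle, dif_pos ⟨hi, hj⟩, pt, pt, dif_pos hi, dif_pos hj]

/-- The indices of the points of `C`. -/
def idx (x : Fin n → Pt d) (C : Finset (Pt d)) : Set ℕ := {y | y < n ∧ pt x y ∈ C}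

/-- The trees represent the set `C`; the key of the center `y` in the tree of the point `i` is
`Δ² + 1 - ‖x_i - x_y‖²`. -/
def Forest (x : Fin n → Pt d) (Δ : ℝ) (C : Finset (Pt d)) (m : Mem) : Prop :=
  ∀ i < n, TreeRow n (fun y => Δ * Δ + 1 - sqDistOracle x i y) (idx x C) (m.real 3 i) (m.nat 3 i)

theorem Forest.congr {C : Finset (Pt d)} {m m' : Mem} (h : Forest x Δ C m)
    (hn : m'.nat 3 = m.nat 3) (hr : m'.real 3 = m.real 3) : Forest x Δ C m' := by
  intro i hi
  rw [hn, hr]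
  exact h i hi

section Root

variable {C : Finset (Pt d)} {m : Mem} {i : ℕ} {key : ℕ → ℝ} {arg : ℕ → ℕ}

/-- Within `X` squared distances are at most Δ², so centers have keys at least 1 and beat the
default 0; the largest key belongs to a nearest center. -/
theorem TreeRow.nearest_spec
    (h : TreeRow n (fun y => Δ * Δ + 1 - sqDistOracle x i y) (idx x C) key arg) (hi : i < n)
    (hX : SpreadBetween (Finset.univ.image x) Δ) (hC : C ⊆ Finset.univ.image x)
    (hne : C.Nonempty) :
    arg 1 < n ∧ pt x (arg 1) ∈ C ∧
      truncSq (Δ * Δ + 1) (pt x i) C = dist (pt x i) (pt x (arg 1)) ^ 2 ∧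
      Δ * Δ + 1 - key 1 = truncSq (Δ * Δ + 1) (pt x i) C := by
  obtain ⟨c, hc⟩ := hne
  obtain ⟨j, hj, rfl⟩ := exists_pt (hC hc)
  have hle : ∀ y < n, sqDistOracle x i y ≤ Δ * Δ := fun y hy => by
    rw [sqDistOracle_eq hi hy, ← sq]; exact hX.sq_le (pt_mem hi) (pt_mem hy)
  obtain ⟨h1, h2, h3, h4⟩ := h.root_of_mem (fun y hy => by
    have := hle y hy.1; linarith) hj (show j ∈ idx x C from ⟨hj, hc⟩)
  have h5 : truncSq (Δ * Δ + 1) (pt x i) C = dist (pt x i) (pt x (arg 1)) ^ 2 := by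
    refine le_antisymm (truncSq_le_dist h2.2) (le_truncSq.2 ⟨?_, fun c hc => ?_⟩)
    · rw [← sqDistOracle_eq hi h1]; have := hle _ h1; linarith
    · obtain ⟨l, hl, rfl⟩ := exists_pt (hC hc)
      have := h4 l hl ⟨hl, hc⟩
      rw [← sqDistOracle_eq hi h1, ← sqDistOracle_eq hi hl]
      linarith
  refine ⟨h1, h2.2, h5, ?_⟩
  rw [h5, h3, sqDistOracle_eq hi h1]
  ring

/-- The default key 0 is read as cost Δ² + 1, which is also the truncated cost for `∅`; thus one
formula serves before and after the first center. -/
theorem TreeRow.root_eq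
    (h : TreeRow n (fun y => Δ * Δ + 1 - sqDistOracle x i y) (idx x C) key arg) (hi : i < n)
    (hX : SpreadBetween (Finset.univ.image x) Δ) (hC : C ⊆ Finset.univ.image x) :
    Δ * Δ + 1 - key 1 = truncSq (Δ * Δ + 1) (pt x i) C := by
  rcases C.eq_empty_or_nonempty with rfl | hne
  · rw [h.root_of_empty (by omega) (by simp [idx]), truncSq_empty, sub_zero]
  · exact (h.nearest_spec hi hX hC hne).2.2.2

end Root

/-! #### Updating all the trees -/

/-- The number of points. -/
def inputN : NExpr := .load 0 (.lit 0) (.lit 0)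

/-- The membership flag of the center `y`. -/
def flagAt (y : NExpr) : NExpr := .load 2 (.lit 0) y

/-- Update all the trees according to the flag of the point `y` (scalar `12`). -/
def updateAll : Prog :=
  forLoop 10 inputN (.seq (setRvar 14 (.mul (.ofNat (flagAt (nvar 12)))
    (.sub (rvar 13) (.sqDist (nvar 10) (nvar 12))))) updateRow)

theorem RowFrame.frame {i : ℕ} {m m' : Mem} (h : RowFrame i m m') : Frame [3, 11] [3] m m' :=
  ⟨fun a ha => h.nat a (by simp at ha; tauto) (by simp at ha; tauto),
    fun a ha => h.real a (by simpa using ha)⟩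

/-- During the loop the trees before the counter represent `C'` and the others still `C`.
Multiplication of the key by the flag handles insertion and deletion alike. -/
theorem det_updateAll {C C' : Finset (Pt d)} {m : Mem} {y L : ℕ} (hn : m.nat 0 0 0 = n)
    (hB : m.real 13 0 0 = Δ * Δ + 1) (hy : m.nat 12 0 0 = y) (hyn : y < n) (hL : n ≤ 2 ^ L)
    (h : Forest x Δ C m) (hC : ∀ y' < n, y' ≠ y → (pt x y' ∈ C' ↔ pt x y' ∈ C))
    (hflag : m.nat 2 0 y = if pt x y ∈ C' then 1 else 0) :
    Det (sqDistOracle x) updateAll m (n * (10 * L + 12) + 3) fun m' =>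
      Forest x Δ C' m' ∧ Frame [3, 10, 11] [3, 14] m m' := by
  refine (Det.forLoop (t := 10 * L + 9) (t' := n * (10 * L + 12) + 3) (n := n)
    (I := fun i m' => (Frame [3, 10, 11] [3, 14] m m' ∧ m'.nat 10 0 0 = i) ∧
      (∀ j < i, TreeRow n (fun y => Δ * Δ + 1 - sqDistOracle x j y) (idx x C') (m'.real 3 j)
        (m'.nat 3 j)) ∧
      ∀ j < n, i ≤ j → TreeRow n (fun y => Δ * Δ + 1 - sqDistOracle x j y) (idx x C) (m'.real 3 j)
        (m'.nat 3 j)) ?_ ?_ ?_ le_rfl).conseq le_rfl ?_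
  · rintro i m' ⟨⟨h1, h2⟩, -⟩
    refine ⟨h2, ?_⟩
    rw [← hn]
    exact congrFun (congrFun (h1.1 0 (by decide)) 0) 0
  · rintro i hi m₁ ⟨⟨h1, h2⟩, h3, h4⟩
    have e0 := h1.1 0 (by decide)
    have e2 := h1.1 2 (by decide)
    have e12 := h1.1 12 (by decide)
    have e13 := h1.2 13 (by decide)
    have hv : (setRvar 14 (.mul (.ofNat (flagAt (nvar 12)))
        (.sub (rvar 13) (.sqDist (nvar 10) (nvar 12))))).sem (sqDistOracle x) m₁ =
        m₁.setReal 14 0 0 (if pt x y ∈ C' then Δ * Δ + 1 - sqDistOracle x i y else 0) := by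
      simp only [setRvar, Prog.sem, NExpr.eval, RExpr.eval, flagAt, nvar, rvar, e12, hy, e2, hflag,
        e13, hB, h2]
      congr 1
      split_ifs <;> simp
    refine (Det.seq_sem (by exact trivial) hv (t' := 10 * L + 7) ?_).conseq
      (by simp only [setRvar, Prog.size]; omega) fun _ h => h
    obtain ⟨m₂, hm₂⟩ : ∃ m₂, m₂ = m₁.setReal 14 0 0
      (if pt x y ∈ C' then Δ * Δ + 1 - sqDistOracle x i y else 0) := ⟨_, rfl⟩
    rw [← hm₂]
    have hn₂ : m₂.nat = m₁.nat := by rw [hm₂]; rfl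
    have hr₂ : m₂.real 3 = m₁.real 3 := by rw [hm₂]; funext a b; simp [Mem.setReal]
    refine (det_updateRow (n := n) (f := fun y => Δ * Δ + 1 - sqDistOracle x i y) (x := i) (y := y)
      (S := idx x C) (S' := idx x C')
      (by rw [hn₂, e0, hn]) (by rw [hn₂, h2]) (by rw [hn₂, e12, hy]) hyn hL
      (by rw [hn₂, hr₂]; exact h4 i hi le_rfl) ?_ ?_).conseq le_rfl ?_
    · intro y' hy'
      by_cases hyn' : y' < n
      · simp [idx, hyn', hC y' hyn' hy']
      · simp [idx, hyn']
    · rw [hm₂]; simp [Mem.setReal, idx, hyn]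
    · rintro m₃ ⟨h5, h6⟩
      have hrow : ∀ j, j ≠ i → m₃.real 3 j = m₁.real 3 j ∧ m₃.nat 3 j = m₁.nat 3 j := fun j hj =>
        ⟨(h6.row j hj).2.trans (congrFun hr₂ j), (h6.row j hj).1.trans (by rw [hn₂])⟩
      have hset : (m₃.setNat 10 0 0 (i + 1)).nat 3 = m₃.nat 3 := by
        funext a b; simp [Mem.setNat]
      have hfr : Frame [3, 10, 11] [3, 14] m m₂ := by
        rw [hm₂]; exact h1.setReal (by decide) 0 0 _
      refine ⟨by rw [h6.nat 10 (by decide) (by decide), hn₂, h2], ⟨?_, by simp [Mem.setNat]⟩,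
        fun j hj => ?_, fun j hj hij => ?_⟩
      · exact (hfr.trans h6.frame _ _ (by simp) (by simp) (by simp) (by simp)).setNat
          (by decide) 0 0 _
      · rw [hset]
        change TreeRow n _ _ (m₃.real 3 j) _
        by_cases hji : j = i
        · rw [hji]; exact h5
        · rw [(hrow j hji).1, (hrow j hji).2]; exact h3 j (by omega)
      · rw [hset]
        change TreeRow n _ _ (m₃.real 3 j) _
        rw [(hrow j (by omega)).1, (hrow j (by omega)).2]
        exact h4 j hj (by omega)
  · refine ⟨⟨(Frame.refl _ _ m).setNat (by decide) 0 0 0, by simp [Mem.setNat]⟩,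
      fun j hj => absurd hj (by omega), fun j hj _ => ?_⟩
    have hset : (m.setNat 10 0 0 0).nat 3 = m.nat 3 := by
      funext a b; simp [Mem.setNat]
    rw [hset]
    exact h j hj
  · rintro m' ⟨⟨h1, -⟩, h2, -⟩
    exact ⟨h2, h1⟩

/-! #### Drawing a center -/

/-- Sequential sampling: decide about `a` first, and otherwise sample the rest with unchanged
weights. -/
theorem coin_bind_sampleBy {X : Finset (Pt d)} {w : Pt d → ℝ≥0∞} {a : Pt d} (ha : a ∉ X) {p W : ℝ}
    (hp : 0 ≤ p) (hW : 0 ≤ W) (hpW : 0 < p + W) (hwa : w a = ENNReal.ofReal p)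
    (hwX : ∑ y ∈ X, w y = ENNReal.ofReal W) :
    (coin (p / (p + W))).bind (fun b => if b then PMF.pure a else sampleBy X w) =
      sampleBy (insert a X) w := by
  have hsum : ∑ y ∈ insert a X, w y = ENNReal.ofReal (p + W) := by
    rw [Finset.sum_insert ha, hwa, hwX, ENNReal.ofReal_add hp hW]
  have hmin : min 1 (ENNReal.ofReal (p / (p + W))) = ENNReal.ofReal (p / (p + W)) := by
    refine min_eq_right ?_
    rw [← ENNReal.ofReal_one]
    exact ENNReal.ofReal_le_ofReal ((div_le_one hpW).2 (by linarith))
  have hcompl : 1 - ENNReal.ofReal (p / (p + W)) = ENNReal.ofReal (W / (p + W)) := by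
    rw [← ENNReal.ofReal_one, ← ENNReal.ofReal_sub _ (by positivity)]
    congr 1
    field_simp
    ring
  ext y
  rw [PMF.bind_apply, tsum_bool, sampleBy_apply (by rw [hsum]; simpa using hpW)
    (by rw [hsum]; simp), hsum]
  simp only [coin, PMF.ofFintype_apply, cond_true, cond_false, hmin, hcompl, if_true,
    Bool.false_eq_true, if_false, PMF.pure_apply]
  rw [ENNReal.ofReal_div_of_pos hpW, ENNReal.ofReal_div_of_pos hpW]
  -- If the rest has weight 0, `sampleBy X w` is a meaningless point mass, but the coin shows
  -- `false` with probability 0.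
  rcases hW.eq_or_lt with rfl | hW0
  · by_cases hya : y = a
    · subst hya
      simp [hwa, ENNReal.div_eq_inv_mul, mul_comm]
    · have hzero : ∀ y ∈ X, w y = 0 := by
        rw [ENNReal.ofReal_zero, Finset.sum_eq_zero_iff] at hwX; exact hwX
      have : (if y ∈ X then w y else 0) = 0 := by
        split_ifs with h
        · exact hzero y h
        · rfl
      simp [hya, this]
  · rw [sampleBy_apply (by rw [hwX]; simpa using hW0) (by rw [hwX]; simp), hwX]
    by_cases hya : y = a
    · subst hya
      simp [hwa, ha, ENNReal.div_eq_inv_mul, mul_comm]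
    · simp only [hya, if_false, mul_zero, add_zero, Finset.mem_insert, false_or]
      rw [ENNReal.div_eq_inv_mul, mul_assoc, mul_left_comm (ENNReal.ofReal W),
        ENNReal.mul_inv_cancel (by simpa using hW0) (by simp), mul_one, mul_comm]

/-- Go through the points from `x` (scalar `10`) on and stop with probability `w_x / S` at `x`, where
`S` (real scalar `12`) is the sum of the remaining weights. -/
def scanLoop : Prog :=
  .while (.natLT (nvar 14) (.lit 1))
    (.seq (.flip 14 (.lit 0) (.lit 0) (.div (.load 2 (.lit 0) (nvar 10)) (rvar 12)))
      (.seq (setRvar 12 (.sub (rvar 12) (.load 2 (.lit 0) (nvar 10))))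
        (setNvar 10 (.add (nvar 10) (.lit 1)))))

theorem coin_true {p : ℝ} (h : 1 ≤ p) : coin p = PMF.pure true := by
  ext b
  have : min 1 (ENNReal.ofReal p) = 1 := min_eq_left (by simpa using h)
  cases b <;> simp [coin, PMF.pure_apply, this]

/-- Real arithmetic is exact, so the scalar always equals the remaining sum; at the last positive
weight the bias is 1, and the scan cannot run past the points. The counter ends one beyond the
chosen index, which `addCenter` undoes. -/
theorem wp_scanLoop (hx : Function.Injective x) {D : ℕ → ℕ → ℝ} {w : ℕ → ℝ} {wt : Pt d → ℝ≥0∞}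
    (hw : ∀ i < n, 0 ≤ w i) (hwt : ∀ i < n, wt (pt x i) = ENNReal.ofReal (w i)) (l : ℕ) {j : ℕ}
    (hj : j + l = n) {m : Mem} (hpos : 0 < ∑ i ∈ Finset.Ico j n, w i) (hm10 : m.nat 10 0 0 = j)
    (hm14 : m.nat 14 0 0 = 0) (hm12 : m.real 12 0 0 = ∑ i ∈ Finset.Ico j n, w i)
    (hm2 : ∀ i < n, m.real 2 0 i = w i) :
    Wp D scanLoop m (l * 6 + 1) (sampleBy ((Finset.Ico j n).image (pt x)) wt) fun c m' =>
      (∃ i < n, c = pt x i ∧ m'.nat 10 0 0 = i + 1) ∧ Frame [10, 14] [12] m m' := by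
  induction l generalizing j m with
  | zero => exact absurd hpos (by simp [show j = n by omega])
  | succ l ih =>
    have hjn : j < n := by omega
    have hIco : Finset.Ico j n = insert j (Finset.Ico (j + 1) n) := by
      ext i; simp; omega
    have hsplit : ∑ i ∈ Finset.Ico j n, w i = w j + ∑ i ∈ Finset.Ico (j + 1) n, w i := by
      rw [hIco, Finset.sum_insert (by simp)]
    have hW : 0 ≤ ∑ i ∈ Finset.Ico (j + 1) n, w i :=
      Finset.sum_nonneg fun i hi => hw i (Finset.mem_Ico.1 hi).2
    have hlaw := coin_bind_sampleBy (X := (Finset.Ico (j + 1) n).image (pt x)) (w := wt)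
      (a := pt x j) (by
        rw [Finset.mem_image]
        rintro ⟨i, hi, h⟩
        rw [Finset.mem_Ico] at hi
        have := pt_inj hx hi.2 hjn h
        omega) (hw j hjn) hW (hsplit ▸ hpos) (hwt j hjn) (by
        rw [Finset.sum_image, ENNReal.ofReal_sum_of_nonneg]
        · exact Finset.sum_congr rfl fun i hi => hwt i (Finset.mem_Ico.1 hi).2
        · exact fun i hi => hw i (Finset.mem_Ico.1 hi).2
        · intro i hi i' hi' h
          exact pt_inj hx (Finset.mem_Ico.1 hi).2 (Finset.mem_Ico.1 hi').2 h)
    rw [hIco, Finset.image_insert, ← hlaw, ← hsplit]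
    have hbody : Wp D (.seq (.flip 14 (.lit 0) (.lit 0) (.div (.load 2 (.lit 0) (nvar 10))
        (rvar 12))) (.seq (setRvar 12 (.sub (rvar 12) (.load 2 (.lit 0) (nvar 10))))
        (setNvar 10 (.add (nvar 10) (.lit 1))))) m 5
        (coin (w j / ∑ i ∈ Finset.Ico j n, w i)) fun b m' =>
        m' = (((m.setNat 14 0 0 (if b then 1 else 0)).setReal 12 0 0
          (∑ i ∈ Finset.Ico (j + 1) n, w i)).setNat 10 0 0 (j + 1)) := by
      have := wp_flip (D := D) (m := m) 14 (.lit 0) (.lit 0)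
        (.div (.load 2 (.lit 0) (nvar 10)) (rvar 12))
      have he : RExpr.eval D m (.div (.load 2 (.lit 0) (nvar 10)) (rvar 12)) =
          w j / ∑ i ∈ Finset.Ico j n, w i := by
        simp [RExpr.eval, NExpr.eval, nvar, rvar, hm10, hm12, hm2 j hjn]
      rw [he] at this
      refine (this.seq_det (t' := 3) fun b _ m' hm' => Det.of_sem
        (by exact ⟨trivial, trivial⟩) le_rfl ?_).conseq le_rfl fun _ _ _ h => h
      rw [hm']
      simp [Prog.sem, setRvar, setNvar, RExpr.eval, NExpr.eval, nvar, rvar, Mem.setReal, Mem.setNat,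
        hm10, hm12, hm2 j hjn, hsplit]
      rfl
    refine (Wp.while_true (by simp [BExpr.holds, nvar, NExpr.eval, hm14]) hbody (t' := l * 6 + 1)
      fun b hb m' hm' => ?_).conseq (by omega) fun _ _ _ h => h
    have hfr : Frame [10, 14] [12] m m' := by
      rw [hm']
      exact (((Frame.refl _ _ m).setNat (by decide) _ _ _).setReal (by decide) _ _ _).setNat
        (by decide) _ _ _
    cases b with
    | true =>
      refine (Det.while_false ?_ (Q := fun m' => (∃ i < n, pt x j = pt x i ∧ m'.nat 10 0 0 = i + 1) ∧
        Frame [10, 14] [12] m m') ⟨⟨j, hjn, rfl, ?_⟩, hfr⟩).conseq (by omega) (fun _ h => h) |>.wp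
          (Q := fun c m' => (∃ i < n, c = pt x i ∧ m'.nat 10 0 0 = i + 1) ∧
            Frame [10, 14] [12] m m')
      · simp [BExpr.holds, nvar, NExpr.eval, hm', Mem.setNat, Mem.setReal]
      · simp [hm', Mem.setNat]
    | false =>
      have hpos' : 0 < ∑ i ∈ Finset.Ico (j + 1) n, w i := by
        refine hW.lt_of_ne fun h0 => ?_
        have h1 : w j / ∑ i ∈ Finset.Ico j n, w i = 1 := by
          rw [hsplit, ← h0, add_zero]
          refine div_self ?_
          rw [hsplit, ← h0, add_zero] at hpos
          exact hpos.ne'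
        rw [h1, coin_true le_rfl] at hb
        simp at hb
      refine (ih (by omega) hpos' ?_ ?_ ?_ ?_).conseq le_rfl ?_
      · simp [hm', Mem.setNat]
      · simp [hm', Mem.setNat, Mem.setReal]
      · simp [hm', Mem.setNat, Mem.setReal]
      · intro i hi
        rw [← hm2 i hi, hfr.2 2 (by decide)]
      · rintro c _ m'' ⟨h1, h2⟩
        exact ⟨h1, hfr.trans h2 _ _ (by simp) (by simp) (by simp) (by simp)⟩

end Points

/-! ### The current centers in memory: insertion, deletion and sampling -/

section Centers

variable {d n : ℕ} {x : Fin n → Pt d} {Δ θ : ℝ} {C : Finset (Pt d)} {m : Mem}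

/-- The memory holds the number of points and `Δ² + 1`. -/
structure Consts (n : ℕ) (Δ : ℝ) (m : Mem) : Prop where
  card : m.nat 0 0 0 = n
  big : m.real 13 0 0 = Δ * Δ + 1

theorem Consts.frame {W V : List ℕ} {m' : Mem} (h : Consts n Δ m) (hf : Frame W V m m')
    (hW : 0 ∉ W) (hV : 13 ∉ V) : Consts n Δ m' :=
  ⟨by rw [hf.1 0 hW, h.card], by rw [hf.2 13 hV, h.big]⟩

/-- The memory represents the centers `C`. -/
structure Represents (x : Fin n → Pt d) (Δ : ℝ) (C : Finset (Pt d)) (m : Mem) : Prop where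
  subset : C ⊆ Finset.univ.image x
  forest : Forest x Δ C m
  flag : ∀ y < n, m.nat 2 0 y = if pt x y ∈ C then 1 else 0

theorem Represents.frame {W V : List ℕ} {m' : Mem} (h : Represents x Δ C m) (hf : Frame W V m m')
    (h2 : 2 ∉ W) (h3 : 3 ∉ W) (hV : 3 ∉ V) : Represents x Δ C m' :=
  ⟨h.subset, h.forest.congr (hf.1 3 h3) (hf.2 3 hV), fun y hy => by rw [hf.1 2 h2, h.flag y hy]⟩

/-- The truncated squared distance, also truncated at `Δ² + 1`. -/
noncomputable def wgt (x : Fin n → Pt d) (Δ θ : ℝ) (C : Finset (Pt d)) (i : ℕ) : ℝ :=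
  min θ (truncSq (Δ * Δ + 1) (pt x i) C)

theorem wgt_eq (hX : SpreadBetween (Finset.univ.image x) Δ) (hC : C ⊆ Finset.univ.image x)
    (hne : C.Nonempty) {i : ℕ} (hi : i < n) : wgt x Δ θ C i = truncSq θ (pt x i) C := by
  refine (truncSq_eq_min hne fun c hc => ?_).symm
  have := hX.sq_le (pt_mem hi) (hC hc)
  linarith [sq Δ]

theorem wgt_nonneg (hθ : 0 < θ) (i : ℕ) : 0 ≤ wgt x Δ θ C i :=
  le_min hθ.le (truncSq_nonneg (by nlinarith [mul_self_nonneg Δ]))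

/-! #### Insertion and deletion of a center -/

/-- Insert the point before the point `x` (scalar `10`) into the set of centers. -/
def addCenter : Prog :=
  .seq (.seq (setNvar 12 (.sub (nvar 10) (.lit 1))) (.setNat 2 (.lit 0) (nvar 12) (.lit 1))) updateAll

/-- Delete the point `y` (scalar `12`) from the set of centers. -/
def removeCenter : Prog := .seq (.setNat 2 (.lit 0) (nvar 12) (.lit 0)) updateAll

theorem det_addCenter (hx : Function.Injective x) {i L : ℕ} (hc : Consts n Δ m)
    (hL : n ≤ 2 ^ L) (hr : Represents x Δ C m) (hi : i < n) (h10 : m.nat 10 0 0 = i + 1) :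
    Det (sqDistOracle x) addCenter m (n * (10 * L + 12) + 7) fun m' =>
      Represents x Δ (insert (pt x i) C) m' ∧ Frame [2, 3, 10, 11, 12] [3, 14] m m' := by
  have hs : (Prog.seq (setNvar 12 (.sub (nvar 10) (.lit 1)))
      (.setNat 2 (.lit 0) (nvar 12) (.lit 1))).sem (sqDistOracle x) m =
      (m.setNat 12 0 0 i).setNat 2 0 i 1 := by
    simp [Prog.sem, setNvar, nvar, NExpr.eval, h10, Mem.setNat]
  have hfr : Frame [2, 12] [] m ((m.setNat 12 0 0 i).setNat 2 0 i 1) :=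
    ((Frame.refl _ _ m).setNat (by decide) _ _ _).setNat (by decide) _ _ _
  have hflag : ∀ y < n, ((m.setNat 12 0 0 i).setNat 2 0 i 1).nat 2 0 y =
      if pt x y ∈ insert (pt x i) C then 1 else 0 := by
    intro y hy
    by_cases hyi : y = i
    · subst hyi; simp [Mem.setNat]
    · have : pt x y ≠ pt x i := fun h => hyi (pt_inj hx hy hi h)
      simp [Mem.setNat, hyi, this, hr.flag y hy]
  refine (Det.seq_sem (by exact ⟨trivial, trivial⟩) hs (det_updateAll (y := i) (L := L) (C := C)
    (C' := insert (pt x i) C) (hc.frame hfr (by decide) (by decide)).card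
    (hc.frame hfr (by decide) (by decide)).big (by simp [Mem.setNat]) hi hL
    (hr.forest.congr (hfr.1 3 (by decide)) (hfr.2 3 (by decide))) (fun y hy hyi => ?_)
    (hflag i hi))).conseq (by simp only [Prog.size, setNvar]; omega) ?_
  · have : pt x y ≠ pt x i := fun h => hyi (pt_inj hx hy hi h)
    simp [this]
  · rintro m' ⟨h1, h2⟩
    refine ⟨⟨Finset.insert_subset (pt_mem hi) hr.subset, h1, fun y hy => ?_⟩,
      hfr.trans h2 _ _ (by simp) (by simp) (by simp) (by simp)⟩
    rw [h2.1 2 (by decide)]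
    exact hflag y hy

theorem det_removeCenter (hx : Function.Injective x) {i L : ℕ} (hc : Consts n Δ m)
    (hL : n ≤ 2 ^ L) (hr : Represents x Δ C m) (hi : i < n) (h12 : m.nat 12 0 0 = i) :
    Det (sqDistOracle x) removeCenter m (n * (10 * L + 12) + 5) fun m' =>
      Represents x Δ (C.erase (pt x i)) m' ∧ Frame [2, 3, 10, 11] [3, 14] m m' := by
  have hs : (Prog.setNat 2 (.lit 0) (nvar 12) (.lit 0)).sem (sqDistOracle x) m =
      m.setNat 2 0 i 0 := by
    simp [Prog.sem, nvar, NExpr.eval, h12]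
  have hfr : Frame [2] [] m (m.setNat 2 0 i 0) := (Frame.refl _ _ m).setNat (by decide) _ _ _
  have hflag : ∀ y < n, (m.setNat 2 0 i 0).nat 2 0 y =
      if pt x y ∈ C.erase (pt x i) then 1 else 0 := by
    intro y hy
    by_cases hyi : y = i
    · subst hyi; simp [Mem.setNat]
    · have : pt x y ≠ pt x i := fun h => hyi (pt_inj hx hy hi h)
      simp [Mem.setNat, hyi, this, hr.flag y hy]
  refine (Det.seq_sem (by exact trivial) hs (det_updateAll (y := i) (L := L) (C := C)
    (C' := C.erase (pt x i)) (hc.frame hfr (by decide) (by decide)).card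
    (hc.frame hfr (by decide) (by decide)).big (by simpa [Mem.setNat] using h12) hi hL
    (hr.forest.congr (hfr.1 3 (by decide)) (hfr.2 3 (by decide))) (fun y hy hyi => ?_)
    (hflag i hi))).conseq (by simp only [Prog.size]; omega) ?_
  · have : pt x y ≠ pt x i := fun h => hyi (pt_inj hx hy hi h)
    simp [this]
  · rintro m' ⟨h1, h2⟩
    refine ⟨⟨(Finset.erase_subset _ _).trans hr.subset, h1, fun y hy => ?_⟩,
      hfr.trans h2 _ _ (by simp) (by simp) (by simp) (by simp)⟩
    rw [h2.1 2 (by decide)]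
    exact hflag y hy

/-! #### Sampling -/

/-- Set the real scalar `18` to the truncated squared distance of the current point. -/
def minKey : Prog :=
  .seq (setRvar 18 (.sub (rvar 13) (keyAt (.lit 1))))
    (.ite (.realLT (rvar 10) (rvar 18)) (setRvar 18 (rvar 10)) .skip)

theorem sem_minKey {D : ℕ → ℕ → ℝ} : minKey.sem D m = m.setReal 18 0 0
    (min (m.real 10 0 0) (m.real 13 0 0 - m.real 3 (m.nat 10 0 0) 1)) := by
  obtain ⟨v, hv⟩ : ∃ v, v = m.real 13 0 0 - m.real 3 (m.nat 10 0 0) 1 := ⟨_, rfl⟩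
  have hs : (setRvar 18 (.sub (rvar 13) (keyAt (.lit 1)))).sem D m = m.setReal 18 0 0 v := by
    rw [hv]; rfl
  rw [minKey, Prog.sem, hs, Prog.sem, ← hv]
  have hiff : (BExpr.realLT (rvar 10) (rvar 18)).holds D (m.setReal 18 0 0 v) ↔
      m.real 10 0 0 < v := by
    simp [BExpr.holds, rvar, RExpr.eval, NExpr.eval, Mem.setReal]
  by_cases h : m.real 10 0 0 < v
  · rw [if_pos (hiff.2 h), min_eq_left h.le]
    simp only [Mem.setReal, Prog.sem, setRvar, rvar, RExpr.eval, NExpr.eval, Mem.mk.injEq, true_and]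
    funext a i j
    split_ifs <;> simp_all
  · rw [if_neg (fun h' => h (hiff.1 h')), min_eq_right (not_lt.1 h)]
    rfl

/-- Compute the weight of the current point. -/
def weightStep : Prog :=
  .seq minKey (.seq (.setReal 2 (.lit 0) (nvar 10) (rvar 18))
    (setRvar 12 (.add (rvar 12) (rvar 18))))

/-- Compute all the weights, and their sum. -/
def weightLoop : Prog := .seq (setRvar 12 (.lit 0)) (forLoop 10 inputN weightStep)

theorem det_weightLoop {D : ℕ → ℕ → ℝ} (hn : m.nat 0 0 0 = n) :
    Det D weightLoop m (n * 12 + 5) fun m' =>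
      Frame [10] [2, 12, 18] m m' ∧
      m'.real 12 0 0 = ∑ i ∈ Finset.range n, min (m.real 10 0 0) (m.real 13 0 0 - m.real 3 i 1) ∧
      ∀ i < n, m'.real 2 0 i = min (m.real 10 0 0) (m.real 13 0 0 - m.real 3 i 1) := by
  have hs : (setRvar 12 (.lit 0)).sem D m = m.setReal 12 0 0 0 := by
    simp [Prog.sem, setRvar, NExpr.eval, RExpr.eval]
  refine (Det.seq_sem (by exact trivial) hs (Det.forLoop (n := n)
    (t := weightStep.size) (t' := n * 12 + 3) (I := fun i m' => m'.nat 10 0 0 = i ∧ Frame [10] [2, 12, 18] m m' ∧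
      m'.real 12 0 0 = ∑ i ∈ Finset.range i, min (m.real 10 0 0) (m.real 13 0 0 - m.real 3 i 1) ∧
      ∀ j < i, m'.real 2 0 j = min (m.real 10 0 0) (m.real 13 0 0 - m.real 3 j 1))
      ?_ ?_ ?_ le_rfl)).conseq (by simp only [Prog.size, setRvar]; omega) fun m' h => h.2
  · rintro i m' ⟨h1, h2, -⟩
    refine ⟨h1, ?_⟩
    rw [← hn, ← h2.1 0 (by decide)]
    rfl
  · rintro i hi m₁ ⟨h1, h2, h3, h4⟩
    refine Det.of_sem (by exact ⟨⟨trivial, trivial, trivial⟩, trivial, trivial⟩) le_rfl ?_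
    have e10 := h2.2 10 (by decide)
    have e13 := h2.2 13 (by decide)
    have e3 := h2.2 3 (by decide)
    obtain ⟨v, hv⟩ : ∃ v, v = min (m.real 10 0 0) (m.real 13 0 0 - m.real 3 i 1) := ⟨_, rfl⟩
    have hsem : weightStep.sem D m₁ = ((m₁.setReal 18 0 0 v).setReal 2 0 i v).setReal 12 0 0
        (m₁.real 12 0 0 + v) := by
      rw [weightStep, Prog.sem, sem_minKey, e10, e13, e3, h1, ← hv]
      simp [Prog.sem, NExpr.eval, RExpr.eval, nvar, rvar, setRvar, Mem.setReal, h1]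
    rw [hsem]
    refine ⟨by simpa [Mem.setReal] using h1, by simp [Mem.setNat], ?_, ?_, fun j hj => ?_⟩
    · exact (((h2.setReal (by decide) _ _ _).setReal (by decide) _ _ _).setReal (by decide)
        _ _ _).setNat (by decide) _ _ _
    · rw [Finset.sum_range_succ, ← h3, ← hv]
      simp [Mem.setReal, Mem.setNat]
    · by_cases hji : j = i
      · subst hji
        simp [Mem.setReal, Mem.setNat, hv]
      · rw [← h4 j (by omega)]
        simp [Mem.setReal, Mem.setNat, hji]
  · refine ⟨by simp [Mem.setNat], ?_, by simp [Mem.setReal, Mem.setNat],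
      fun j hj => absurd hj (by omega)⟩
    exact ((Frame.refl _ _ m).setReal (by decide) _ _ _).setNat (by decide) _ _ _

/-- Draw a center. -/
def drawCenter : Prog :=
  .seq weightLoop (.seq (.seq (setNvar 14 (.lit 0)) (setNvar 10 (.lit 0))) scanLoop)

/-- The stored weights are also truncated at Δ² + 1. This changes nothing if there is a center, and
for `∅` it only replaces one constant weight by another. -/
theorem sampleBy_min_eq (hX : SpreadBetween (Finset.univ.image x) Δ) (hn : 0 < n) (hθ : 0 < θ)
    (hC : C ⊆ Finset.univ.image x) :
    sampleBy (Finset.univ.image x) (fun y => ENNReal.ofReal (min θ (truncSq (Δ * Δ + 1) y C))) =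
      sampleTrunc (Finset.univ.image x) θ C := by
  have hB : 0 < Δ * Δ + 1 := by nlinarith [mul_self_nonneg Δ]
  rcases C.eq_empty_or_nonempty with rfl | hne
  · simp only [sampleTrunc, truncSq_empty]
    have hne : (Finset.univ.image x).Nonempty := ⟨_, pt_mem hn⟩
    rw [sampleBy_const hne (by simpa using ⟨hθ, hB⟩) (by simp),
      sampleBy_const hne (c := ENNReal.ofReal θ) (by simpa using hθ) (by simp)]
  · refine sampleBy_congr fun y hy => ?_
    obtain ⟨i, hi, rfl⟩ := exists_pt hy
    exact congrArg ENNReal.ofReal (wgt_eq hX hC hne hi)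

theorem wp_drawCenter (hx : Function.Injective x) (hX : SpreadBetween (Finset.univ.image x) Δ)
    (hθ : 0 < θ) (hcard : C.card < n) (hc : Consts n Δ m) (hr : Represents x Δ C m)
    (h10 : m.real 10 0 0 = θ) :
    Wp (sqDistOracle x) drawCenter m (n * 18 + 14) (sampleTrunc (Finset.univ.image x) θ C)
      fun c m' => (∃ i < n, c = pt x i ∧ m'.nat 10 0 0 = i + 1) ∧
        Frame [10, 14] [2, 12, 18] m m' := by
  have hn : 0 < n := by omega
  have hB : 0 < Δ * Δ + 1 := by nlinarith [mul_self_nonneg Δ]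
  have hw : ∀ i < n, min (m.real 10 0 0) (m.real 13 0 0 - m.real 3 i 1) = wgt x Δ θ C i :=
    fun i hi => by rw [h10, hc.big, (hr.forest i hi).root_eq hi hX hr.subset]; rfl
  have hpos : 0 < ∑ i ∈ Finset.range n, wgt x Δ θ C i := by
    obtain ⟨y, hy, hyC⟩ := Finset.exists_mem_notMem_of_card_lt_card (s := C)
      (t := Finset.univ.image x) (by rw [Finset.card_image_of_injective _ hx]; simpa using hcard)
    obtain ⟨i, hi, rfl⟩ := exists_pt hy
    exact Finset.sum_pos' (fun _ _ => wgt_nonneg hθ _) ⟨i, Finset.mem_range.2 hi,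
      lt_min hθ (truncSq_pos hB hyC)⟩
  refine (Det.seq_wp (t' := n * 6 + 6) (det_weightLoop hc.card) (fun m₁ hm₁ => ?_)
    (Q' := fun c m' => (∃ i < n, c = pt x i ∧ m'.nat 10 0 0 = i + 1) ∧
        Frame [10, 14] [2, 12, 18] m m')).conseq (by omega) fun _ _ _ h => h
  obtain ⟨h1, h2, h3⟩ := hm₁
  have hs : (Prog.seq (setNvar 14 (.lit 0)) (setNvar 10 (.lit 0))).sem (sqDistOracle x) m₁ =
      (m₁.setNat 14 0 0 0).setNat 10 0 0 0 := rfl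
  refine (Det.seq_wp (t' := n * 6 + 1) (det_sem _ (by exact ⟨trivial, trivial⟩) m₁)
    fun m₂ hm₂ => ?_).conseq (by simp only [Prog.size, setNvar]; omega) fun _ _ _ h => h
  rw [hs] at hm₂
  have hfr : Frame [10, 14] [2, 12, 18] m m₂ := by
    rw [hm₂]
    exact ((h1.trans (Frame.refl [] [] _) [10, 14] [2, 12, 18] (by simp) (by simp) (by simp)
      (by simp)).setNat (by decide) _ _ _).setNat (by decide) _ _ _
  have h := wp_scanLoop (D := sqDistOracle x) hx (w := wgt x Δ θ C)
    (wt := fun y => ENNReal.ofReal (min θ (truncSq (Δ * Δ + 1) y C)))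
    (fun i _ => wgt_nonneg hθ i) (fun i _ => rfl) n (j := 0) (by omega) (m := m₂)
    (by simpa using hpos) (by simp [hm₂, Mem.setNat]) (by simp [hm₂, Mem.setNat])
    (by
      rw [hm₂]
      simp only [Mem.setNat, h2, Finset.range_eq_Ico]
      exact Finset.sum_congr rfl fun i hi => hw i (Finset.mem_Ico.1 hi).2)
    (fun i hi => by rw [hm₂]; exact (h3 i hi).trans (hw i hi))
  rw [← Finset.range_eq_Ico, image_pt, sampleBy_min_eq hX hn hθ hr.subset] at h
  refine h.conseq le_rfl ?_
  rintro c - m' ⟨h4, h5⟩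
  exact ⟨h4, hfr.trans h5 _ _ (by simp) (by simp) (by simp) (by simp)⟩

/-- Draw a center, and insert it. -/
def drawAndAdd : Prog := .seq drawCenter addCenter

theorem wp_drawAndAdd (hx : Function.Injective x) (hX : SpreadBetween (Finset.univ.image x) Δ)
    (hθ : 0 < θ) (hcard : C.card < n) {L : ℕ} (hL : n ≤ 2 ^ L) (hc : Consts n Δ m)
    (hr : Represents x Δ C m) (h10 : m.real 10 0 0 = θ) :
    Wp (sqDistOracle x) drawAndAdd m (n * (10 * L + 30) + 22)
      (sampleTrunc (Finset.univ.image x) θ C)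
      fun c m' => Represents x Δ (insert c C) m' ∧
        Frame [2, 3, 10, 11, 12, 14] [2, 3, 12, 14, 18] m m' := by
  refine (Wp.seq_det (t' := n * (10 * L + 12) + 7) (wp_drawCenter hx hX hθ hcard hc hr h10)
    fun c _ m' hm' => ?_).conseq (by ring_nf; omega) fun _ _ _ h => h
  obtain ⟨⟨i, hi, rfl, h1⟩, h2⟩ := hm'
  refine (det_addCenter hx (hc.frame h2 (by decide) (by decide)) hL
    (hr.frame h2 (by decide) (by decide) (by decide)) hi h1).conseq le_rfl ?_
  rintro m'' ⟨h3, h4⟩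
  exact ⟨h3, h2.trans h4 _ _ (by simp) (by simp) (by simp) (by simp)⟩

end Centers

section Deletion

variable {d n : ℕ} {x : Fin n → Pt d} {Δ θ : ℝ} {C : Finset (Pt d)} {m : Mem}

/-! #### The cost of the deletion of a center -/

/-- The effect of the deletion of the center `y` on the first `i` points. -/
noncomputable def delCost (x : Fin n → Pt d) (Δ θ : ℝ) (C : Finset (Pt d)) (i y : ℕ) : ℝ :=
  ∑ j ∈ Finset.range i, (wgt x Δ θ (C.erase (pt x y)) j - wgt x Δ θ C j)

/-- Find the center of the current point, and mark it for deletion from the tree. -/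
def beforeDelete : Prog :=
  .seq (setNvar 12 (argAt (.lit 1))) (.seq minKey
    (.seq (setRvar 20 (rvar 18)) (setRvar 14 (.lit 0))))

/-- Note the new cost of the current point, and mark its center for insertion into the tree. -/
def afterDelete : Prog :=
  .seq minKey (.seq (.setReal 4 (.lit 0) (nvar 12)
    (.add (.load 4 (.lit 0) (nvar 12)) (.sub (rvar 18) (rvar 20))))
    (setRvar 14 (.sub (rvar 13) (.sqDist (nvar 10) (nvar 12)))))

/-- Charge the current point to its center. -/
def delCostStep : Prog := .seq beforeDelete (.seq updateRow (.seq afterDelete updateRow))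

/-- The cost of a point can change only if the center at the root of its tree is deleted. Taking
that center out of this tree, reading the new root and putting it back costs O(log n), whatever the
number of centers. -/
theorem det_delCostStep (hx : Function.Injective x) (hX : SpreadBetween (Finset.univ.image x) Δ)
    {i L : ℕ} (hL : n ≤ 2 ^ L) (hc : Consts n Δ m) (hθ : m.real 10 0 0 = θ)
    (hr : Represents x Δ C m) (hne : C.Nonempty) (hi : i < n) (h10 : m.nat 10 0 0 = i) :
    Det (sqDistOracle x) delCostStep m (20 * L + 40) fun m' =>
      Frame [3, 11, 12] [3, 4, 14, 18, 20] m m' ∧ Forest x Δ C m' ∧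
        ∀ y < n, pt x y ∈ C → m'.real 4 0 y =
          m.real 4 0 y + (wgt x Δ θ (C.erase (pt x y)) i - wgt x Δ θ C i) := by
  have hrow := hr.forest i hi
  obtain ⟨hyn, hyC, hdist, hkey⟩ := hrow.nearest_spec hi hX hr.subset hne
  obtain ⟨y, hy⟩ : ∃ y, y = m.nat 3 i 1 := ⟨_, rfl⟩
  rw [← hy] at hyn hyC hdist
  obtain ⟨m₁, hm₁⟩ : ∃ m₁, m₁ = (((m.setNat 12 0 0 y).setReal 18 0 0 (wgt x Δ θ C i)).setReal 20 0 0
      (wgt x Δ θ C i)).setReal 14 0 0 0 := ⟨_, rfl⟩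
  have hs₁ : beforeDelete.sem (sqDistOracle x) m = m₁ := by
    rw [beforeDelete, Prog.sem, Prog.sem, sem_minKey]
    simp [Prog.sem, setNvar, setRvar, NExpr.eval, RExpr.eval, argAt, nvar, rvar, Mem.setNat,
      Mem.setReal, h10, ← hy, hθ, hc.big, hkey, hm₁, wgt]
  have hf₁ : Frame [12] [14, 18, 20] m m₁ := by
    rw [hm₁]
    exact ((((Frame.refl _ _ m).setNat (by decide) _ _ _).setReal (by decide) _ _ _).setReal
      (by decide) _ _ _).setReal (by decide) _ _ _
  have hc₁ := hc.frame hf₁ (by decide) (by decide)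
  have h10₁ : m₁.nat 10 0 0 = i := by rw [hf₁.1 10 (by decide), h10]
  have h12₁ : m₁.nat 12 0 0 = y := by simp [hm₁, Mem.setReal, Mem.setNat]
  have hidx : ∀ y', y' ≠ y → (y' ∈ idx x (C.erase (pt x y)) ↔ y' ∈ idx x C) := by
    intro y' hy'
    by_cases hyn' : y' < n
    · have : pt x y' ≠ pt x y := fun h => hy' (pt_inj hx hyn' hyn h)
      simp [idx, this]
    · simp [idx, hyn']
  refine (Det.seq_sem (by exact ⟨trivial, ⟨trivial, trivial, trivial⟩, trivial, trivial⟩) hs₁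
    (Det.seq (t' := 10 * L + 17) (det_updateRow (n := n)
      (f := fun y => Δ * Δ + 1 - sqDistOracle x i y) (x := i) (y := y) (L := L) (S := idx x C)
      (S' := idx x (C.erase (pt x y))) hc₁.card h10₁ h12₁ hyn hL
      (by rw [hf₁.2 3 (by decide), hf₁.1 3 (by decide)]; exact hrow) hidx
      (by simp [hm₁, Mem.setReal, idx])) fun m₂ hm₂ => ?_)).conseq
    (by simp only [Prog.size, setNvar, setRvar, beforeDelete, minKey]; omega) fun _ h => h
  obtain ⟨hrow₂, hfr₂⟩ := hm₂
  have hf₂ : Frame [3, 11, 12] [3, 14, 18, 20] m m₂ :=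
    hf₁.trans hfr₂.frame _ _ (by simp) (by simp) (by simp) (by simp)
  have hc₂ := hc.frame hf₂ (by decide) (by decide)
  have h10₂ : m₂.nat 10 0 0 = i := by rw [hf₂.1 10 (by decide), h10]
  have h12₂ : m₂.nat 12 0 0 = y := by rw [hfr₂.nat 12 (by decide) (by decide), h12₁]
  have h20₂ : m₂.real 20 0 0 = wgt x Δ θ C i := by
    rw [hfr₂.real 20 (by decide)]; simp [hm₁, Mem.setReal]
  have hθ₂ : m₂.real 10 0 0 = θ := by rw [hf₂.2 10 (by decide), hθ]
  have hkey₂ := hrow₂.root_eq hi hX ((Finset.erase_subset _ _).trans hr.subset)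
  obtain ⟨b, hb⟩ : ∃ b, b = wgt x Δ θ (C.erase (pt x y)) i := ⟨_, rfl⟩
  obtain ⟨m₃, hm₃⟩ : ∃ m₃, m₃ = ((m₂.setReal 18 0 0 b).setReal 4 0 y
      (m₂.real 4 0 y + (b - wgt x Δ θ C i))).setReal 14 0 0 (Δ * Δ + 1 - sqDistOracle x i y) :=
    ⟨_, rfl⟩
  have hs₃ : afterDelete.sem (sqDistOracle x) m₂ = m₃ := by
    rw [afterDelete, Prog.sem, sem_minKey, h10₂, hθ₂, hc₂.big, hkey₂]
    rw [show min θ (truncSq (Δ * Δ + 1) (pt x i) (C.erase (pt x y))) = b from hb.symm]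
    simp [Prog.sem, setRvar, NExpr.eval, RExpr.eval, nvar, rvar, Mem.setReal, h10₂, h12₂, h20₂,
      hc₂.big, hm₃]
  have hf₃ : Frame [] [4, 14, 18] m₂ m₃ := by
    rw [hm₃]
    exact (((Frame.refl _ _ m₂).setReal (by decide) _ _ _).setReal (by decide) _ _ _).setReal
      (by decide) _ _ _
  have hc₃ := hc₂.frame hf₃ (by decide) (by decide)
  have h10₃ : m₃.nat 10 0 0 = i := by rw [hf₃.1 10 (by decide), h10₂]
  have h12₃ : m₃.nat 12 0 0 = y := by rw [hf₃.1 12 (by decide), h12₂]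
  refine (Det.seq_sem (by exact ⟨⟨trivial, trivial, trivial⟩, trivial, trivial⟩) hs₃
    (det_updateRow (n := n) (f := fun y => Δ * Δ + 1 - sqDistOracle x i y) (x := i) (y := y) (L := L)
      (S := idx x (C.erase (pt x y))) (S' := idx x C) hc₃.card h10₃ h12₃ hyn hL
      (by rw [hf₃.2 3 (by decide), hf₃.1 3 (by decide)]; exact hrow₂)
      (fun y' hy' => (hidx y' hy').symm)
      (by simp [hm₃, Mem.setReal, idx, hyn, hyC]))).conseq
    (by simp only [Prog.size, setRvar, afterDelete, minKey]; omega) ?_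
  rintro m₄ ⟨hrow₄, hfr₄⟩
  have hf₄ : Frame [3, 11, 12] [3, 4, 14, 18, 20] m m₄ :=
    (hf₂.trans hf₃ [3, 11, 12] [3, 4, 14, 18, 20] (by simp) (by simp) (by simp)
      (by simp)).trans hfr₄.frame _ _ (by simp) (by simp)
      (by simp) (by simp)
  refine ⟨hf₄, fun j hj => ?_, fun y' hy'n hy'C => ?_⟩
  · by_cases hji : j = i
    · rw [hji]; exact hrow₄
    · rw [(hfr₄.row j hji).1, (hfr₄.row j hji).2, hf₃.1 3 (by decide), hf₃.2 3 (by decide),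
        (hfr₂.row j hji).1, (hfr₂.row j hji).2, hf₁.1 3 (by decide), hf₁.2 3 (by decide)]
      exact hr.forest j hj
  · have h4 : m₂.real 4 = m.real 4 := by
      rw [hfr₂.real 4 (by decide), hf₁.2 4 (by decide)]
    rw [hfr₄.real 4 (by decide)]
    by_cases hyy : y' = y
    · subst hyy
      rw [← hb]
      simp [hm₃, Mem.setReal, h4]
    · have hmem : pt x y ∈ C.erase (pt x y') :=
        Finset.mem_erase.2 ⟨fun h => hyy (pt_inj hx hyn hy'n h).symm, hyC⟩
      -- Deleting any other center leaves `y` in place, so the cost is unchanged even if `y'` is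
      -- equally near.
      have heq : truncSq (Δ * Δ + 1) (pt x i) (C.erase (pt x y')) =
          truncSq (Δ * Δ + 1) (pt x i) C :=
        le_antisymm (by rw [hdist]; exact truncSq_le_dist hmem)
          (truncSq_anti (Finset.erase_subset _ _))
      simp [hm₃, Mem.setReal, h4, hyy, wgt, heq]

/-- Compute the effects of the deletions of the centers. -/
def delCostLoop : Prog :=
  .seq (forLoop 10 inputN (.setReal 4 (.lit 0) (nvar 10) (.lit 0))) (forLoop 10 inputN delCostStep)

theorem det_delCostLoop (hx : Function.Injective x) (hX : SpreadBetween (Finset.univ.image x) Δ)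
    {L : ℕ} (hL : n ≤ 2 ^ L) (hc : Consts n Δ m) (hθ : m.real 10 0 0 = θ)
    (hr : Represents x Δ C m) (hne : C.Nonempty) :
    Det (sqDistOracle x) delCostLoop m (n * (20 * L + 47) + 7) fun m' =>
      Frame [3, 10, 11, 12] [3, 4, 14, 18, 20] m m' ∧ Forest x Δ C m' ∧
        ∀ y < n, pt x y ∈ C → m'.real 4 0 y = delCost x Δ θ C n y := by
  refine (Det.seq (t' := n * (20 * L + 43) + 3) (Det.forLoop (n := n) (t := 1) (t' := n * 4 + 3)
    (I := fun i m' => m'.nat 10 0 0 = i ∧ Frame [10] [4] m m' ∧ ∀ y < i, m'.real 4 0 y = 0)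
    ?_ ?_ ?_ le_rfl) fun m₁ hm₁ => Det.forLoop (n := n) (t := 20 * L + 40)
      (I := fun i m' => m'.nat 10 0 0 = i ∧ Frame [3, 10, 11, 12] [3, 4, 14, 18, 20] m m' ∧
        Forest x Δ C m' ∧ ∀ y < n, pt x y ∈ C → m'.real 4 0 y = delCost x Δ θ C i y)
    ?_ ?_ ?_ le_rfl).conseq (by ring_nf; omega) fun m' h => h.2
  · rintro i m' ⟨h1, h2, -⟩
    exact ⟨h1, (hc.frame h2 (by decide) (by decide)).card⟩
  · rintro i hi m₁ ⟨h1, h2, h3⟩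
    refine Det.of_sem (by exact trivial) le_rfl ?_
    have hs : (Prog.setReal 4 (.lit 0) (nvar 10) (.lit 0)).sem (sqDistOracle x) m₁ =
        m₁.setReal 4 0 i 0 := by simp [Prog.sem, nvar, NExpr.eval, RExpr.eval, h1]
    rw [hs]
    refine ⟨h1, by simp [Mem.setNat], (h2.setReal (by decide) _ _ _).setNat (by decide) _ _ _,
      fun y hy => ?_⟩
    by_cases hyi : y = i
    · simp [hyi, Mem.setNat, Mem.setReal]
    · simp [hyi, Mem.setNat, Mem.setReal, h3 y (by omega)]
  · exact ⟨by simp [Mem.setNat], (Frame.refl _ _ m).setNat (by decide) _ _ _,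
      fun y hy => absurd hy (by omega)⟩
  · rintro i m' ⟨h1, h2, -⟩
    exact ⟨h1, (hc.frame h2 (by decide) (by decide)).card⟩
  · rintro i hi m₂ ⟨h1, h2, h3, h4⟩
    refine (det_delCostStep hx hX hL (hc.frame h2 (by decide) (by decide))
      (by rw [h2.2 10 (by decide), hθ]) ⟨hr.subset, h3, fun y hy => by
        rw [h2.1 2 (by decide), hr.flag y hy]⟩ hne hi h1).conseq le_rfl ?_
    rintro m₃ ⟨h5, h6, h7⟩
    refine ⟨by rw [h5.1 10 (by decide), h1], by simp [Mem.setNat],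
      (h2.trans h5 _ _ (List.Subset.refl _) (by simp) (List.Subset.refl _) (by simp)).setNat
        (by decide) _ _ _, h6.congr ?_ rfl, fun y hy hyC => ?_⟩
    · funext a b; simp [Mem.setNat]
    · rw [delCost, Finset.sum_range_succ, ← delCost, ← h4 y hy hyC]
      exact h7 y hy hyC
  · obtain ⟨h1, h2, h3⟩ := hm₁
    have h4 : Frame [10] [4] m (m₁.setNat 10 0 0 0) := h2.setNat (by decide) _ _ _
    refine ⟨by simp [Mem.setNat], h4.trans (Frame.refl [] [] _) _ _ (by simp) (by simp) (by simp)
      (by simp), hr.forest.congr (h4.1 3 (by decide)) (h4.2 3 (by decide)), fun y hy _ => ?_⟩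
    simp only [delCost, Finset.range_zero, Finset.sum_empty]
    exact h3 y hy

/-! #### The choice of the center to be deleted -/

/-- If the point `x` is a center whose deletion is cheaper than that of the best one so far, then
note it. -/
def argminStep : Prog :=
  .ite (.and (.natLT (.lit 0) (flagAt (nvar 10))) (.not (.and (.natLT (.lit 0) (nvar 17))
      (.not (.realLT (.load 4 (.lit 0) (nvar 10)) (rvar 19))))))
    (.seq (setNvar 12 (nvar 10)) (.seq (setRvar 19 (.load 4 (.lit 0) (nvar 10)))
      (setNvar 17 (.lit 1)))) .skip

/-- Find the center with the cheapest deletion. -/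
def argminLoop : Prog := .seq (setNvar 17 (.lit 0)) (forLoop 10 inputN argminStep)

/-- A later point replaces the candidate only if it is strictly cheaper. The strict inequality for
smaller indices identifies the result with the choice of `indexRule`. -/
theorem det_argminLoop {D : ℕ → ℕ → ℝ} {g : ℕ → ℝ} (hn : m.nat 0 0 0 = n)
    (hflag : ∀ y < n, m.nat 2 0 y = if pt x y ∈ C then 1 else 0)
    (hg : ∀ y < n, pt x y ∈ C → m.real 4 0 y = g y) (hC : C ⊆ Finset.univ.image x)
    (hne : C.Nonempty) :
    Det D argminLoop m (n * 10 + 5) fun m' =>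
      Frame [10, 12, 17] [19] m m' ∧ m'.nat 12 0 0 < n ∧ pt x (m'.nat 12 0 0) ∈ C ∧
        ∀ y < n, pt x y ∈ C → g (m'.nat 12 0 0) ≤ g y ∧
          (y < m'.nat 12 0 0 → g (m'.nat 12 0 0) < g y) := by
  have hs : (setNvar 17 (.lit 0)).sem D m = m.setNat 17 0 0 0 := rfl
  refine (Det.seq_sem (by exact trivial) hs (Det.forLoop (n := n)
    (t := argminStep.size) (t' := n * 10 + 3)
    (I := fun i m' => (m'.nat 10 0 0 = i ∧ Frame [10, 12, 17] [19] m m') ∧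
      ((m'.nat 17 0 0 = 0 ∧ ∀ y < n, y < i → pt x y ∉ C) ∨
        (m'.nat 17 0 0 = 1 ∧ m'.nat 12 0 0 < i ∧ m'.nat 12 0 0 < n ∧ pt x (m'.nat 12 0 0) ∈ C ∧
          m'.real 19 0 0 = g (m'.nat 12 0 0) ∧
          ∀ y < n, y < i → pt x y ∈ C → g (m'.nat 12 0 0) ≤ g y ∧
            (y < m'.nat 12 0 0 → g (m'.nat 12 0 0) < g y))))
      ?_ ?_ ?_ le_rfl)).conseq (by simp only [Prog.size, setNvar]; omega) ?_
  · rintro i m' ⟨⟨h1, h2⟩, -⟩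
    refine ⟨h1, ?_⟩
    rw [← hn, ← h2.1 0 (by decide)]
    rfl
  · rintro i hi m₁ ⟨⟨h1, h2⟩, h3⟩
    refine Det.of_sem (by exact ⟨⟨trivial, trivial, trivial⟩, trivial⟩) le_rfl ?_
    have e2 : m₁.nat 2 0 i = if pt x i ∈ C then 1 else 0 := by rw [h2.1 2 (by decide), hflag i hi]
    have e4 : pt x i ∈ C → m₁.real 4 0 i = g i := fun h => by rw [h2.2 4 (by decide), hg i hi h]
    by_cases hiC : pt x i ∈ C
    · by_cases hcond : 0 < m₁.nat 17 0 0 ∧ ¬ m₁.real 4 0 i < m₁.real 19 0 0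
      · have hsem : argminStep.sem D m₁ = m₁ := by
          rw [argminStep, Prog.sem, if_neg]
          · rfl
          · simp [BExpr.holds, nvar, rvar, NExpr.eval, RExpr.eval, h1, hcond.1]
            exact fun _ => not_lt.1 hcond.2
        rw [hsem]
        refine ⟨h1, ⟨by simp [Mem.setNat], h2.setNat (by decide) _ _ _⟩, ?_⟩
        rcases h3 with h3 | ⟨h4, h5, h6, h7, h8, h9⟩
        · exact absurd h3.1 hcond.1.ne'
        · refine Or.inr ⟨by simpa [Mem.setNat] using h4, by simp [Mem.setNat]; omega, by
            simpa [Mem.setNat] using h6, by simpa [Mem.setNat] using h7, by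
            simpa [Mem.setNat, Mem.setReal] using h8, fun y hy hyi hyC => ?_⟩
          have hset : (m₁.setNat 10 0 0 (i + 1)).nat 12 0 0 = m₁.nat 12 0 0 := by
            simp [Mem.setNat]
          rw [hset]
          rcases (Nat.lt_succ_iff_lt_or_eq.1 hyi) with hlt | rfl
          · exact h9 y hy hlt hyC
          · refine ⟨?_, fun h => absurd h (by omega)⟩
            rw [← h8, ← e4 hiC]
            exact not_lt.1 hcond.2
      · have hsem : argminStep.sem D m₁ = ((m₁.setNat 12 0 0 i).setReal 19 0 0 (g i)).setNat
            17 0 0 1 := by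
          rw [argminStep, Prog.sem, if_pos]
          · simp [Prog.sem, setNvar, setRvar, NExpr.eval, RExpr.eval, nvar, Mem.setNat, Mem.setReal,
              h1, e4 hiC]
            rfl
          · simp only [BExpr.holds, nvar, rvar, NExpr.eval, RExpr.eval, h1, flagAt, e2, hiC, if_true]
            exact ⟨Nat.one_pos, hcond⟩
        rw [hsem]
        refine ⟨by simpa [Mem.setNat, Mem.setReal] using h1, ⟨by simp [Mem.setNat], ?_⟩,
          Or.inr ⟨by simp [Mem.setNat], by simp [Mem.setNat, Mem.setReal], by
            simpa [Mem.setNat, Mem.setReal] using hi, by simpa [Mem.setNat, Mem.setReal] using hiC,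
            by simp [Mem.setNat, Mem.setReal], fun y hy hyi hyC => ?_⟩⟩
        · exact (((h2.setNat (by decide) _ _ _).setReal (by decide) _ _ _).setNat (by decide)
            _ _ _).setNat (by decide) _ _ _
        · have hset : ((((m₁.setNat 12 0 0 i).setReal 19 0 0 (g i)).setNat 17 0 0 1).setNat 10 0 0
              (i + 1)).nat 12 0 0 = i := by
            simp [Mem.setNat, Mem.setReal]
          rw [hset]
          rcases (Nat.lt_succ_iff_lt_or_eq.1 hyi) with hlt | rfl
          · rcases h3 with h3 | ⟨h4, h5, h6, h7, h8, h9⟩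
            · exact absurd hyC (h3.2 y hy hlt)
            · have hlt' : g i < g (m₁.nat 12 0 0) := by
                rw [← h8, ← e4 hiC]
                by_contra hcon
                exact hcond ⟨by omega, hcon⟩
              have := (h9 y hy hlt hyC).1
              exact ⟨by linarith, fun _ => by linarith⟩
          · exact ⟨le_rfl, fun h => absurd h (by omega)⟩
    · have hsem : argminStep.sem D m₁ = m₁ := by
        rw [argminStep, Prog.sem, if_neg]
        · rfl
        · simp [BExpr.holds, nvar, NExpr.eval, h1, flagAt, e2, hiC]
      rw [hsem]
      refine ⟨h1, ⟨by simp [Mem.setNat], h2.setNat (by decide) _ _ _⟩, ?_⟩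
      have hset : (m₁.setNat 10 0 0 (i + 1)).nat 12 0 0 = m₁.nat 12 0 0 := by
        simp [Mem.setNat]
      rw [hset]
      rcases h3 with h3 | ⟨h4, h5, h6, h7, h8, h9⟩
      · refine Or.inl ⟨by simpa [Mem.setNat] using h3.1, fun y hy hyi => ?_⟩
        rcases (Nat.lt_succ_iff_lt_or_eq.1 hyi) with hlt | rfl
        · exact h3.2 y hy hlt
        · exact hiC
      · refine Or.inr ⟨by simpa [Mem.setNat] using h4, by omega, h6, h7, h8, fun y hy hyi hyC => ?_⟩
        rcases (Nat.lt_succ_iff_lt_or_eq.1 hyi) with hlt | rfl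
        · exact h9 y hy hlt hyC
        · exact absurd hyC hiC
  · exact ⟨⟨by simp [Mem.setNat], ((Frame.refl _ _ m).setNat (by decide) _ _ _).setNat (by decide)
      _ _ _⟩, Or.inl ⟨by simp [Mem.setNat], fun y _ hy => absurd hy (by omega)⟩⟩
  · rintro m' ⟨⟨-, h1⟩, h2 | ⟨-, -, h3, h4, -, h5⟩⟩
    · obtain ⟨c, hc⟩ := hne
      obtain ⟨i, hi, rfl⟩ := exists_pt (hC hc)
      exact absurd hc (h2.2 i hi hi)
    · exact ⟨h1, h3, h4, fun y hy hyC => h5 y hy hy hyC⟩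

/-- The rule that prefers the point with the smallest index. -/
noncomputable def indexRule (x : Fin n → Pt d) : ArgminRule (Pt d) where
  pick S g :=
    if h : ∃ i, i < n ∧ pt x i ∈ S ∧ ∀ y ∈ S, g (pt x i) ≤ g y then pt x (Nat.find h)
    else if h' : S.Nonempty then (S.exists_min_image g h').choose else 0
  pick_mem S g hS := by
    split_ifs with h
    · exact (Nat.find_spec h).2.1
    · exact (S.exists_min_image g hS).choose_spec.1
  pick_le S g y hy := by
    have hS : S.Nonempty := ⟨y, hy⟩
    split_ifs with h
    · exact (Nat.find_spec h).2.2 y hy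
    · exact (S.exists_min_image g hS).choose_spec.2 y hy

theorem indexRule_pick {S : Finset (Pt d)} {g : Pt d → ℝ≥0∞} {i : ℕ} (hi : i < n)
    (hiS : pt x i ∈ S) (hle : ∀ y ∈ S, g (pt x i) ≤ g y)
    (hlt : ∀ j < i, pt x j ∈ S → g (pt x i) < g (pt x j)) : (indexRule x).pick S g = pt x i := by
  have h : ∃ i, i < n ∧ pt x i ∈ S ∧ ∀ y ∈ S, g (pt x i) ≤ g y := ⟨i, hi, hiS, hle⟩
  have hfind : Nat.find h = i := by
    refine (Nat.find_eq_iff h).2 ⟨⟨hi, hiS, hle⟩, ?_⟩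
    rintro j hj ⟨-, h2, h3⟩
    exact absurd (h3 _ hiS) (not_le.2 (hlt j hj h2))
  change (if h : ∃ i, i < n ∧ pt x i ∈ S ∧ ∀ y ∈ S, g (pt x i) ≤ g y then pt x (Nat.find h)
    else _) = _
  rw [dif_pos h, hfind]

/-- Delete the center whose deletion is cheapest. -/
def deleteCheapest : Prog := .seq delCostLoop (.seq argminLoop removeCenter)

theorem det_deleteCheapest (hx : Function.Injective x)
    (hX : SpreadBetween (Finset.univ.image x) Δ) {L : ℕ} (hL : n ≤ 2 ^ L) {Θ : ℝ≥0∞}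
    (hΘ : PenaltyEquiv (Finset.univ.image x) Θ θ) (hc : Consts n Δ m) (hθ : m.real 10 0 0 = θ)
    (hr : Represents x Δ C m) (hcard : 2 ≤ C.card) :
    Det (sqDistOracle x) deleteCheapest m (n * (30 * L + 69) + 19) fun m' =>
      Represents x Δ (C.erase ((indexRule x).pick C fun e => tau Θ (Finset.univ.image x) (C.erase e)))
        m' ∧ Frame [2, 3, 10, 11, 12, 17] [3, 4, 14, 18, 19, 20] m m' := by
  have hne : C.Nonempty := Finset.card_pos.1 (by omega)
  refine (Det.seq (t' := n * (10 * L + 22) + 11) (det_delCostLoop hx hX hL hc hθ hr hne)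
    fun m₁ hm₁ => ?_).conseq (by ring_nf; omega) fun _ h => h
  obtain ⟨h1, h2, h3⟩ := hm₁
  have hc₁ := hc.frame h1 (by decide) (by decide)
  have hflag₁ : ∀ y < n, m₁.nat 2 0 y = if pt x y ∈ C then 1 else 0 := fun y hy => by
    rw [h1.1 2 (by decide), hr.flag y hy]
  refine (Det.seq (t' := n * (10 * L + 12) + 5) (det_argminLoop hc₁.card hflag₁ h3 hr.subset hne)
    fun m₂ hm₂ => ?_).conseq (by ring_nf; omega) fun _ h => h
  obtain ⟨h4, h5, h6, h7⟩ := hm₂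
  obtain ⟨y, hy⟩ : ∃ y, y = m₂.nat 12 0 0 := ⟨_, rfl⟩
  rw [← hy] at h5 h6 h7
  -- The costs after deletion exceed the computed effects by the same constant, the current cost, so
  -- the minimizers agree.
  have htau : ∀ j < n, pt x j ∈ C → tau Θ (Finset.univ.image x) (C.erase (pt x j)) =
      ENNReal.ofReal (delCost x Δ θ C n j + ∑ i ∈ Finset.range n, wgt x Δ θ C i) := by
    intro j hj hjC
    have hne' : (C.erase (pt x j)).Nonempty :=
      Finset.card_pos.1 (by rw [Finset.card_erase_of_mem hjC]; omega)
    have hsub := (Finset.erase_subset (pt x j) C).trans hr.subset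
    rw [hΘ.tau_eq hsub hne', truncSum, sum_image_pt hx, delCost, ← Finset.sum_add_distrib]
    congr 1
    refine Finset.sum_congr rfl fun i hi => ?_
    rw [wgt_eq hX hsub hne' (Finset.mem_range.1 hi)]
    ring
  have hnn : ∀ j, 0 ≤ delCost x Δ θ C n j + ∑ i ∈ Finset.range n, wgt x Δ θ C i := by
    intro j
    rw [delCost, ← Finset.sum_add_distrib]
    refine Finset.sum_nonneg fun i _ => ?_
    have := wgt_nonneg (x := x) (Δ := Δ) (C := C.erase (pt x j)) hΘ.1 i
    linarith
  have hpick : (indexRule x).pick C (fun e => tau Θ (Finset.univ.image x) (C.erase e)) = pt x y := by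
    refine indexRule_pick h5 h6 (fun c hcC => ?_) fun j hj hjC => ?_
    · obtain ⟨j, hj, rfl⟩ := exists_pt (hr.subset hcC)
      rw [htau y h5 h6, htau j hj hcC]
      exact ENNReal.ofReal_le_ofReal (by linarith [(h7 j hj hcC).1])
    · have hjn : j < n := hj.trans h5
      rw [htau y h5 h6, htau j hjn hjC]
      refine (ENNReal.ofReal_lt_ofReal_iff_of_nonneg (hnn y)).2 ?_
      linarith [(h7 j hjn hjC).2 hj]
  rw [hpick]
  have hr₂ : Represents x Δ C m₂ := ⟨hr.subset, h2.congr (h4.1 3 (by decide)) (h4.2 3 (by decide)),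
    fun y hy => by rw [h4.1 2 (by decide), hflag₁ y hy]⟩
  refine (det_removeCenter hx (hc₁.frame h4 (by decide) (by decide)) hL hr₂ h5 hy.symm).conseq
    le_rfl ?_
  rintro m₃ ⟨h8, h9⟩
  refine ⟨h8, ?_⟩
  exact (h1.trans h4 [3, 10, 11, 12, 17] [3, 4, 14, 18, 19, 20] (by simp) (by simp) (by simp)
    (by simp)).trans h9 _ _ (by simp) (by simp) (by simp) (by simp)

end Deletion

/-! ### The stored input and a complete local search step -/

section Best

variable {d n k z N : ℕ} {x : Fin n → Pt d} {ε Δ θ : ℝ} {C : Finset (Pt d)} {m : Mem}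
  {best : Finset (Pt d) × Finset (Pt d)}

/-- The memory holds the input, and `Δ² + 1`. -/
structure Setup (n k z N : ℕ) (ε Δ : ℝ) (m : Mem) : Prop where
  nat : m.nat 0 = (inputMem n k z N ε Δ).nat 0
  real : m.real 0 = (inputMem n k z N ε Δ).real 0
  big : m.real 13 0 0 = Δ * Δ + 1

theorem Setup.frame {W V : List ℕ} {m' : Mem} (h : Setup n k z N ε Δ m) (hf : Frame W V m m')
    (hW : 0 ∉ W) (hV : 0 ∉ V) (hV' : 13 ∉ V) : Setup n k z N ε Δ m' :=
  ⟨by rw [hf.1 0 hW, h.nat], by rw [hf.2 0 hV, h.real], by rw [hf.2 13 hV', h.big]⟩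

theorem Setup.consts (h : Setup n k z N ε Δ m) : Consts n Δ m :=
  ⟨by rw [h.nat]; simp [inputMem], h.big⟩

/-! #### The outliers -/

/-- Decide whether the current point is an outlier, and update the cost and the number of the
outliers. -/
def outStep : Prog :=
  .seq (setRvar 18 (.sub (rvar 13) (keyAt (.lit 1))))
    (.ite (.realLT (rvar 18) (.mul (.lit 10) (rvar 10)))
      (.seq (setRvar 15 (.add (rvar 15) (rvar 18))) (.setNat 4 (.lit 0) (nvar 10) (.lit 0)))
      (.seq (setNvar 18 (.add (nvar 18) (.lit 1))) (.setNat 4 (.lit 0) (nvar 10) (.lit 1))))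

/-- Compute the outliers, their number, and the cost of the other points. -/
def outLoop : Prog :=
  .seq (.seq (setRvar 15 (.lit 0)) (setNvar 18 (.lit 0))) (forLoop 10 inputN outStep)

theorem det_outLoop {D : ℕ → ℕ → ℝ} {v : ℕ → ℝ} (hc : Consts n Δ m) (hθ : m.real 10 0 0 = θ)
    (hv : ∀ i < n, Δ * Δ + 1 - m.real 3 i 1 = v i) :
    Det D outLoop m (n * 12 + 7) fun m' =>
      Frame [4, 10, 18] [15, 18] m m' ∧
      m'.real 15 0 0 = ∑ i ∈ Finset.range n, (if v i < 10 * θ then v i else 0) ∧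
      m'.nat 18 0 0 = ∑ i ∈ Finset.range n, (if v i < 10 * θ then 0 else 1) ∧
      ∀ i < n, m'.nat 4 0 i = if v i < 10 * θ then 0 else 1 := by
  have hs : (Prog.seq (setRvar 15 (.lit 0)) (setNvar 18 (.lit 0))).sem D m =
      (m.setReal 15 0 0 0).setNat 18 0 0 0 := by
    simp [Prog.sem, setRvar, setNvar, NExpr.eval, RExpr.eval]
  refine (Det.seq_sem (by exact ⟨trivial, trivial⟩) hs (Det.forLoop (n := n)
    (t := outStep.size) (t' := n * 12 + 3) (I := fun i m' => m'.nat 10 0 0 = i ∧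
      Frame [4, 10, 18] [15, 18] m m' ∧
      m'.real 15 0 0 = ∑ i ∈ Finset.range i, (if v i < 10 * θ then v i else 0) ∧
      m'.nat 18 0 0 = ∑ i ∈ Finset.range i, (if v i < 10 * θ then 0 else 1) ∧
      ∀ j < i, m'.nat 4 0 j = if v j < 10 * θ then 0 else 1)
      ?_ ?_ ?_ le_rfl)).conseq (by simp only [Prog.size, setNvar, setRvar]; omega) fun m' h => h.2
  · rintro i m' ⟨h1, h2, -⟩
    exact ⟨h1, (hc.frame h2 (by decide) (by decide)).card⟩
  · rintro i hi m₁ ⟨h1, h2, h3, h4, h5⟩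
    refine Det.of_sem (by exact ⟨trivial, ⟨trivial, trivial⟩, trivial, trivial⟩) le_rfl ?_
    have e10 : m₁.real 10 0 0 = θ := by rw [h2.2 10 (by decide), hθ]
    have e3 : Δ * Δ + 1 - m₁.real 3 i 1 = v i := by rw [h2.2 3 (by decide), hv i hi]
    have e13 := (hc.frame h2 (by decide) (by decide)).big
    have hs₁ : (setRvar 18 (.sub (rvar 13) (keyAt (.lit 1)))).sem D m₁ =
        m₁.setReal 18 0 0 (v i) := by
      rw [← e3, ← e13, ← h1]; rfl
    have hiff : (BExpr.realLT (rvar 18) (.mul (.lit 10) (rvar 10))).holds D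
        (m₁.setReal 18 0 0 (v i)) ↔ v i < 10 * θ := by
      simp [BExpr.holds, rvar, RExpr.eval, NExpr.eval, Mem.setReal, e10]
    rw [outStep, Prog.sem, hs₁, Prog.sem]
    have hj : ∀ j < i + 1, j ≠ i → m₁.nat 4 0 j = if v j < 10 * θ then 0 else 1 :=
      fun j hj hji => h5 j (by omega)
    by_cases hlt : v i < 10 * θ
    · rw [if_pos (hiff.2 hlt)]
      have hsem : (Prog.seq (setRvar 15 (.add (rvar 15) (rvar 18)))
          (.setNat 4 (.lit 0) (nvar 10) (.lit 0))).sem D (m₁.setReal 18 0 0 (v i)) =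
          ((m₁.setReal 18 0 0 (v i)).setReal 15 0 0 (m₁.real 15 0 0 + v i)).setNat 4 0 i 0 := by
        simp [Prog.sem, setRvar, nvar, rvar, NExpr.eval, RExpr.eval, Mem.setReal, h1]
      rw [hsem]
      refine ⟨by simpa [Mem.setNat, Mem.setReal] using h1, by simp [Mem.setNat], ?_, ?_, ?_,
        fun j hj' => ?_⟩
      · exact (((h2.setReal (by decide) _ _ _).setReal (by decide) _ _ _).setNat (by decide)
          _ _ _).setNat (by decide) _ _ _
      · rw [Finset.sum_range_succ, ← h3, if_pos hlt]
        simp [Mem.setReal, Mem.setNat]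
      · rw [Finset.sum_range_succ, ← h4, if_pos hlt]
        simp [Mem.setReal, Mem.setNat]
      · by_cases hji : j = i
        · rw [hji, if_pos hlt]; simp [Mem.setNat, Mem.setReal]
        · rw [← hj j hj' hji]; simp [Mem.setNat, Mem.setReal, hji]
    · rw [if_neg fun h => hlt (hiff.1 h)]
      have hsem : (Prog.seq (setNvar 18 (.add (nvar 18) (.lit 1)))
          (.setNat 4 (.lit 0) (nvar 10) (.lit 1))).sem D (m₁.setReal 18 0 0 (v i)) =
          ((m₁.setReal 18 0 0 (v i)).setNat 18 0 0 (m₁.nat 18 0 0 + 1)).setNat 4 0 i 1 := by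
        simp [Prog.sem, setNvar, nvar, NExpr.eval, Mem.setReal, Mem.setNat, h1]
        rfl
      rw [hsem]
      refine ⟨by simpa [Mem.setNat, Mem.setReal] using h1, by simp [Mem.setNat], ?_, ?_, ?_,
        fun j hj' => ?_⟩
      · exact (((h2.setReal (by decide) _ _ _).setNat (by decide) _ _ _).setNat (by decide)
          _ _ _).setNat (by decide) _ _ _
      · rw [Finset.sum_range_succ, ← h3, if_neg hlt]
        simp [Mem.setReal, Mem.setNat]
      · rw [Finset.sum_range_succ, ← h4, if_neg hlt]
        simp [Mem.setReal, Mem.setNat]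
      · by_cases hji : j = i
        · rw [hji, if_neg hlt]; simp [Mem.setNat, Mem.setReal]
        · rw [← hj j hj' hji]; simp [Mem.setNat, Mem.setReal, hji]
  · refine ⟨by simp [Mem.setNat], ?_, by simp [Mem.setReal, Mem.setNat],
      by simp [Mem.setReal, Mem.setNat], fun j hj => absurd hj (by omega)⟩
    exact (((Frame.refl _ _ m).setReal (by decide) _ _ _).setNat (by decide) _ _ _).setNat
      (by decide) _ _ _

theorem truncSq_eq_nearest (hX : SpreadBetween (Finset.univ.image x) Δ)
    (hC : C ⊆ Finset.univ.image x) (hne : C.Nonempty) {i : ℕ} (hi : i < n) :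
    truncSq (Δ * Δ + 1) (pt x i) C = dist (pt x i) (nearest C (pt x i)) ^ 2 := by
  rw [truncSq_eq_min_nearest hne, min_eq_right]
  have := hX.sq_le (pt_mem hi) (hC (nearest_mem hne (pt x i)))
  linarith [sq Δ]

theorem mem_outPts_iff {i : ℕ} (hε : 0 < ε) (hX : SpreadBetween (Finset.univ.image x) Δ)
    (hC : C ⊆ Finset.univ.image x) (hne : C.Nonempty) {j : ℕ} (hj : j < n) :
    pt x j ∈ outPts (10 * penalty z ε i) (Finset.univ.image x) C ↔
      ¬ truncSq (Δ * Δ + 1) (pt x j) C < 10 * realPenalty z ε Δ i := by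
  rw [outPts_penalty hε hX i hC hne, Finset.mem_filter, truncSq_eq_nearest hX hC hne hj, not_lt]
  exact and_iff_right (pt_mem hj)

theorem card_outPts {i : ℕ} (hε : 0 < ε) (hx : Function.Injective x)
    (hX : SpreadBetween (Finset.univ.image x) Δ) (hC : C ⊆ Finset.univ.image x)
    (hne : C.Nonempty) :
    (outPts (10 * penalty z ε i) (Finset.univ.image x) C).card =
    ∑ j ∈ Finset.range n,
      (if truncSq (Δ * Δ + 1) (pt x j) C < 10 * realPenalty z ε Δ i then 0 else 1) := by
  have h1 : (outPts (10 * penalty z ε i) (Finset.univ.image x) C).card =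
      ∑ y ∈ Finset.univ.image x,
        (if y ∈ outPts (10 * penalty z ε i) (Finset.univ.image x) C then 1 else 0) := by
    rw [Finset.sum_ite_mem, Finset.sum_const, smul_eq_mul, mul_one,
      Finset.inter_eq_right.2 (show outPts _ _ _ ⊆ _ from Finset.filter_subset _ _)]
  rw [h1, sum_image_pt hx]
  refine Finset.sum_congr rfl fun j hj => ?_
  have := mem_outPts_iff (z := z) (i := i) hε hX hC hne (Finset.mem_range.1 hj)
  by_cases h : truncSq (Δ * Δ + 1) (pt x j) C < 10 * realPenalty z ε Δ i
  · rw [if_pos h, if_neg fun h' => this.1 h' h]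
  · rw [if_neg h, if_pos (this.2 h)]

theorem phi_sdiff_outPts {i : ℕ} (hε : 0 < ε) (hx : Function.Injective x)
    (hX : SpreadBetween (Finset.univ.image x) Δ) (hC : C ⊆ Finset.univ.image x)
    (hne : C.Nonempty) :
    phi (Finset.univ.image x \ outPts (10 * penalty z ε i)
      (Finset.univ.image x) C) C =
    ENNReal.ofReal (∑ j ∈ Finset.range n, (if truncSq (Δ * Δ + 1) (pt x j) C <
      10 * realPenalty z ε Δ i then truncSq (Δ * Δ + 1) (pt x j) C else 0)) := by
  rw [phi_eq_ofReal_sum hne]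
  congr 1
  have h1 : ∑ y ∈ Finset.univ.image x \ outPts (10 * penalty z ε i) (Finset.univ.image x) C,
      dist y (nearest C y) ^ 2 = ∑ y ∈ Finset.univ.image x,
        (if y ∈ outPts (10 * penalty z ε i) (Finset.univ.image x) C then 0
          else dist y (nearest C y) ^ 2) := by
    rw [← Finset.filter_notMem_eq_sdiff, Finset.sum_filter]
    refine Finset.sum_congr rfl fun y _ => ?_
    by_cases h : y ∈ outPts (10 * penalty z ε i) (Finset.univ.image x) C <;> simp [h]
  rw [h1, sum_image_pt hx]
  refine Finset.sum_congr rfl fun j hj => ?_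
  have := mem_outPts_iff (z := z) (i := i) hε hX hC hne (Finset.mem_range.1 hj)
  rw [← truncSq_eq_nearest hX hC hne (Finset.mem_range.1 hj)]
  by_cases h : truncSq (Δ * Δ + 1) (pt x j) C < 10 * realPenalty z ε Δ i
  · rw [if_pos h, if_neg fun h' => this.1 h' h]
  · rw [if_neg h, if_pos (this.2 h)]

/-! #### The best solution -/

/-- The memory represents the best solution found so far. -/
structure BestRep (x : Fin n → Pt d) (best : Finset (Pt d) × Finset (Pt d)) (m : Mem) : Prop where
  subset_fst : best.1 ⊆ Finset.univ.image x
  subset_snd : best.2 ⊆ Finset.univ.image x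
  flag_fst : ∀ y < n, m.nat 1 0 y = 1 ↔ pt x y ∈ best.1
  flag_snd : ∀ y < n, m.nat 1 1 y = 1 ↔ pt x y ∈ best.2
  cost : (m.nat 19 0 0 = 0 ∧ best = (∅, ∅)) ∨ (m.nat 19 0 0 = 1 ∧
    phi (Finset.univ.image x \ best.2) best.1 = ENNReal.ofReal (m.real 16 0 0))

theorem BestRep.frame {W V : List ℕ} {m' : Mem} (h : BestRep x best m) (hf : Frame W V m m')
    (hW : 1 ∉ W) (hW' : 19 ∉ W) (hV : 16 ∉ V) : BestRep x best m' :=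
  ⟨h.subset_fst, h.subset_snd, by rw [hf.1 1 hW]; exact h.flag_fst,
    by rw [hf.1 1 hW]; exact h.flag_snd, by rw [hf.1 19 hW', hf.2 16 hV]; exact h.cost⟩

/-- Copy the current centers and outliers to the output. -/
def copyStep : Prog :=
  .seq (.setNat 1 (.lit 0) (nvar 10) (flagAt (nvar 10)))
    (.setNat 1 (.lit 1) (nvar 10) (.load 4 (.lit 0) (nvar 10)))

/-- The test for an improvement of the best solution. -/
def improves : BExpr :=
  .and (.not (.realLT (.mul (.add (.lit 1) (.load 0 (.lit 0) (.lit 0)))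
      (.ofNat (.load 0 (.lit 0) (.lit 2)))) (.ofNat (nvar 18))))
    (.not (.and (.natLT (.lit 0) (nvar 19)) (.not (.realLT (rvar 15) (rvar 16)))))

/-- Update the best solution. -/
def keepStep : Prog :=
  .ite improves (.seq (.seq (setNvar 19 (.lit 1)) (setRvar 16 (rvar 15)))
    (forLoop 10 inputN copyStep)) .skip

theorem det_copyLoop {D : ℕ → ℕ → ℝ} (hn : m.nat 0 0 0 = n) :
    Det D (forLoop 10 inputN copyStep) m (n * 6 + 3) fun m' => Frame [1, 10] [] m m' ∧
      ∀ y < n, m'.nat 1 0 y = m.nat 2 0 y ∧ m'.nat 1 1 y = m.nat 4 0 y := by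
  refine (Det.forLoop (n := n) (t := 3) (t' := n * 6 + 3)
    (I := fun i m' => m'.nat 10 0 0 = i ∧ Frame [1, 10] [] m m' ∧
      ∀ y < i, m'.nat 1 0 y = m.nat 2 0 y ∧ m'.nat 1 1 y = m.nat 4 0 y)
    ?_ ?_ ?_ le_rfl).conseq le_rfl fun m' h => h.2
  · rintro i m' ⟨h1, h2, -⟩
    refine ⟨h1, ?_⟩
    rw [← hn, ← h2.1 0 (by decide)]
    rfl
  · rintro i hi m₁ ⟨h1, h2, h3⟩
    refine Det.of_sem (by exact ⟨trivial, trivial⟩) le_rfl ?_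
    have hs : copyStep.sem D m₁ = (m₁.setNat 1 0 i (m.nat 2 0 i)).setNat 1 1 i (m.nat 4 0 i) := by
      rw [← h2.1 2 (by decide), ← h2.1 4 (by decide)]
      simp [copyStep, Prog.sem, NExpr.eval, nvar, flagAt, Mem.setNat, h1]
    rw [hs]
    refine ⟨by simpa [Mem.setNat] using h1, by simp [Mem.setNat], ((h2.setNat (by decide) _ _
      _).setNat (by decide) _ _ _).setNat (by decide) _ _ _, fun y hy => ?_⟩
    by_cases hyi : y = i
    · simp [hyi, Mem.setNat]
    · simp [hyi, Mem.setNat, h3 y (by omega)]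
  · exact ⟨by simp [Mem.setNat], (Frame.refl _ _ m).setNat (by decide) _ _ _,
      fun y hy => absurd hy (by omega)⟩

theorem phi_empty_right (hn : 0 < n) : phi (Finset.univ.image x) ∅ = ∞ := by
  rw [phi, ENNReal.sum_eq_top]
  exact ⟨pt x 0, pt_mem hn, by simp [phiPt]⟩

/-- The initial cost `∞` is not a real number. Integer scalar 19 records whether a solution has been
stored, and while it is 0 the comparison of costs is skipped. -/
theorem det_keepStep {D : ℕ → ℕ → ℝ} {Θ : ℝ≥0∞} (hn : 0 < n) (hs : Setup n k z N ε Δ m)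
    (hr : Represents x Δ C m) (hb : BestRep x best m)
    (hout : ∀ y < n, m.nat 4 0 y = 1 ↔ pt x y ∈ outPts (10 * Θ) (Finset.univ.image x) C)
    (hcard : m.nat 18 0 0 = (outPts (10 * Θ) (Finset.univ.image x) C).card)
    (hcost : 0 ≤ m.real 15 0 0)
    (hphi : phi (Finset.univ.image x \ outPts (10 * Θ) (Finset.univ.image x) C) C =
      ENNReal.ofReal (m.real 15 0 0)) :
    Det D keepStep m (n * 6 + 8) fun m' =>
      BestRep x (keepBest (Finset.univ.image x) z ε Θ C best) m' ∧ Frame [1, 10, 19] [16] m m' := by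
  have hiff : improves.holds D m ↔ ((outPts (10 * Θ) (Finset.univ.image x) C).card : ℝ) ≤ (1 + ε) * z ∧
      phi (Finset.univ.image x \ outPts (10 * Θ) (Finset.univ.image x) C) C <
        phi (Finset.univ.image x \ best.2) best.1 := by
    have h1 : improves.holds D m ↔ ((m.nat 18 0 0 : ℝ) ≤ (1 + ε) * z ∧
        ¬ (0 < m.nat 19 0 0 ∧ ¬ m.real 15 0 0 < m.real 16 0 0)) := by
      simp [improves, BExpr.holds, RExpr.eval, NExpr.eval, nvar, rvar, hs.nat, hs.real, inputMem]
    rw [h1, hcard, hphi]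
    refine and_congr_right fun _ => ?_
    rcases hb.cost with ⟨h2, rfl⟩ | ⟨h2, h3⟩
    · simp [h2, phi_empty_right hn]
    · rw [h3, ENNReal.ofReal_lt_ofReal_iff_of_nonneg hcost]
      simp [h2]
  refine (Det.ite (t := n * 6 + 7) (fun hc => ?_) fun hc => ?_).conseq le_rfl fun _ h => h
  · have hs₁ : (Prog.seq (setNvar 19 (.lit 1)) (setRvar 16 (rvar 15))).sem D m =
        (m.setNat 19 0 0 1).setReal 16 0 0 (m.real 15 0 0) := by
      simp [Prog.sem, setNvar, setRvar, rvar, NExpr.eval, RExpr.eval, Mem.setNat]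
      rfl
    have hf₁ : Frame [19] [16] m ((m.setNat 19 0 0 1).setReal 16 0 0 (m.real 15 0 0)) :=
      ((Frame.refl _ _ m).setNat (by decide) _ _ _).setReal (by decide) _ _ _
    refine (Det.seq_sem (by exact ⟨trivial, trivial⟩) hs₁ (det_copyLoop
      (hs.frame hf₁ (by decide) (by decide) (by decide)).consts.card)).conseq
      (by simp only [Prog.size, setNvar, setRvar]; omega) ?_
    rintro m' ⟨h1, h2⟩
    rw [keepBest, if_pos (hiff.1 hc)]
    refine ⟨⟨hr.subset, Finset.filter_subset _ _, fun y hy => ?_, fun y hy => ?_, Or.inr ⟨?_, ?_⟩⟩,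
      hf₁.trans h1 _ _ (by simp) (by simp) (by simp) (by simp)⟩
    · rw [(h2 y hy).1, hf₁.1 2 (by decide), hr.flag y hy]
      simp
    · rw [(h2 y hy).2, hf₁.1 4 (by decide)]
      exact hout y hy
    · rw [h1.1 19 (by decide)]; simp [Mem.setNat, Mem.setReal]
    · rw [h1.2 16 (by decide), hphi]; simp [Mem.setReal]
  · refine Det.of_sem (by exact trivial) (by simp [Prog.size]) ?_
    rw [keepBest, if_neg fun h => hc (hiff.2 h)]
    exact ⟨hb, Frame.refl _ _ _⟩

/-! #### The local search step -/

/-- One local search step. -/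
def searchStep : Prog := .seq drawAndAdd (.seq deleteCheapest (.seq outLoop keepStep))

/-- The arrays of natural numbers that a round changes. -/
def roundNat : List ℕ := [1, 2, 3, 4, 10, 11, 12, 14, 15, 17, 18, 19]

/-- The arrays of real numbers that the steps of a round change. -/
def stepReal : List ℕ := [2, 3, 4, 12, 14, 15, 16, 18, 19, 20]

theorem wp_searchStep (hε : 0 < ε) (hx : Function.Injective x)
    (hX : SpreadBetween (Finset.univ.image x) Δ) {L i : ℕ} (hL : n ≤ 2 ^ L)
    (hs : Setup n k z N ε Δ m) (hθ : m.real 10 0 0 = realPenalty z ε Δ i)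
    (hr : Represents x Δ C m) (hb : BestRep x best m) (hne : C.Nonempty) (hcard : C.card < n) :
    Wp (sqDistOracle x) searchStep m (n * (40 * L + 117) + 59)
      ((localSearchStep (indexRule x) (Finset.univ.image x) (penalty z ε i) C).map fun C' =>
        (C', keepBest (Finset.univ.image x) z ε (penalty z ε i) C' best))
      fun s m' => Represents x Δ s.1 m' ∧ BestRep x s.2 m' ∧ s.1.card = C.card ∧
        m'.nat 15 = m.nat 15 ∧ Frame roundNat stepReal m m' := by
  have hΘ := penaltyEquiv_penalty (z := z) hε hX i
  have hXc : (Finset.univ.image x).card = n := by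
    rw [Finset.card_image_of_injective _ hx]; simp
  rw [localSearchStep_eq hΘ _ hr.subset hne]
  refine Wp.map (Wp.map ?_)
  refine (Wp.seq_det (t' := n * (30 * L + 87) + 36)
    (wp_drawAndAdd hx hX hΘ.1 hcard hL hs.consts hr hθ) fun c hc m₁ hm₁ => ?_).conseq
    (by ring_nf; omega) fun _ _ _ h => h
  obtain ⟨hr₁, hf₁⟩ := hm₁
  have hcC : c ∉ C := (mem_support_sampleTrunc hΘ.1 (by rw [hXc]; exact hcard) hc).2
  have hcard₁ : (insert c C).card = C.card + 1 := Finset.card_insert_of_notMem hcC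
  have hpos := hne.card_pos
  have hs₁ := hs.frame hf₁ (by decide) (by decide) (by decide)
  have hθ₁ : m₁.real 10 0 0 = realPenalty z ε Δ i := by rw [hf₁.2 10 (by decide), hθ]
  refine (Det.seq (t' := n * 18 + 16) (det_deleteCheapest hx hX hL hΘ hs₁.consts hθ₁ hr₁ (by omega))
    fun m₂ hm₂ => ?_).conseq (by ring_nf; omega) fun _ h => h
  obtain ⟨hr₂, hf₂⟩ := hm₂
  obtain ⟨C', hC'⟩ : ∃ C', C' = (insert c C).erase ((indexRule x).pick (insert c C) fun e =>
    tau (penalty z ε i) (Finset.univ.image x) ((insert c C).erase e)) := ⟨_, rfl⟩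
  rw [← hC'] at hr₂ ⊢
  have hcard' : C'.card = C.card := by
    rw [hC', Finset.card_erase_of_mem ((indexRule x).pick_mem _ _ (Finset.insert_nonempty _ _)),
      hcard₁, Nat.add_sub_cancel]
  have hne' : C'.Nonempty := Finset.card_pos.1 (by omega)
  have hs₂ := hs₁.frame hf₂ (by decide) (by decide) (by decide)
  have hθ₂ : m₂.real 10 0 0 = realPenalty z ε Δ i := by rw [hf₂.2 10 (by decide), hθ₁]
  have hf₁₂ : Frame [2, 3, 10, 11, 12, 14, 17] [2, 3, 4, 12, 14, 18, 19, 20] m m₂ :=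
    hf₁.trans hf₂ _ _ (by simp) (by simp) (by simp) (by simp)
  refine (Det.seq (t' := n * 6 + 8) (det_outLoop hs₂.consts hθ₂
    fun j hj => (hr₂.forest j hj).root_eq hj hX hr₂.subset) fun m₃ hm₃ => ?_).conseq
    (by ring_nf; omega) fun _ h => h
  obtain ⟨hf₃, h15, h18, h4⟩ := hm₃
  have hf₁₃ : Frame [2, 3, 4, 10, 11, 12, 14, 17, 18] [2, 3, 4, 12, 14, 15, 18, 19, 20] m m₃ :=
    hf₁₂.trans hf₃ _ _ (by simp) (by simp) (by simp) (by simp)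
  refine (det_keepStep (Θ := penalty z ε i) (C := C') (best := best) (by omega)
    (hs₂.frame hf₃ (by decide) (by decide) (by decide))
    (hr₂.frame hf₃ (by decide) (by decide) (by decide))
    (hb.frame hf₁₃ (by decide) (by decide) (by decide)) (fun y hy => ?_) ?_ ?_ ?_).conseq le_rfl ?_
  · rw [h4 y hy, mem_outPts_iff hε hX hr₂.subset hne' hy]
    split_ifs with h <;> simp [h]
  · rw [h18, card_outPts hε hx hX hr₂.subset hne']
  · rw [h15]
    refine Finset.sum_nonneg fun j _ => ?_
    split_ifs
    · exact truncSq_nonneg (by nlinarith [mul_self_nonneg Δ])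
    · exact le_rfl
  · rw [h15, phi_sdiff_outPts hε hx hX hr₂.subset hne']
  · rintro m₄ ⟨hb₄, hf₄⟩
    refine ⟨(hr₂.frame hf₃ (by decide) (by decide) (by decide)).frame hf₄ (by decide) (by decide)
      (by decide), hb₄, hcard', ?_, ?_⟩
    · rw [hf₄.1 15 (by decide), hf₁₃.1 15 (by decide)]
    · exact hf₁₃.trans hf₄ _ _ (by simp [roundNat]) (by simp [roundNat]) (by simp [stepReal])
        (by simp [stepReal])

end Best

/-! ### Seeding, rounds and the whole program -/

section Rounds

variable {d n k z N : ℕ} {x : Fin n → Pt d} {ε Δ θ : ℝ} {C : Finset (Pt d)} {m : Mem}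
  {best : Finset (Pt d) × Finset (Pt d)}

/-- The number of centers. -/
def inputK : NExpr := .load 0 (.lit 0) (.lit 1)

/-- The number of local search steps in each round. -/
def inputSteps : NExpr := .load 0 (.lit 0) (.lit 3)

theorem Setup.evalK (h : Setup n k z N ε Δ m) : inputK.eval m = k := by
  change m.nat 0 0 1 = k
  rw [h.nat]; simp [inputMem]

theorem Setup.evalSteps (h : Setup n k z N ε Δ m) : inputSteps.eval m = N := by
  change m.nat 0 0 3 = N
  rw [h.nat]; simp [inputMem]

/-! #### The seeding -/

/-- Delete a center, if there is one. -/
def clearStep : Prog :=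
  .ite (.realLT (.lit 0) (.load 3 (.lit 0) (.lit 1)))
    (.seq (setNvar 12 (.load 3 (.lit 0) (.lit 1))) removeCenter) .skip

/-- The tree of point 0 tells whether there is a center: its root key is positive exactly then, and
its argument is a center. -/
theorem det_clearStep (hx : Function.Injective x) (hX : SpreadBetween (Finset.univ.image x) Δ)
    (hn : 0 < n) {L : ℕ} (hL : n ≤ 2 ^ L) (hc : Consts n Δ m) (hr : Represents x Δ C m) :
    Det (sqDistOracle x) clearStep m (n * (10 * L + 12) + 8) fun m' =>
      ∃ C' : Finset (Pt d), Represents x Δ C' m' ∧ C'.card ≤ C.card - 1 ∧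
        Frame [2, 3, 10, 11, 12] [3, 14] m m' := by
  have hiff : (BExpr.realLT (.lit 0) (.load 3 (.lit 0) (.lit 1))).holds (sqDistOracle x) m ↔
      0 < m.real 3 0 1 := by simp [BExpr.holds, RExpr.eval, NExpr.eval]
  rcases C.eq_empty_or_nonempty with rfl | hne
  · have h0 : m.real 3 0 1 = 0 := (hr.forest 0 hn).root_of_empty hn (by simp [idx])
    refine (Det.ite (t := n * (10 * L + 12) + 7) (fun h => absurd (hiff.1 h) (by simp [h0]))
      fun _ => Det.of_sem (by exact trivial) (by simp [Prog.size]) ?_).conseq le_rfl fun _ h => h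
    exact ⟨∅, hr, by simp, Frame.refl _ _ _⟩
  · obtain ⟨hyn, hyC, hdist, hkey⟩ := (hr.forest 0 hn).nearest_spec hn hX hr.subset hne
    have hpos : 0 < m.real 3 0 1 := by
      have := hX.sq_le (pt_mem hn) (pt_mem (x := x) hyn)
      rw [← hdist, ← hkey] at this
      linarith [sq Δ]
    have hs : (setNvar 12 (.load 3 (.lit 0) (.lit 1))).sem (sqDistOracle x) m =
        m.setNat 12 0 0 (m.nat 3 0 1) := by simp [setNvar, Prog.sem, NExpr.eval]
    have hf : Frame [12] [] m (m.setNat 12 0 0 (m.nat 3 0 1)) :=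
      (Frame.refl _ _ m).setNat (by decide) _ _ _
    refine (Det.ite (t := n * (10 * L + 12) + 7) (fun _ => ?_) fun h => absurd (hiff.2 hpos) h).conseq
      le_rfl fun _ h => h
    refine (Det.seq_sem (by exact trivial) hs (det_removeCenter hx (L := L)
      (hc.frame hf (by decide) (by decide)) hL (hr.frame hf (by decide) (by decide) (by decide)) hyn
      (by simp [Mem.setNat]))).conseq (by simp only [Prog.size, setNvar]; omega) ?_
    rintro m' ⟨h1, h2⟩
    exact ⟨_, h1, by rw [Finset.card_erase_of_mem hyC],
      hf.trans h2 _ _ (by simp) (by simp) (by simp) (by simp)⟩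

/-- The centers of the previous round are removed by k deletions; rewriting all the trees would take
time quadratic in n. -/
theorem det_clearLoop (hx : Function.Injective x) (hX : SpreadBetween (Finset.univ.image x) Δ)
    (hn : 0 < n) {L : ℕ} (hL : n ≤ 2 ^ L) (hs : Setup n k z N ε Δ m) (hr : Represents x Δ C m)
    (hC : C.card ≤ k) :
    Det (sqDistOracle x) (forLoop 15 inputK clearStep) m (k * (n * (10 * L + 12) + 11) + 3)
      fun m' => Represents x Δ ∅ m' ∧ Frame [2, 3, 10, 11, 12, 15] [3, 14] m m' := by
  refine (Det.forLoop (n := k) (t := n * (10 * L + 12) + 8)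
    (I := fun i m' => m'.nat 15 0 0 = i ∧ Frame [2, 3, 10, 11, 12, 15] [3, 14] m m' ∧
      ∃ C' : Finset (Pt d), Represents x Δ C' m' ∧ C'.card ≤ k - i)
    ?_ ?_ ?_ le_rfl).conseq le_rfl ?_
  · rintro i m' ⟨h1, h2, -⟩
    exact ⟨h1, (hs.frame h2 (by decide) (by decide) (by decide)).evalK⟩
  · rintro i hi m₁ ⟨h1, h2, C', hr', hC'⟩
    refine (det_clearStep hx hX hn hL (hs.consts.frame h2 (by decide) (by decide)) hr').conseq
      le_rfl ?_
    rintro m₂ ⟨C'', hr'', hC'', hf⟩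
    refine ⟨by rw [hf.1 15 (by decide), h1], by simp [Mem.setNat],
      (h2.trans hf _ _ (List.Subset.refl _) (by simp) (by simp) (by simp)).setNat (by decide) _ _ _,
      C'', ?_, by omega⟩
    exact hr''.frame ((Frame.refl [15] [] m₂).setNat (by decide) 0 0 (i + 1)) (by decide) (by decide)
      (by decide)
  · have hf : Frame [15] [] m (m.setNat 15 0 0 0) := (Frame.refl _ _ m).setNat (by decide) _ _ _
    exact ⟨by simp [Mem.setNat], hf.trans (Frame.refl [] [] _) _ _ (by simp) (by simp) (by simp)
      (by simp), C, hr.frame hf (by decide) (by decide) (by decide), by simpa using hC⟩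
  · rintro m' ⟨-, h1, C', h2, h3⟩
    rw [Nat.sub_self, Nat.le_zero, Finset.card_eq_zero] at h3
    subst h3
    exact ⟨h2, h1⟩

theorem kmeansPP_eq_iterLaw {X : Finset (Pt d)} {Θ : ℝ≥0∞} (h : PenaltyEquiv X Θ θ)
    (hX : X.Nonempty) {ℓ : ℕ} (hℓ : ℓ ≤ X.card) :
    kmeansPP X Θ ℓ =
      iterLaw (fun _ C => (sampleTrunc X θ C).map fun c => insert c C) ℓ ∅ := by
  induction ℓ with
  | zero => rfl
  | succ ℓ ih => rw [kmeansPP_succ h hX (by omega), ih (by omega)]; rfl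

theorem wp_seedLoop (hx : Function.Injective x) (hX : SpreadBetween (Finset.univ.image x) Δ)
    (hkn : k < n) {L : ℕ} (hL : n ≤ 2 ^ L) {Θ : ℝ≥0∞}
    (hΘ : PenaltyEquiv (Finset.univ.image x) Θ θ) (hs : Setup n k z N ε Δ m)
    (hθ : m.real 10 0 0 = θ) (hr : Represents x Δ ∅ m) :
    Wp (sqDistOracle x) (forLoop 15 inputK drawAndAdd) m (k * (n * (10 * L + 30) + 25) + 3)
      (kmeansPP (Finset.univ.image x) Θ k) fun C m' => Represents x Δ C m' ∧ C.card = k ∧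
        Frame [2, 3, 10, 11, 12, 14, 15] [2, 3, 12, 14, 18] m m' := by
  have hXc : (Finset.univ.image x).card = n := by
    rw [Finset.card_image_of_injective _ hx]; simp
  have hne : (Finset.univ.image x).Nonempty := ⟨_, pt_mem (show 0 < n by omega)⟩
  -- The loop only needs that at most i centers have been drawn; that there are exactly k at the end
  -- is read off from the support of `kmeansPP`.
  suffices h : Wp (sqDistOracle x) (forLoop 15 inputK drawAndAdd) m
      (k * (n * (10 * L + 30) + 25) + 3) (kmeansPP (Finset.univ.image x) Θ k)
      fun C m' => (m'.nat 15 0 0 = k ∧ C.card ≤ k) ∧ Represents x Δ C m' ∧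
        Frame [2, 3, 10, 11, 12, 14, 15] [2, 3, 12, 14, 18] m m' by
    refine h.conseq le_rfl ?_
    rintro C hC m' ⟨-, h1, h2⟩
    exact ⟨h1, (kmeansPP_support hΘ (by omega) hC).2, h2⟩
  rw [kmeansPP_eq_iterLaw hΘ hne (by omega)]
  refine (Wp.forLoop (n := k) (t := n * (10 * L + 30) + 22)
    (I := fun i C m' => (m'.nat 15 0 0 = i ∧ C.card ≤ i) ∧ Represents x Δ C m' ∧
      Frame [2, 3, 10, 11, 12, 14, 15] [2, 3, 12, 14, 18] m m') ?_ ?_ ?_ le_rfl)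
  · rintro i C m' ⟨⟨h1, -⟩, -, h2⟩
    exact ⟨h1, (hs.frame h2 (by decide) (by decide) (by decide)).evalK⟩
  · rintro i hi C m₁ ⟨⟨h1, h2⟩, h3, h4⟩
    refine Wp.map ((wp_drawAndAdd hx hX hΘ.1 (by omega) hL
      (hs.consts.frame h4 (by decide) (by decide)) h3
      (by rw [h4.2 10 (by decide), hθ])).conseq le_rfl ?_)
    rintro c - m₂ ⟨h5, h6⟩
    refine ⟨by rw [h6.1 15 (by decide), h1], ⟨by simp [Mem.setNat],
      (Finset.card_insert_le _ _).trans (by omega)⟩, ?_,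
      (h4.trans h6 _ _ (List.Subset.refl _) (by simp) (by simp) (by simp)).setNat (by decide) _ _ _⟩
    exact h5.frame ((Frame.refl [15] [] m₂).setNat (by decide) 0 0 (i + 1)) (by decide) (by decide)
      (by decide)
  · have hf : Frame [15] [] m (m.setNat 15 0 0 0) := (Frame.refl _ _ m).setNat (by decide) _ _ _
    exact ⟨⟨by simp [Mem.setNat], by simp⟩, hr.frame hf (by decide) (by decide) (by decide),
      hf.trans (Frame.refl [] [] _) _ _ (by simp) (by simp) (by simp) (by simp)⟩

/-! #### The rounds -/

theorem innerLoop_eq_iterLaw (am : ArgminRule (Pt d)) (X : Finset (Pt d)) (Θ : ℝ≥0∞) (N : ℕ)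
    (s : Finset (Pt d) × (Finset (Pt d) × Finset (Pt d))) :
    innerLoop am X z ε Θ N s = iterLaw (fun _ s' =>
      (localSearchStep am X Θ s'.1).map fun C => (C, keepBest X z ε Θ C s'.2)) N s := by
  induction N with
  | zero => rfl
  | succ N ih => rw [innerLoop, ih]; rfl

theorem wp_searchLoop (hε : 0 < ε) (hx : Function.Injective x)
    (hX : SpreadBetween (Finset.univ.image x) Δ) (hk : 1 ≤ k) (hkn : k < n) {L i : ℕ}
    (hL : n ≤ 2 ^ L) (hs : Setup n k z N ε Δ m) (hθ : m.real 10 0 0 = realPenalty z ε Δ i)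
    (hr : Represents x Δ C m) (hb : BestRep x best m) (hC : C.card = k) :
    Wp (sqDistOracle x) (forLoop 15 inputSteps searchStep) m (N * (n * (40 * L + 117) + 62) + 3)
      (innerLoop (indexRule x) (Finset.univ.image x) z ε (penalty z ε i) N (C, best))
      fun s m' => Represents x Δ s.1 m' ∧ BestRep x s.2 m' ∧ s.1.card = k ∧
        Frame roundNat stepReal m m' := by
  rw [innerLoop_eq_iterLaw]
  refine (Wp.forLoop (n := N) (t := n * (40 * L + 117) + 59)
    (I := fun i s m' => m'.nat 15 0 0 = i ∧ Represents x Δ s.1 m' ∧ BestRep x s.2 m' ∧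
      s.1.card = k ∧ Frame roundNat stepReal m m') ?_ ?_ ?_ le_rfl).conseq le_rfl
      fun _ _ _ h => h.2
  · rintro i s m' ⟨h1, -, -, -, h2⟩
    exact ⟨h1, (hs.frame h2 (by decide) (by decide) (by decide)).evalSteps⟩
  · rintro i hi ⟨C', best'⟩ m₁ ⟨h1, h2, h3, h4, h5⟩
    dsimp only at h2 h3 h4
    refine (wp_searchStep hε hx hX hL (hs.frame h5 (by decide) (by decide) (by decide))
      (by rw [h5.2 10 (by decide), hθ]) h2 h3 (Finset.card_pos.1 (by omega)) (by omega)).conseq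
      le_rfl ?_
    rintro ⟨C'', best''⟩ - m₂ ⟨h6, h7, h8, h9, h10⟩
    have hf := (Frame.refl [15] [] m₂).setNat (List.mem_singleton_self _) 0 0 (i + 1)
    exact ⟨by rw [h9, h1], by simp [Mem.setNat], h6.frame hf (by decide) (by decide) (by decide),
      h7.frame hf (by decide) (by decide) (by decide), h8.trans h4,
      (h5.trans h10 _ _ (List.Subset.refl _) (List.Subset.refl _) (List.Subset.refl _)
        (List.Subset.refl _)).setNat (by decide) _ _ _⟩
  · have hf : Frame [15] [] m (m.setNat 15 0 0 0) := (Frame.refl _ _ m).setNat (by decide) _ _ _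
    exact ⟨by simp [Mem.setNat], hr.frame hf (by decide) (by decide) (by decide),
      hb.frame hf (by decide) (by decide) (by decide), hC,
      hf.trans (Frame.refl [] [] _) _ _ (by simp [roundNat]) (by simp) (by simp) (by simp)⟩

/-- Double the guess (real scalar `11`) and set the penalty (real scalar `10`). -/
def setPenalty : Prog :=
  .seq (setRvar 11 (.add (rvar 11) (rvar 11)))
    (.ite (.natLT (.lit 0) (.load 0 (.lit 0) (.lit 2)))
      (setRvar 10 (.div (.mul (.div (.lit 300) (.load 0 (.lit 0) (.lit 0))) (rvar 11))
        (.ofNat (.load 0 (.lit 0) (.lit 2)))))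
      (setRvar 10 (rvar 13)))

/-- One round. -/
def guessStep : Prog :=
  .seq setPenalty (.seq (forLoop 15 inputK clearStep)
    (.seq (forLoop 15 inputK drawAndAdd) (forLoop 15 inputSteps searchStep)))

theorem sem_setPenalty {D : ℕ → ℕ → ℝ} {i : ℕ} (hs : Setup n k z N ε Δ m)
    (h11 : m.real 11 0 0 = 2 ^ i / 2) :
    setPenalty.sem D m = (m.setReal 11 0 0 (2 ^ i)).setReal 10 0 0 (realPenalty z ε Δ i) := by
  have hs₁ : (setRvar 11 (.add (rvar 11) (rvar 11))).sem D m = m.setReal 11 0 0 (2 ^ i) := by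
    simp [setRvar, rvar, Prog.sem, RExpr.eval, NExpr.eval, h11]
  have hz : m.nat 0 0 2 = z := by rw [hs.nat]; simp [inputMem]
  have he : m.real 0 0 0 = ε := by rw [hs.real]; simp [inputMem]
  rw [setPenalty, Prog.sem, hs₁, Prog.sem]
  by_cases h0 : z = 0
  · rw [if_neg (by simp [BExpr.holds, NExpr.eval, Mem.setReal, hz, h0]), realPenalty, if_pos h0]
    simp [Prog.sem, setRvar, rvar, RExpr.eval, NExpr.eval, Mem.setReal, hs.big, sq]
  · rw [if_pos (by simpa [BExpr.holds, NExpr.eval, Mem.setReal, hz] using Nat.pos_of_ne_zero h0),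
      realPenalty, if_neg h0]
    simp [Prog.sem, setRvar, rvar, RExpr.eval, NExpr.eval, Mem.setReal, hz, he]

/-- The memory at the start of the round `i`. -/
structure RoundStart (x : Fin n → Pt d) (k z N : ℕ) (ε Δ : ℝ) (i : ℕ)
    (best : Finset (Pt d) × Finset (Pt d)) (m : Mem) : Prop where
  setup : Setup n k z N ε Δ m
  guess : m.real 11 0 0 = 2 ^ i / 2
  bound : m.real 17 0 0 = n * Δ ^ 2
  best : BestRep x best m
  centers : ∃ C : Finset (Pt d), Represents x Δ C m ∧ C.card ≤ k

theorem wp_guessStep (hε : 0 < ε) (hx : Function.Injective x)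
    (hX : SpreadBetween (Finset.univ.image x) Δ) (hk : 1 ≤ k) (hkn : k < n) {L i : ℕ}
    (hL : n ≤ 2 ^ L) (h : RoundStart x k z N ε Δ i best m) :
    Wp (sqDistOracle x) guessStep m ((k + N) * (n * (40 * L + 117) + 62) + 17)
      (guessRound (indexRule x) (Finset.univ.image x) k z ε N i best)
      (RoundStart x k z N ε Δ (i + 1)) := by
  have hΘ := penaltyEquiv_penalty (z := z) hε hX i
  obtain ⟨C, hr, hC⟩ := h.centers
  have hle : k * (n * (10 * L + 12) + 11) + k * (n * (10 * L + 30) + 25) ≤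
      k * (n * (40 * L + 117) + 62) := by
    rw [← Nat.mul_add]
    refine Nat.mul_le_mul_left k ?_
    have : n * (10 * L + 12) + n * (10 * L + 30) ≤ n * (40 * L + 117) := by
      rw [← Nat.mul_add]; exact Nat.mul_le_mul_left n (by omega)
    omega
  obtain ⟨m₁, hm₁⟩ : ∃ m₁, m₁ = (m.setReal 11 0 0 (2 ^ i)).setReal 10 0 0 (realPenalty z ε Δ i) :=
    ⟨_, rfl⟩
  have hf₁ : Frame [] [10, 11] m m₁ := by
    rw [hm₁]
    exact ((Frame.refl _ _ m).setReal (by decide) _ _ _).setReal (by decide) _ _ _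
  have h10₁ : m₁.real 10 0 0 = realPenalty z ε Δ i := by simp [hm₁, Mem.setReal]
  have h11₁ : m₁.real 11 0 0 = 2 ^ i := by simp [hm₁, Mem.setReal]
  have hs₁ := h.setup.frame hf₁ (by decide) (by decide) (by decide)
  refine (Det.seq_wp (det_sem setPenalty (by exact ⟨trivial, trivial, trivial⟩) m)
    (fun m' hm' => ?_) (t' := k * (n * (10 * L + 12) + 11) + k * (n * (10 * L + 30) + 25) +
      N * (n * (40 * L + 117) + 62) + 11)).conseq
    (by rw [Nat.add_mul]; simp only [setPenalty, Prog.size, setRvar]; omega) fun _ _ _ h => h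
  rw [sem_setPenalty h.setup h.guess, ← hm₁] at hm'
  rw [hm']
  refine (Det.seq_wp (t' := k * (n * (10 * L + 30) + 25) + N * (n * (40 * L + 117) + 62) + 7)
    (det_clearLoop hx hX (by omega) hL hs₁ (hr.frame hf₁ (by decide) (by decide) (by decide)) hC)
    fun m₂ hm₂ => ?_).conseq (by omega) fun _ _ _ h => h
  obtain ⟨hr₂, hf₂⟩ := hm₂
  have hs₂ := hs₁.frame hf₂ (by decide) (by decide) (by decide)
  refine (Wp.seq (t' := N * (n * (40 * L + 117) + 62) + 3)
    (wp_seedLoop hx hX hkn hL hΘ hs₂ (by rw [hf₂.2 10 (by decide), h10₁]) hr₂)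
    fun C₃ _ m₃ hm₃ => ?_).conseq (by omega) fun _ _ _ h => h
  obtain ⟨hr₃, hC₃, hf₃⟩ := hm₃
  have hf₁₃ : Frame [2, 3, 10, 11, 12, 14, 15] [2, 3, 12, 14, 18] m₁ m₃ :=
    hf₂.trans hf₃ _ _ (by simp) (by simp) (by simp) (by simp)
  have hf₀₃ : Frame [2, 3, 10, 11, 12, 14, 15] [2, 3, 10, 11, 12, 14, 18] m m₃ :=
    hf₁.trans hf₁₃ _ _ (by simp) (by simp) (by simp) (by simp)
  refine Wp.map ((wp_searchLoop hε hx hX hk hkn hL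
    (hs₂.frame hf₃ (by decide) (by decide) (by decide)) (by rw [hf₁₃.2 10 (by decide), h10₁]) hr₃
    (h.best.frame hf₀₃ (by decide) (by decide) (by decide)) hC₃).conseq le_rfl ?_)
  rintro s - m₄ ⟨hr₄, hb₄, hC₄, hf₄⟩
  have hf₀₄ : Frame roundNat (10 :: 11 :: stepReal) m m₄ :=
    hf₀₃.trans hf₄ _ _ (by simp [roundNat]) (by simp) (by simp [stepReal])
      fun a ha => List.mem_cons_of_mem _ (List.mem_cons_of_mem _ ha)
  refine ⟨h.setup.frame hf₀₄ (by decide) (by decide) (by decide), ?_, ?_, hb₄, s.1, hr₄, hC₄.le⟩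
  · rw [hf₄.2 11 (by decide), hf₁₃.2 11 (by decide), h11₁, pow_succ]
    ring
  · rw [hf₀₄.2 17 (by decide), h.bound]

/-! #### The program -/

/-- Compute the constants. -/
def initConsts : Prog :=
  .seq (setRvar 13 (.add (.mul (.load 0 (.lit 0) (.lit 1)) (.load 0 (.lit 0) (.lit 1))) (.lit 1)))
    (.seq (setRvar 11 (.lit (1 / 2))) (setRvar 17 (.mul (.ofNat inputN)
      (.mul (.load 0 (.lit 0) (.lit 1)) (.load 0 (.lit 0) (.lit 1))))))

/-- Local-search++ with outliers. -/
def localSearchProg : Prog := .seq initConsts (.while (.realLT (rvar 11) (rvar 17)) guessStep)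

/-- The memory holds 2^i/2 before round i, so one comparison decides whether the round takes place
and the machine needs no logarithm. -/
theorem lt_ceil_logb_iff {v : ℝ} (hv : 1 ≤ v) (i : ℕ) :
    (2 : ℝ) ^ i / 2 < v ↔ i < ⌈Real.logb 2 v⌉₊ + 1 := by
  rcases i with _ | i
  · simp; linarith
  · rw [pow_succ, mul_div_cancel_right₀ _ two_ne_zero, Nat.add_lt_add_iff_right, Nat.lt_ceil,
      Real.lt_logb_iff_rpow_lt one_lt_two (by linarith), Real.rpow_natCast]

theorem guessRounds_eq_iterLaw (am : ArgminRule (Pt d)) (X : Finset (Pt d)) (r : ℕ) :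
    guessRounds am X k z ε N r = iterLaw (guessRound am X k z ε N) r (∅, ∅) := by
  induction r with
  | zero => rfl
  | succ r ih => rw [guessRounds, ih]; rfl

/-- All-zero memory already represents `∅`, so the trees need no initialization. -/
theorem forest_inputMem : Forest x Δ ∅ (inputMem n k z N ε Δ) := by
  intro i _
  refine ⟨fun y _ => by simp [inputMem, idx], fun y _ hy => by simp [idx] at hy, fun v _ _ => ?_⟩
  simp [NodeOK, inputMem]

theorem BestRep.outputOf_eq (h : BestRep x best m) : outputOf x m = best := by
  refine Prod.ext ?_ ?_
  · ext y
    simp only [outputOf, Finset.mem_image, Finset.mem_filter, Finset.mem_univ, true_and]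
    constructor
    · rintro ⟨i, hi, rfl⟩
      have := (h.flag_fst i i.2).1 hi
      rwa [pt_val] at this
    · intro hy
      obtain ⟨i, -, rfl⟩ := Finset.mem_image.1 (h.subset_fst hy)
      exact ⟨i, (h.flag_fst i i.2).2 (by rwa [pt_val]), rfl⟩
  · ext y
    simp only [outputOf, Finset.mem_image, Finset.mem_filter, Finset.mem_univ, true_and]
    constructor
    · rintro ⟨i, hi, rfl⟩
      have := (h.flag_snd i i.2).1 hi
      rwa [pt_val] at this
    · intro hy
      obtain ⟨i, -, rfl⟩ := Finset.mem_image.1 (h.subset_snd hy)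
      exact ⟨i, (h.flag_snd i i.2).2 (by rwa [pt_val]), rfl⟩

theorem Wp.implements {P : Prog} {t : ℕ} {μ : PMF (Finset (Pt d) × Finset (Pt d))}
    {Q : Finset (Pt d) × Finset (Pt d) → Mem → Prop}
    (h : Wp (sqDistOracle x) P (inputMem n k z N ε Δ) t μ Q)
    (hQ : ∀ b m, Q b m → outputOf x m = b) : Implements P x k z N ε Δ t μ := by
  have := h _ (outputOf x) [] 0 PMF.pure fun b _ m' hm' =>
    ⟨fun s hs => by
      rw [runFor, PMF.support_pure, Set.mem_singleton_iff] at hs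
      rw [hs], by rw [runFor, PMF.pure_map, hQ b m' hm']⟩
  rw [PMF.bind_pure] at this
  exact this

theorem implements_localSearchProg (hε : 0 < ε) (hx : Function.Injective x)
    (hX : SpreadBetween (Finset.univ.image x) Δ) (hk : 1 ≤ k) (hkn : k < n) (hv : 1 ≤ n * Δ ^ 2)
    {L : ℕ} (hL : n ≤ 2 ^ L) :
    Implements localSearchProg x k z N ε Δ
      ((⌈Real.logb 2 (n * Δ ^ 2)⌉₊ + 1) * ((k + N) * (n * (40 * L + 117) + 62) + 18) + 7)
      (localSearchOutliers (indexRule x) (Finset.univ.image x) k z ε Δ N) := by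
  have hXc : (Finset.univ.image x).card = n := by
    rw [Finset.card_image_of_injective _ hx]; simp
  refine Wp.implements (Q := RoundStart x k z N ε Δ (⌈Real.logb 2 (n * Δ ^ 2)⌉₊ + 1)) ?_
    fun b m hm => hm.best.outputOf_eq
  rw [localSearchOutliers, hXc, guessRounds_eq_iterLaw]
  refine (Det.seq_wp (det_sem initConsts (by exact ⟨trivial, trivial, trivial⟩) _)
    fun m hm => Wp.while_iter (I := RoundStart x k z N ε Δ) (fun i b m h => ?_)
      (fun i _ b m h => wp_guessStep hε hx hX hk hkn hL h) ?_).conseq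
    (by simp only [initConsts, Prog.size, setRvar, Nat.add_assoc]; norm_num; omega)
      fun _ _ _ h => h
  · rw [← lt_ceil_logb_iff hv]
    simp [BExpr.holds, rvar, RExpr.eval, NExpr.eval, h.guess, h.bound]
  · have hs : initConsts.sem (sqDistOracle x) (inputMem n k z N ε Δ) =
        (((inputMem n k z N ε Δ).setReal 13 0 0 (Δ * Δ + 1)).setReal 11 0 0 (2 ^ 0 / 2)).setReal
          17 0 0 (n * Δ ^ 2) := by
      simp [initConsts, Prog.sem, setRvar, RExpr.eval, NExpr.eval, inputN, Mem.setReal, inputMem, sq]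
    rw [hs] at hm
    have hf : Frame [] [11, 13, 17] (inputMem n k z N ε Δ) m := by
      rw [hm]
      exact (((Frame.refl _ _ _).setReal (by decide) _ _ _).setReal (by decide) _ _ _).setReal
        (by decide) _ _ _
    refine ⟨⟨hf.1 0 (by decide), hf.2 0 (by decide), by simp [hm, Mem.setReal]⟩,
      by simp [hm, Mem.setReal], by simp [hm, Mem.setReal],
      ⟨Finset.empty_subset _, Finset.empty_subset _, ?_, ?_, Or.inl ⟨?_, rfl⟩⟩,
      ∅, ⟨Finset.empty_subset _, forest_inputMem.congr (hf.1 3 (by decide)) (hf.2 3 (by decide)), ?_⟩,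
      by simp⟩
    · intro y _; rw [hf.1 1 (by decide)]; simp [inputMem]
    · intro y _; rw [hf.1 1 (by decide)]; simp [inputMem]
    · rw [hf.1 19 (by decide)]; simp [inputMem]
    · intro y _; rw [hf.1 2 (by decide)]; simp [inputMem]

end Rounds

/-! ### The running time -/

section Time

/-- Uses 2/log 2 < 3; rounding up costs one more log 2 ≤ M. -/
theorem le_three_mul_of_le_logb {M a : ℝ} (hM : Real.log 2 ≤ M)
    (ha : a * Real.log 2 ≤ M + Real.log 2) : a ≤ 3 * M := by
  have h2 := Real.log_two_gt_d9
  by_contra hcon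
  push Not at hcon
  nlinarith

theorem numSteps_le {A : ℝ} (hA : 0 < A) {k : ℕ} (hk : 1 ≤ k) {ε M : ℝ} (hε : 0 < ε) (hε1 : ε ≤ 1)
    (hM : 1 ≤ 2 * M) (hkM : Real.log k ≤ M) (hεM : Real.log (1 / ε) ≤ M) :
    (k + numSteps A k ε : ℝ) ≤ 4 * (A + 1) * M * (k / ε) := by
  have hk1 : (1 : ℝ) ≤ k := by exact_mod_cast hk
  have hM0 : 0 ≤ M := by linarith
  have hkε : (k : ℝ) ≤ k / ε := (le_div_iff₀ hε).2 (by nlinarith)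
  have h1 : max 1 (Real.log (Real.log k)) ≤ 2 * M :=
    max_le hM ((Real.log_le_self (Real.log_nonneg hk1)).trans (by linarith))
  have h2 : max 1 (Real.log (1 / ε)) ≤ 2 * M := max_le hM (by linarith)
  have h3 : k * max 1 (Real.log (Real.log k)) + k * max 1 (Real.log (1 / ε)) / ε ≤
      4 * M * (k / ε) := by
    have h4 : k * max 1 (Real.log (Real.log k)) ≤ k / ε * (2 * M) :=
      mul_le_mul hkε h1 (by positivity) (by positivity)
    have h5 : k * max 1 (Real.log (1 / ε)) / ε ≤ k / ε * (2 * M) := by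
      rw [mul_div_right_comm]
      exact mul_le_mul_of_nonneg_left h2 (by positivity)
    linarith
  have h4 : (numSteps A k ε : ℝ) ≤ A * (4 * M * (k / ε)) + 1 := by
    refine (Nat.ceil_lt_add_one (by positivity)).le.trans ?_
    have := mul_le_mul_of_nonneg_left h3 hA.le
    linarith
  nlinarith [mul_le_mul_of_nonneg_left hM (show 0 ≤ (k : ℝ) / ε by positivity)]

/-- With M = log(nΔ/ε): at most 6M rounds, k + N ≤ 4(A+1)Mk/ε operations in each, and 244nL steps
per operation with tree depth L ≤ 3M. The constant is 6·4·244·3 = 17568. -/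
theorem time_le {A : ℝ} (hA : 0 < A) {n k : ℕ} (hk : 1 ≤ k) (hkn : k < n) {ε Δ : ℝ} (hε : 0 < ε)
    (hε1 : ε ≤ 1) (hΔ : 1 ≤ Δ) :
    (((⌈Real.logb 2 (n * Δ ^ 2)⌉₊ + 1) * ((k + numSteps A k ε) *
      (n * (40 * (Nat.log 2 n + 1) + 117) + 62) + 18) + 7 : ℕ) : ℝ) ≤
      17568 * (A + 1) * (n * k / ε) * Real.log (n * Δ / ε) ^ 3 := by
  have hk1 : (1 : ℝ) ≤ k := by exact_mod_cast hk
  have hn : (2 : ℝ) ≤ n := by exact_mod_cast (by omega : 2 ≤ n)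
  have hkn' : (k : ℝ) ≤ n := by exact_mod_cast hkn.le
  obtain ⟨M, hMdef⟩ : ∃ M, M = Real.log (n * Δ / ε) := ⟨_, rfl⟩
  have hle : ∀ a : ℝ, 0 < a → a * ε ≤ n * Δ → Real.log a ≤ M := fun a ha h => by
    rw [hMdef]
    exact Real.log_le_log ha ((le_div_iff₀ hε).2 h)
  have hnΔ : (n : ℝ) ≤ n * Δ := by nlinarith
  have h2M : Real.log 2 ≤ M := hle 2 two_pos (by nlinarith)
  have hnM : Real.log n ≤ M := hle n (by linarith) (by nlinarith)
  have hl2 := Real.log_two_gt_d9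
  have hM : 1 ≤ 2 * M := by linarith
  have hεM : Real.log (1 / ε) ≤ M :=
    hle _ (by positivity) (by rw [one_div, inv_mul_cancel₀ hε.ne']; nlinarith)
  have hkM : Real.log k ≤ M := (Real.log_le_log (by linarith) hkn').trans hnM
  have hΔM : Real.log (n * Δ ^ 2) ≤ 2 * M := by
    have h1 := hle (n * Δ) (by positivity) (by nlinarith)
    have h2 : Real.log (n * Δ ^ 2) ≤ Real.log ((n * Δ) ^ 2) := by
      refine Real.log_le_log (by positivity) ?_
      rw [mul_pow]
      exact mul_le_mul_of_nonneg_right (by nlinarith) (by positivity)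
    rw [Real.log_pow] at h2
    push_cast at h2
    linarith
  have hN := numSteps_le hA hk hε hε1 hM hkM hεM
  obtain ⟨L, hL⟩ : ∃ L, L = Nat.log 2 n + 1 := ⟨_, rfl⟩
  have hLM : (L : ℝ) ≤ 3 * M := by
    refine le_three_mul_of_le_logb h2M ?_
    have h1 : ((2 : ℝ) ^ Nat.log 2 n) ≤ n := by exact_mod_cast Nat.pow_log_le_self 2 (by omega)
    have h2 := Real.log_le_log (by positivity) h1
    rw [Real.log_pow] at h2
    rw [hL]
    push_cast
    linarith
  obtain ⟨R, hR⟩ : ∃ R, R = ⌈Real.logb 2 (n * Δ ^ 2)⌉₊ + 1 := ⟨_, rfl⟩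
  have hRM : (R : ℝ) ≤ 6 * M := by
    have h1 : (1 : ℝ) ≤ n * Δ ^ 2 := by nlinarith [sq_nonneg (Δ - 1)]
    have h2 := (Nat.ceil_lt_add_one (Real.logb_nonneg one_lt_two h1)).le
    have h3 : Real.logb 2 (n * Δ ^ 2) * Real.log 2 = Real.log (n * Δ ^ 2) :=
      div_mul_cancel₀ _ (by linarith)
    have h4 : (R : ℝ) ≤ Real.logb 2 (n * Δ ^ 2) + 2 := by
      rw [hR]; push_cast; linarith
    have h5 := le_three_mul_of_le_logb (a := R / 2) h2M (by nlinarith)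
    linarith
  rw [← hL, ← hR]
  have hT : R * ((k + numSteps A k ε) * (n * (40 * L + 117) + 62) + 18) + 7 ≤
      R * ((k + numSteps A k ε) * (n * (244 * L))) := by
    have hR1 : 1 ≤ R := by omega
    have hL1 : 1 ≤ L := by omega
    have hn1 : 1 ≤ n := by omega
    have hk1 : 1 ≤ k + numSteps A k ε := by omega
    -- 244 = 40 + 117 + 62 + 25, and n, L ≥ 1; the 25 = 18 + 7 collects the overhead of a round and
    -- of the program.
    have h1 : n * (40 * L + 117) + 62 + 25 ≤ n * (244 * L) := by nlinarith
    calc R * ((k + numSteps A k ε) * (n * (40 * L + 117) + 62) + 18) + 7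
        ≤ R * ((k + numSteps A k ε) * (n * (40 * L + 117) + 62) + 25) := by nlinarith
      _ ≤ R * ((k + numSteps A k ε) * (n * (40 * L + 117) + 62 + 25)) := by
          refine Nat.mul_le_mul_left R ?_; nlinarith
      _ ≤ _ := Nat.mul_le_mul_left R (Nat.mul_le_mul_left _ h1)
  refine (Nat.cast_le.2 hT).trans ?_
  push_cast
  have hM0 : 0 ≤ M := by linarith
  calc (R : ℝ) * ((k + numSteps A k ε) * (n * (244 * L)))
      ≤ 6 * M * (4 * (A + 1) * M * (k / ε) * (n * (244 * (3 * M)))) := by gcongr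
    _ = 17568 * (A + 1) * (n * k / ε) * Real.log (n * Δ / ε) ^ 3 := by rw [← hMdef]; ring

end Time

theorem mainTheorem1 :
    -- the guarantee of the algorithm
    (∃ A₀ c p : ℝ, 0 < A₀ ∧ 0 < c ∧ 0 < p ∧
      ∀ (A : ℝ), A₀ ≤ A →
      ∀ (d k z : ℕ) (ε Δ : ℝ) (X : Finset (Pt d)),
        0 < ε → ε ≤ 1 → 1 ≤ k → k + z < X.card → SpreadBetween X Δ →
        ∀ am : ArgminRule (Pt d),
          ENNReal.ofReal p ≤
            (localSearchOutliers am X k z ε Δ (numSteps A k ε)).toOuterMeasure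
              {o | GoodOutput X k z ε c o}) ∧
    -- the running time `Õ(nk/ε)`
    (∃ (P : Prog) (q : ℕ), ∀ (A : ℝ), 0 < A → ∃ K : ℝ, 0 < K ∧
      ∀ (d n k z : ℕ) (ε Δ : ℝ) (x : Fin n → Pt d),
        0 < ε → ε ≤ 1 → 1 ≤ k → k + z < n → Function.Injective x →
        SpreadBetween (Finset.univ.image x) Δ →
        ∃ (am : ArgminRule (Pt d)) (T : ℕ),
          (T : ℝ) ≤ K * (n * k / ε) * Real.log (n * Δ / ε) ^ q ∧
          Implements P x k z (numSteps A k ε) ε Δ T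
            (localSearchOutliers am (Finset.univ.image x) k z ε Δ (numSteps A k ε))) := by
  refine ⟨⟨50000, 60000, 1 / 2, by norm_num, by norm_num, by norm_num, ?_⟩, ?_⟩
  · intro A hA d k z ε Δ X hε hε1 hk hkz hX am
    exact half_le_localSearchOutliers hA hε hε1 hk hkz hX am
  · refine ⟨localSearchProg, 3, fun A hA => ⟨17568 * (A + 1), by positivity, ?_⟩⟩
    intro d n k z ε Δ x hε hε1 hk hkz hx hX
    -- Since 1 ≤ k and k + z < n, there are at least two points, whose distance lies between 1 and
    -- Δ.
    have hΔ : 1 ≤ Δ := by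
      have h := hX _ (pt_mem (show 0 < n by omega)) _ (pt_mem (show 1 < n by omega))
        fun h => absurd (pt_inj hx (by omega) (by omega) h) zero_ne_one
      exact h.1.trans h.2
    have hn : (1 : ℝ) ≤ n := by exact_mod_cast (by omega : 1 ≤ n)
    exact ⟨indexRule x, _, time_le hA hk (by omega) hε hε1 hΔ,
      implements_localSearchProg hε hx hX hk (by omega)
        (one_le_mul_of_one_le_of_one_le hn (one_le_pow₀ hΔ))
        (Nat.lt_pow_succ_log_self one_lt_two n).le⟩
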